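/- **Setting.** Let $G$ be a locally compact unimodular group with Haar measure $dg$, acting properly, cocompactly and isometrically on a complete Riemannian manifold $X$ with Riemannian volume $dx$. Let $E=E_0\oplus E_1$ be a $\mathbb{Z}/2$-graded smooth complex $G$-vector bundle over $X$ of finite rank with a smooth $G$-invariant Hermitian structure, and let $L^2(X,E_i)$ be the completion of $C_c^\infty(X,E_i)$ for $\langle u,v\rangle=\int_X\langle u(x),v(x)\rangle\,dx$. The group $G$ acts on sections by $(g\cdot u)(x)=g(u(g^{-1}x))$. For $m\in\mathbb{R}$ let $P=\begin{pmatrix}0&P_0^*\\P_0&0\end{pmatrix}$, where $P_0:C_c^\infty(X,E_0)\to C_c^\infty(X,E_1)$ is a $G$-invariant, properly supported pseudo-differential operator of order $m$ with formal adjoint $P_0^*:C_c^\infty(X,E_1)\to C_c^\infty(X,E_0)$. Assume that $P$ is elliptic: there is a pseudo-differential operator $R$ of order $-m$ from $E_1$ to $E_0$ whose principal symbol satisfies $\|\sigma_{P_0}(x,\xi)\sigma_R(x,\xi)-1\|\to0$ and $\|\sigma_R(x,\xi)\sigma_{P_0}(x,\xi)-1\|\to0$ as $\xi\to\infty$ in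 $T_x^*X$, uniformly for $x$ in compact sets. Write $\operatorname{Ker}P_0\subset L^2(X,E_0)$ for the kernel of the closure of $P_0$ (its bounded extension if $m\le 0$) and $\operatorname{Ker}P_0^*\subset L^2(X,E_1)$ for the kernel of the Hilbert space adjoint. A bounded operator $S$ on $L^2(X,E_i)$ that commutes with $G$ is of *$G$-trace class* if $\phi|S|\psi$ is of trace class for all $\phi,\psi\in C_c^\infty(X)$. Its *$G$-trace* is $\operatorname{tr}_G S=\operatorname{tr}(c_1Sc_2)$, where $c_1,c_2\in C_c^\infty(X)$ are any nonnegative functions with $\int_G c_1(g^{-1}x)c_2(g^{-1}x)\,dg=1$ for all $x\in X$. The *$L^2$-index* of $P$ is $$\operatorname{ind}P=\operatorname{tr}_G P_{\operatorname{Ker}P_0}-\operatorname{tr}_G P_{\operatorname{Ker}P_0^*},$$ where $P_K$ denotes the orthogonal projection onto $K$. **Proposition.** Let $Q$ be a (possibly unbounded) closable operator from $L^2(X,E_1)$ to $L^2(X,E_0)$ whose domain contains $C_c^\infty(X,E_1)$, and let $S_1$ on $L^2(X,E_0)$ and $S_2$ on $L^2(X,E_1)$ be $G$-trace class operators with $$1-QP_0=S_1\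 \text{ on } C_c^\infty(X,E_0),\qquad 1-P_0Q=S_2\ \text{ on } C_c^\infty(X,E_1),$$ where in the second equation $P_0$ stands for its closure. Then $P_{\operatorname{Ker}P_0}$ and $P_{\operatorname{Ker}P_0^*}$ are of $G$-trace class and, for every choice of the functions $c_1,c_2$ in each of the four $G$-traces, $$\operatorname{ind}P=\operatorname{tr}_G S_1-\operatorname{tr}_G S_2 .$$ -/

import Mathlib

open MeasureTheory Bundle Set Filter
open scoped Manifold ContDiff Bundle Topology InnerProductSpace

noncomputable section

namespace GIndex

set_option linter.unusedSectionVars false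
set_option linter.unusedTactic false

/-! ### Smooth sections and test functions -/

section Sections

variable (n : ℕ) {X : Type*} [TopologicalSpace X] [ChartedSpace (EuclideanSpace ℝ (Fin n)) X]
  (F : Type*) [NormedAddCommGroup F] [NormedSpace ℂ F]
  (V : X → Type*) [TopologicalSpace (TotalSpace F V)]
  [∀ x, NormedAddCommGroup (V x)] [∀ x, InnerProductSpace ℂ (V x)] [FiberBundle F V]

/-- The section `s` of the bundle `V` is smooth. -/
def IsSmoothSection (s : ∀ x, V x) : Prop :=
  ContMDiff (𝓡 n) ((𝓡 n).prod 𝓘(ℝ, F)) ∞ (fun x => TotalSpace.mk' F x (s x))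

/-- The compactly supported smooth complex valued functions on `X`. -/
structure TestFun (X : Type*) [TopologicalSpace X]
    [ChartedSpace (EuclideanSpace ℝ (Fin n)) X] where
  toFun : X → ℂ
  smooth : ContMDiff (𝓡 n) 𝓘(ℝ, ℂ) ∞ toFun
  compact : HasCompactSupport toFun

instance : CoeFun (TestFun n X) (fun _ => X → ℂ) := ⟨TestFun.toFun⟩

variable [VectorBundle ℂ F V] [VectorBundle ℝ F V]

variable {n F V} in
theorem IsSmoothSection.smul {φ : X → ℂ} (hφ : ContMDiff (𝓡 n) 𝓘(ℝ, ℂ) ∞ φ)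
    {s : ∀ x, V x} (hs : IsSmoothSection n F V s) :
    IsSmoothSection n F V (fun x => φ x • s x) := by
  intro x₀
  have h := hs x₀
  rw [contMDiffAt_section] at h ⊢
  have hb : ContDiff ℝ ∞ (fun p : ℂ × F => p.1 • p.2) := isBoundedBilinearMap_smul.contDiff
  refine (hb.contMDiff.contMDiffAt.comp x₀ ((hφ x₀).prodMk_space h)).congr_of_eventuallyEq ?_
  filter_upwards [(trivializationAt F V x₀).open_baseSet.mem_nhds
    (mem_baseSet_trivializationAt F V x₀)] with y hy
  exact ((trivializationAt F V x₀).linear ℂ hy).2 (φ y) (s y)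

variable {n F V} in
theorem IsSmoothSection.add {s t : ∀ x, V x} (hs : IsSmoothSection n F V s)
    (ht : IsSmoothSection n F V t) : IsSmoothSection n F V (fun x => s x + t x) := by
  intro x₀
  have h := hs x₀
  have h' := ht x₀
  rw [contMDiffAt_section] at h h' ⊢
  refine (h.add h').congr_of_eventuallyEq ?_
  filter_upwards [(trivializationAt F V x₀).open_baseSet.mem_nhds
    (mem_baseSet_trivializationAt F V x₀)] with y hy
  exact ((trivializationAt F V x₀).linear ℂ hy).1 (s y) (t y)

/-- The space `C_c^∞(X, V)` of smooth sections with compact support. -/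
def testSections : Submodule ℂ (∀ x, V x) where
  carrier := {s | IsSmoothSection n F V s ∧ ∃ K : Set X, IsCompact K ∧ ∀ x ∉ K, s x = 0}
  zero_mem' := ⟨contMDiff_zeroSection ℝ V, ∅, isCompact_empty, fun _ _ => rfl⟩
  add_mem' := by
    rintro s t ⟨hs, K, hK, hsK⟩ ⟨ht, L, hL, htL⟩
    refine ⟨hs.add ht, K ∪ L, hK.union hL, fun x hx => ?_⟩
    simp only [Set.mem_union, not_or] at hx
    simp [hsK x hx.1, htL x hx.2]
  smul_mem' := by
    rintro c s ⟨hs, K, hK, hsK⟩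
    refine ⟨hs.smul (φ := fun _ => c) contMDiff_const, K, hK, fun x hx => ?_⟩
    simp [hsK x hx]

variable {n F V} in
/-- Multiplication of a test section by a test function. -/
def TestFun.mulTest (φ : TestFun n X) : testSections n F V →ₗ[ℂ] testSections n F V where
  toFun s := ⟨fun x => φ x • s.1 x, s.2.1.smul φ.smooth, by
    obtain ⟨K, hK, h⟩ := s.2.2
    exact ⟨K, hK, fun x hx => by simp [h x hx]⟩⟩
  map_add' s t := by
    ext x
    exact smul_add _ _ _
  map_smul' c s := by
    ext x
    exact smul_comm _ _ _

end Sections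

/-! ### The Hilbert space of square integrable sections -/

section L2

/-- The Hermitian structure on the fibres of `V` depends smoothly on the base point. -/
class IsSmoothHermitian (n : ℕ) {X : Type*} [TopologicalSpace X]
    [ChartedSpace (EuclideanSpace ℝ (Fin n)) X]
    (F : Type*) [NormedAddCommGroup F] [NormedSpace ℂ F]
    (V : X → Type*) [TopologicalSpace (TotalSpace F V)]
    [∀ x, NormedAddCommGroup (V x)] [∀ x, InnerProductSpace ℂ (V x)] [FiberBundle F V] :
    Prop where
  smooth_inner : ∀ (U : Set X), IsOpen U → ∀ s t : ∀ x, V x,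
    ContMDiffOn (𝓡 n) ((𝓡 n).prod 𝓘(ℝ, F)) ∞ (fun x => TotalSpace.mk' F x (s x)) U →
    ContMDiffOn (𝓡 n) ((𝓡 n).prod 𝓘(ℝ, F)) ∞ (fun x => TotalSpace.mk' F x (t x)) U →
    ContMDiffOn (𝓡 n) 𝓘(ℝ, ℂ) ∞ (fun x => ⟪s x, t x⟫_ℂ) U

variable (n : ℕ) {X : Type*} [TopologicalSpace X] [ChartedSpace (EuclideanSpace ℝ (Fin n)) X]
  (F : Type*) [NormedAddCommGroup F] [NormedSpace ℂ F]
  (V : X → Type*) [TopologicalSpace (TotalSpace F V)]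
  [∀ x, NormedAddCommGroup (V x)] [∀ x, InnerProductSpace ℂ (V x)] [FiberBundle F V]
  [VectorBundle ℂ F V] [VectorBundle ℝ F V] [IsSmoothHermitian n F V]
  [MeasurableSpace X] [BorelSpace X] (ν : Measure X)

variable {n F V} in
theorem continuous_inner_section (s t : testSections n F V) :
    Continuous (fun x => ⟪s.1 x, t.1 x⟫_ℂ) :=
  (contMDiffOn_univ.1 (IsSmoothHermitian.smooth_inner univ isOpen_univ s.1 t.1
    s.2.1.contMDiffOn t.2.1.contMDiffOn)).continuous

variable {n F V} in
theorem integrable_inner_section [T2Space X] [IsFiniteMeasureOnCompacts ν]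
    (s t : testSections n F V) : Integrable (fun x => ⟪s.1 x, t.1 x⟫_ℂ) ν := by
  refine (continuous_inner_section s t).integrable_of_hasCompactSupport ?_
  obtain ⟨K, hK, h⟩ := s.2.2
  exact HasCompactSupport.intro hK fun x hx => by simp [h x hx]

/-- The space `C_c^∞(X, V)` with the inner product `∫ ⟨s x, t x⟩ dν x`. -/
def PreL2 (_ : Measure X) : Type _ := testSections n F V

variable [T2Space X] [IsFiniteMeasureOnCompacts ν]

instance : AddCommGroup (PreL2 n F V ν) := inferInstanceAs (AddCommGroup (testSections n F V))

instance : Module ℂ (PreL2 n F V ν) := inferInstanceAs (Module ℂ (testSections n F V))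

instance preL2Core : PreInnerProductSpace.Core ℂ (PreL2 n F V ν) where
  inner s t := ∫ x, ⟪s.1 x, t.1 x⟫_ℂ ∂ν
  conj_inner_symm s t := by
    change (starRingEnd ℂ) (∫ x, ⟪t.1 x, s.1 x⟫_ℂ ∂ν) = ∫ x, ⟪s.1 x, t.1 x⟫_ℂ ∂ν
    rw [← integral_conj]
    simp only [inner_conj_symm]
  re_inner_nonneg s := by
    change 0 ≤ RCLike.re (∫ x, ⟪s.1 x, s.1 x⟫_ℂ ∂ν)
    rw [← integral_re (integrable_inner_section ν s s)]
    exact integral_nonneg fun x => inner_self_nonneg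
  add_left s t u := by
    change ∫ x, ⟪s.1 x + t.1 x, u.1 x⟫_ℂ ∂ν = ∫ x, ⟪s.1 x, u.1 x⟫_ℂ ∂ν + ∫ x, ⟪t.1 x, u.1 x⟫_ℂ ∂ν
    rw [← integral_add (integrable_inner_section ν s u) (integrable_inner_section ν t u)]
    simp only [inner_add_left]
  smul_left s t c := by
    change ∫ x, ⟪c • s.1 x, t.1 x⟫_ℂ ∂ν = (starRingEnd ℂ) c * ∫ x, ⟪s.1 x, t.1 x⟫_ℂ ∂ν
    rw [← integral_const_mul]
    simp only [inner_smul_left]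

instance : SeminormedAddCommGroup (PreL2 n F V ν) :=
  InnerProductSpace.Core.toSeminormedAddCommGroup (𝕜 := ℂ)

instance : InnerProductSpace ℂ (PreL2 n F V ν) :=
  InnerProductSpace.ofCore (preL2Core n F V ν)

/-- The Hilbert space `L²(X, V)`: the completion of the compactly supported sections for the
inner product `∫ ⟨s x, t x⟩ dν x`. -/
abbrev L2 : Type _ := UniformSpace.Completion (PreL2 n F V ν)

variable {n F V} in
/-- The canonical map `C_c^∞(X, V) → L²(X, V)`. -/
def toL2 : testSections n F V →ₗ[ℂ] L2 n F V ν :=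
  ((UniformSpace.Completion.toComplL : PreL2 n F V ν →L[ℂ] L2 n F V ν) :
    PreL2 n F V ν →ₗ[ℂ] L2 n F V ν)

theorem TestFun.bounded (φ : TestFun n X) : ∃ C : ℝ, 0 ≤ C ∧ ∀ x, ‖φ x‖ ≤ C := by
  obtain ⟨C, hC⟩ := φ.compact.exists_bound_of_continuous φ.smooth.continuous
  exact ⟨max C 0, le_max_right _ _, fun x => (hC x).trans (le_max_left _ _)⟩

theorem TestFun.norm_mulTest_le (φ : TestFun n X) : ∃ C : ℝ, ∀ s : PreL2 n F V ν,
    ‖(show PreL2 n F V ν from φ.mulTest (F := F) (V := V) s)‖ ≤ C * ‖s‖ := by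
  obtain ⟨C, hC0, hC⟩ := TestFun.bounded n φ
  refine ⟨C, fun s => ?_⟩
  set t : PreL2 n F V ν := φ.mulTest (F := F) (V := V) s with ht
  refine le_of_sq_le_sq ?_ (by positivity)
  rw [mul_pow, ← inner_self_eq_norm_sq (𝕜 := ℂ) t, ← inner_self_eq_norm_sq (𝕜 := ℂ) s]
  change RCLike.re (∫ x, ⟪t.1 x, t.1 x⟫_ℂ ∂ν) ≤ C ^ 2 * RCLike.re (∫ x, ⟪s.1 x, s.1 x⟫_ℂ ∂ν)
  rw [← integral_re (integrable_inner_section ν t t),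
    ← integral_re (integrable_inner_section ν s s), ← integral_const_mul]
  refine integral_mono (integrable_inner_section ν t t).re
    ((integrable_inner_section ν s s).re.const_mul _) fun x => ?_
  have hx : t.1 x = φ x • s.1 x := rfl
  simp only [inner_self_eq_norm_sq, hx, norm_smul, mul_pow]
  gcongr
  exact hC x

/-- Multiplication by a test function, as a bounded operator on `L²(X, V)`. -/
def mulOp (φ : TestFun n X) : L2 n F V ν →L[ℂ] L2 n F V ν :=
  ContinuousLinearMap.completion
    (LinearMap.mkContinuousOfExistsBound
      (show PreL2 n F V ν →ₗ[ℂ] PreL2 n F V ν from φ.mulTest (F := F) (V := V))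
      (TestFun.norm_mulTest_le n F V ν φ))

end L2

/-! ### The Riemannian volume and isometric group actions -/

section Geometry

variable (n : ℕ) {X : Type*} [TopologicalSpace X] [ChartedSpace (EuclideanSpace ℝ (Fin n)) X]
  [RiemannianBundle (fun x : X => TangentSpace (𝓡 n) x)]

/-- The matrix `(g_ij)` of the Riemannian metric in the coordinates given by the chart `e`, at the
point with coordinates `y`. -/
def gramMatrix (e : OpenPartialHomeomorph X (EuclideanSpace ℝ (Fin n)))
    (y : EuclideanSpace ℝ (Fin n)) : Matrix (Fin n) (Fin n) ℝ :=
  Matrix.of fun i j =>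
    inner ℝ (mfderiv (𝓡 n) (𝓡 n) e.symm y (EuclideanSpace.single i (1 : ℝ)))
      (mfderiv (𝓡 n) (𝓡 n) e.symm y (EuclideanSpace.single j (1 : ℝ)))

/-- `ν` is the Riemannian volume measure: in every chart it has the density `√(det g_ij)` with
respect to Lebesgue measure. -/
def IsRiemannianVolume [MeasurableSpace X] (ν : Measure X) : Prop :=
  ∀ e ∈ IsManifold.maximalAtlas (𝓡 n) ∞ X, ∀ A : Set X, MeasurableSet A → A ⊆ e.source →
    ν A = ∫⁻ y in e '' A, ENNReal.ofReal (Real.sqrt (gramMatrix n e y).det)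

/-- Every element of `G` acts on `X` by a smooth isometry of the Riemannian metric. -/
structure IsIsometricAction (G : Type*) [Group G] (X : Type*) [TopologicalSpace X]
    [ChartedSpace (EuclideanSpace ℝ (Fin n)) X]
    [RiemannianBundle (fun x : X => TangentSpace (𝓡 n) x)] [MulAction G X] : Prop where
  smooth : ∀ g : G, ContMDiff (𝓡 n) (𝓡 n) ∞ (fun x : X => g • x)
  inner_map : ∀ (g : G) (x : X) (v w : TangentSpace (𝓡 n) x),
    inner ℝ (mfderiv (𝓡 n) (𝓡 n) (fun x : X => g • x) x v)
      (mfderiv (𝓡 n) (𝓡 n) (fun x : X => g • x) x w) = inner ℝ v w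

end Geometry

section Action

variable (n : ℕ) {X : Type*} [TopologicalSpace X] [ChartedSpace (EuclideanSpace ℝ (Fin n)) X]
  (G : Type*) [Group G] [TopologicalSpace G] [MulAction G X]
  (F : Type*) [NormedAddCommGroup F] [NormedSpace ℂ F]
  (V : X → Type*) [TopologicalSpace (TotalSpace F V)]
  [∀ x, NormedAddCommGroup (V x)] [∀ x, InnerProductSpace ℂ (V x)] [FiberBundle F V]

/-- An action of `G` on the vector bundle `V` that covers the action on `X`, is linear on the
fibres and preserves the Hermitian structure. -/
structure BundleAction where
  act : ∀ (g : G) (x : X), V x →ₗ[ℂ] V (g • x)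
  act_one : ∀ (x : X) (v : V x),
    (⟨(1 : G) • x, act 1 x v⟩ : TotalSpace F V) = ⟨x, v⟩
  act_mul : ∀ (g h : G) (x : X) (v : V x),
    (⟨(g * h) • x, act (g * h) x v⟩ : TotalSpace F V) = ⟨g • h • x, act g (h • x) (act h x v)⟩
  norm_act : ∀ (g : G) (x : X) (v : V x), ‖act g x v‖ = ‖v‖
  continuous_act : Continuous
    (fun p : G × TotalSpace F V => (⟨p.1 • p.2.1, act p.1 p.2.1 p.2.2⟩ : TotalSpace F V))
  smooth_act : ∀ g : G, ContMDiff ((𝓡 n).prod 𝓘(ℝ, F)) ((𝓡 n).prod 𝓘(ℝ, F)) ∞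
    (fun p : TotalSpace F V => (⟨g • p.1, act g p.1 p.2⟩ : TotalSpace F V))

variable {n G F V}

/-- `s' = g · s`, where `(g · s) (x) = g (s (g⁻¹ x))`; in other words `s' (g x) = g (s x)`. -/
def BundleAction.IsTranslate (ρ : BundleAction n G F V) (g : G) (s s' : ∀ x, V x) : Prop :=
  ∀ x, s' (g • x) = ρ.act g x (s x)

variable [VectorBundle ℂ F V] [VectorBundle ℝ F V] [IsSmoothHermitian n F V]
  [MeasurableSpace X] [BorelSpace X] [T2Space X]

/-- The graph of the unitary operator on `L²(X, V)` by which `g` acts: the closure of the graph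
of `s ↦ g · s` on test sections. -/
def BundleAction.graphL2 (ρ : BundleAction n G F V) (ν : Measure X) [IsFiniteMeasureOnCompacts ν]
    (g : G) : Set (L2 n F V ν × L2 n F V ν) :=
  closure {p | ∃ s s' : testSections n F V, ρ.IsTranslate g s.1 s'.1 ∧
    p = (toL2 ν s, toL2 ν s')}

/-- The bounded operator `S` on `L²(X, V)` commutes with the action of `G`. -/
def BundleAction.Commutes (ρ : BundleAction n G F V) (ν : Measure X) [IsFiniteMeasureOnCompacts ν]
    (S : L2 n F V ν →L[ℂ] L2 n F V ν) : Prop :=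
  ∀ g : G, ∀ p ∈ ρ.graphL2 ν g, (S p.1, S p.2) ∈ ρ.graphL2 ν g

end Action

/-! ### The trace and the `G`-trace -/

section Trace

variable {H : Type*} [NormedAddCommGroup H] [InnerProductSpace ℂ H] [CompleteSpace H]

/-- `T` is of trace class: `∑ |⟨|T| e_i, e_i⟩| < ∞` for an orthonormal basis `(e_i)`, where
`|T| = (T* T) ^ (1/2)`. -/
def IsTraceClass (T : H →L[ℂ] H) : Prop :=
  ∃ (w : Set H) (b : HilbertBasis w ℂ H), Summable fun i => ‖⟪b i, CFC.abs T (b i)⟫_ℂ‖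

/-- The trace `∑ ⟨T e_i, e_i⟩`, computed in some orthonormal basis `(e_i)`. -/
def opTrace (T : H →L[ℂ] H) : ℂ :=
  ∑' i, ⟪(exists_hilbertBasis ℂ H).choose_spec.choose i,
    T ((exists_hilbertBasis ℂ H).choose_spec.choose i)⟫_ℂ

end Trace

section GTrace

/-- Nonnegative `c₁, c₂ ∈ C_c^∞(X)` whose product is a cutoff function:
`∫ c₁(g⁻¹ x) c₂(g⁻¹ x) dg = 1` for all `x`. -/
structure CutoffPair (n : ℕ) (X : Type*) [TopologicalSpace X]
    [ChartedSpace (EuclideanSpace ℝ (Fin n)) X] {G : Type*} [Group G] [MulAction G X]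
    [MeasurableSpace G] (μ : Measure G) where
  c₁ : TestFun n X
  c₂ : TestFun n X
  nonneg₁ : ∀ x, ∃ r : ℝ, 0 ≤ r ∧ c₁ x = r
  nonneg₂ : ∀ x, ∃ r : ℝ, 0 ≤ r ∧ c₂ x = r
  integral_eq_one : ∀ x : X, ∫ g : G, c₁ (g⁻¹ • x) * c₂ (g⁻¹ • x) ∂μ = 1

variable {n : ℕ} {X : Type*} [TopologicalSpace X] [ChartedSpace (EuclideanSpace ℝ (Fin n)) X]
  {G : Type*} [Group G] [TopologicalSpace G] [MulAction G X]
  [MeasurableSpace G] {μ : Measure G}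
  {F : Type*} [NormedAddCommGroup F] [NormedSpace ℂ F]
  {V : X → Type*} [TopologicalSpace (TotalSpace F V)]
  [∀ x, NormedAddCommGroup (V x)] [∀ x, InnerProductSpace ℂ (V x)] [FiberBundle F V]
  [VectorBundle ℂ F V] [VectorBundle ℝ F V] [IsSmoothHermitian n F V]
  [MeasurableSpace X] [BorelSpace X] [T2Space X]
  {ν : Measure X} [IsFiniteMeasureOnCompacts ν]

/-- `S` is of `G`-trace class: it commutes with `G` and `φ |S| ψ` is of trace class for all
`φ, ψ ∈ C_c^∞(X)`. -/
def IsGTraceClass (ρ : BundleAction n G F V) (S : L2 n F V ν →L[ℂ] L2 n F V ν) : Prop :=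
  ρ.Commutes ν S ∧
    ∀ φ ψ : TestFun n X, IsTraceClass (mulOp n F V ν φ ∘L CFC.abs S ∘L mulOp n F V ν ψ)

/-- The `G`-trace `tr (c₁ S c₂)`. -/
def gTrace (c : CutoffPair n X μ) (S : L2 n F V ν →L[ℂ] L2 n F V ν) : ℂ :=
  opTrace (mulOp n F V ν c.c₁ ∘L S ∘L mulOp n F V ν c.c₂)

/-- The `G`-dimension of a closed subspace: the `G`-trace of the orthogonal projection on it. -/
def gDim (c : CutoffPair n X μ) (K : Submodule ℂ (L2 n F V ν)) [K.HasOrthogonalProjection] : ℝ :=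
  (gTrace c K.starProjection).re

end GTrace

/-! ### Pseudo-differential operators -/

section Symbols

variable {n : ℕ}

/-- The scalar symbols of order `m` on `ℝⁿ × ℝⁿ`: smooth functions `a (x, ξ)` with
`|∂_x^k ∂_ξ^l a| ≤ C (1 + |ξ|) ^ (m - l)`. -/
def IsSymbol (m : ℝ) (a : EuclideanSpace ℝ (Fin n) → EuclideanSpace ℝ (Fin n) → ℂ) : Prop :=
  ContDiff ℝ ∞ (fun p : EuclideanSpace ℝ (Fin n) × EuclideanSpace ℝ (Fin n) => a p.1 p.2) ∧
  ∀ k l : ℕ, ∃ C : ℝ, ∀ x ξ,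
    ‖iteratedFDeriv ℝ l (fun ξ' => iteratedFDeriv ℝ k (fun x' => a x' ξ') x) ξ‖ ≤
      C * (1 + ‖ξ‖) ^ (m - l)

/-- The operator `a(x, D)`:
`(a(x, D) w)(x) = (2π)⁻ⁿ ∫ e^{i x·ξ} a(x, ξ) ŵ(ξ) dξ` with `ŵ(ξ) = ∫ e^{-i z·ξ} w(z) dz`. -/
def opOfSymbol (a : EuclideanSpace ℝ (Fin n) → EuclideanSpace ℝ (Fin n) → ℂ)
    (w : EuclideanSpace ℝ (Fin n) → ℂ) (x : EuclideanSpace ℝ (Fin n)) : ℂ :=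
  ((2 * Real.pi : ℝ) : ℂ)⁻¹ ^ n *
    ∫ ξ : EuclideanSpace ℝ (Fin n), Complex.exp (Complex.I * (inner ℝ x ξ : ℝ)) * a x ξ *
      ∫ z : EuclideanSpace ℝ (Fin n), Complex.exp (-Complex.I * (inner ℝ z ξ : ℝ)) * w z

end Symbols

section PseudoDiff

variable (n : ℕ) {X : Type*} [TopologicalSpace X] [ChartedSpace (EuclideanSpace ℝ (Fin n)) X]

/-- The sections `s 1, …, s r` form a smooth complex frame of `V` over `U`. -/
def IsFrameOn (F : Type*) [NormedAddCommGroup F] [NormedSpace ℂ F]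
    (V : X → Type*) [TopologicalSpace (TotalSpace F V)]
    [∀ x, NormedAddCommGroup (V x)] [∀ x, InnerProductSpace ℂ (V x)] [FiberBundle F V]
    {r : ℕ} (s : Fin r → ∀ x, V x) (U : Set X) : Prop :=
  (∀ i, ContMDiffOn (𝓡 n) ((𝓡 n).prod 𝓘(ℝ, F)) ∞ (fun x => TotalSpace.mk' F x (s i x)) U) ∧
  ∀ x ∈ U, LinearIndependent ℂ (fun i => s i x) ∧ Submodule.span ℂ (range fun i => s i x) = ⊤

variable (F₀ : Type*) [NormedAddCommGroup F₀] [NormedSpace ℂ F₀]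
  (V₀ : X → Type*) [TopologicalSpace (TotalSpace F₀ V₀)]
  [∀ x, NormedAddCommGroup (V₀ x)] [∀ x, InnerProductSpace ℂ (V₀ x)] [FiberBundle F₀ V₀]
  (F₁ : Type*) [NormedAddCommGroup F₁] [NormedSpace ℂ F₁]
  (V₁ : X → Type*) [TopologicalSpace (TotalSpace F₁ V₁)]
  [∀ x, NormedAddCommGroup (V₁ x)] [∀ x, InnerProductSpace ℂ (V₁ x)] [FiberBundle F₁ V₁]

/-- A coordinate patch (possibly disconnected) with frames of both bundles over it and two
test functions supported in it. -/
structure Localization where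
  chart : OpenPartialHomeomorph X (EuclideanSpace ℝ (Fin n))
  chart_mem : chart ∈ IsManifold.maximalAtlas (𝓡 n) ∞ X
  r₀ : ℕ
  r₁ : ℕ
  s : Fin r₀ → ∀ x, V₀ x
  t : Fin r₁ → ∀ x, V₁ x
  frame_s : IsFrameOn n F₀ V₀ s chart.source
  frame_t : IsFrameOn n F₁ V₁ t chart.source
  φ : TestFun n X
  ψ : TestFun n X
  supp_φ : tsupport φ.toFun ⊆ chart.source
  supp_ψ : tsupport ψ.toFun ⊆ chart.source

variable {n F₀ V₀ F₁ V₁}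
variable [VectorBundle ℂ F₀ V₀] [VectorBundle ℝ F₀ V₀] [VectorBundle ℂ F₁ V₁] [VectorBundle ℝ F₁ V₁]

/-- In the coordinates and the frames of `L`, the operator `φ P ψ` is `a(x, D)` with the matrix `a`
of symbols of order `m`. -/
def IsLocalSymbol (L : Localization n F₀ V₀ F₁ V₁) (m : ℝ)
    (P : testSections n F₀ V₀ →ₗ[ℂ] ∀ x, V₁ x)
    (a : Fin L.r₁ → Fin L.r₀ → EuclideanSpace ℝ (Fin n) → EuclideanSpace ℝ (Fin n) → ℂ) : Prop :=
  (∀ i j, IsSymbol m (a i j)) ∧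
  (∀ i j, ∀ y ∉ L.chart.target, ∀ ξ, a i j y ξ = 0) ∧
  ∀ (u : testSections n F₀ V₀) (w : Fin L.r₀ → EuclideanSpace ℝ (Fin n) → ℂ),
    (∀ j, ContDiff ℝ ∞ (w j) ∧ HasCompactSupport (w j)) →
    (∀ x ∈ L.chart.source, u.1 x = L.ψ x • ∑ j, w j (L.chart x) • L.s j x) →
    (∀ x ∉ L.chart.source, u.1 x = 0) →
    ∀ x ∈ L.chart.source,
      L.φ x • P u x = ∑ i, (∑ j, opOfSymbol (a i j) (w j) (L.chart x)) • L.t i x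

variable (F₁) in
/-- `P ∈ Ψ^m(X; V₀, V₁)`: a pseudo-differential operator `C_c^∞(X, V₀) → C^∞(X, V₁)` of
order `m`. As the coordinate patches may be disconnected, the condition contains the smoothness of
the Schwartz kernel off the diagonal. -/
def IsPseudoDiff (m : ℝ) (P : testSections n F₀ V₀ →ₗ[ℂ] ∀ x, V₁ x) : Prop :=
  (∀ u, IsSmoothSection n F₁ V₁ (P u)) ∧
  ∀ L : Localization n F₀ V₀ F₁ V₁, ∃ a, IsLocalSymbol L m P a

variable (F₁) in
/-- The section `σ` of `Hom(π^* V₀, π^* V₁)` over `T^* X` represents the principal symbol of order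
`m` of `P`: in local coordinates and frames the full symbol of `φ P ψ` is `φ ψ σ` modulo symbols
of order `m - 1`. -/
def IsPrincipalSymbol (m : ℝ) (P : testSections n F₀ V₀ →ₗ[ℂ] ∀ x, V₁ x)
    (σ : ∀ x : X, (TangentSpace (𝓡 n) x →L[ℝ] ℝ) → (V₀ x →L[ℂ] V₁ x)) : Prop :=
  ∀ (L : Localization n F₀ V₀ F₁ V₁)
    (a b : Fin L.r₁ → Fin L.r₀ → EuclideanSpace ℝ (Fin n) → EuclideanSpace ℝ (Fin n) → ℂ),
    IsLocalSymbol L m P a →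
    (∀ i j, ∀ y ∉ L.chart.target, ∀ ξ, b i j y ξ = 0) →
    (∀ x ∈ L.chart.source, ∀ (ξ : EuclideanSpace ℝ (Fin n)) (j : Fin L.r₀),
      (L.φ x * L.ψ x) • σ x ((innerSL ℝ ξ).comp (mfderiv (𝓡 n) (𝓡 n) L.chart x)) (L.s j x) =
        ∑ i, b i j (L.chart x) ξ • L.t i x) →
    ∀ i j, IsSymbol (m - 1) (fun y ξ => a i j y ξ - b i j y ξ)

variable (F₁) in
/-- Ellipticity of `P ∈ Ψ^m(X; V₀, V₁)`: there is `Q ∈ Ψ^{-m}(X; V₁, V₀)` with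
`‖σ_P σ_Q - 1‖ → 0` and `‖σ_Q σ_P - 1‖ → 0` as `ξ → ∞` in `T_x^* X`, uniformly for `x` in
compact sets. -/
def IsElliptic [RiemannianBundle (fun x : X => TangentSpace (𝓡 n) x)] (m : ℝ)
    (P : testSections n F₀ V₀ →ₗ[ℂ] ∀ x, V₁ x) : Prop :=
  ∃ (Q : testSections n F₁ V₁ →ₗ[ℂ] ∀ x, V₀ x)
    (σP : ∀ x : X, (TangentSpace (𝓡 n) x →L[ℝ] ℝ) → (V₀ x →L[ℂ] V₁ x))
    (σQ : ∀ x : X, (TangentSpace (𝓡 n) x →L[ℝ] ℝ) → (V₁ x →L[ℂ] V₀ x)),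
    IsPseudoDiff F₀ (-m) Q ∧ IsPrincipalSymbol F₁ m P σP ∧ IsPrincipalSymbol F₀ (-m) Q σQ ∧
    ∀ K : Set X, IsCompact K → ∀ ε > 0, ∃ R : ℝ, ∀ x ∈ K,
      ∀ ξ : TangentSpace (𝓡 n) x →L[ℝ] ℝ, R < ‖ξ‖ →
        ‖σP x ξ ∘L σQ x ξ - ContinuousLinearMap.id ℂ (V₁ x)‖ < ε ∧
        ‖σQ x ξ ∘L σP x ξ - ContinuousLinearMap.id ℂ (V₀ x)‖ < ε

/-- The support in `X × X` of the Schwartz kernel of `P`. -/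
def kernelSupport (P : testSections n F₀ V₀ →ₗ[ℂ] ∀ x, V₁ x) : Set (X × X) :=
  {p | ∀ U ∈ 𝓝 p.1, ∀ W ∈ 𝓝 p.2, ∃ u : testSections n F₀ V₀,
    (∀ y ∉ W, u.1 y = 0) ∧ ∃ x ∈ U, P u x ≠ 0}

/-- `P` is properly supported. -/
def IsProperlySupported (P : testSections n F₀ V₀ →ₗ[ℂ] ∀ x, V₁ x) : Prop :=
  ∀ K : Set X, IsCompact K →
    IsCompact (kernelSupport P ∩ K ×ˢ univ) ∧ IsCompact (kernelSupport P ∩ univ ×ˢ K)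

/-- `P` is `G`-invariant: `P (g · u) = g · P u`. -/
def IsInvariantOp {G : Type*} [Group G] [TopologicalSpace G] [MulAction G X]
    (ρ₀ : BundleAction n G F₀ V₀) (ρ₁ : BundleAction n G F₁ V₁)
    (P : testSections n F₀ V₀ →ₗ[ℂ] ∀ x, V₁ x) : Prop :=
  ∀ (g : G) (u u' : testSections n F₀ V₀),
    ρ₀.IsTranslate g u.1 u'.1 → ρ₁.IsTranslate g (P u) (P u')

/-- `P ∈ Ψ^m_{G,p}(X; V₀, V₁)`: the properly supported `G`-invariant pseudo-differential operators
of order `m`, as operators `C_c^∞(X, V₀) → C_c^∞(X, V₁)`. -/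
structure MemPsiGp {G : Type*} [Group G] [TopologicalSpace G] [MulAction G X]
    (ρ₀ : BundleAction n G F₀ V₀) (ρ₁ : BundleAction n G F₁ V₁) (m : ℝ)
    (P : testSections n F₀ V₀ →ₗ[ℂ] testSections n F₁ V₁) : Prop where
  pseudoDiff : IsPseudoDiff F₁ m ((testSections n F₁ V₁).subtype ∘ₗ P)
  invariant : IsInvariantOp ρ₀ ρ₁ ((testSections n F₁ V₁).subtype ∘ₗ P)
  proper : IsProperlySupported ((testSections n F₁ V₁).subtype ∘ₗ P)

end PseudoDiff

/-! ### The operator on `L²` and its index -/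

section Index

variable {n : ℕ} {X : Type*} [TopologicalSpace X] [ChartedSpace (EuclideanSpace ℝ (Fin n)) X]
  {F₀ : Type*} [NormedAddCommGroup F₀] [NormedSpace ℂ F₀]
  {V₀ : X → Type*} [TopologicalSpace (TotalSpace F₀ V₀)]
  [∀ x, NormedAddCommGroup (V₀ x)] [∀ x, InnerProductSpace ℂ (V₀ x)] [FiberBundle F₀ V₀]
  {F₁ : Type*} [NormedAddCommGroup F₁] [NormedSpace ℂ F₁]
  {V₁ : X → Type*} [TopologicalSpace (TotalSpace F₁ V₁)]
  [∀ x, NormedAddCommGroup (V₁ x)] [∀ x, InnerProductSpace ℂ (V₁ x)] [FiberBundle F₁ V₁]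
  [VectorBundle ℂ F₀ V₀] [VectorBundle ℝ F₀ V₀] [VectorBundle ℂ F₁ V₁] [VectorBundle ℝ F₁ V₁]
  [IsSmoothHermitian n F₀ V₀] [IsSmoothHermitian n F₁ V₁]
  [MeasurableSpace X] [BorelSpace X] [T2Space X]
  (ν : Measure X) [IsFiniteMeasureOnCompacts ν]
  (P₀ : testSections n F₀ V₀ →ₗ[ℂ] testSections n F₁ V₁)

/-- The graph of the closure of `P₀` as an operator `L²(X, V₀) → L²(X, V₁)`; for a bounded `P₀`
this is the graph of its extension to `L²(X, V₀)`. -/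
def closureGraph : Submodule ℂ (L2 n F₀ V₀ ν × L2 n F₁ V₁ ν) :=
  (LinearMap.range ((toL2 ν).prod (toL2 ν ∘ₗ P₀))).topologicalClosure

/-- The graph of the Hilbert space adjoint `P₀^*`: all `(v, w)` with `⟨P₀ u, v⟩ = ⟨u, w⟩` for all
test sections `u`. -/
def adjointGraph : Submodule ℂ (L2 n F₁ V₁ ν × L2 n F₀ V₀ ν) where
  carrier := {p | ∀ u : testSections n F₀ V₀, ⟪toL2 ν (P₀ u), p.1⟫_ℂ = ⟪toL2 ν u, p.2⟫_ℂ}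
  zero_mem' := by intro u; simp
  add_mem' := by
    intro p q hp hq u
    simp [inner_add_right, hp u, hq u]
  smul_mem' := by
    intro c p hp u
    simp [inner_smul_right, hp u]

/-- The kernel of (the closure of) `P₀` in `L²(X, V₀)`. -/
def kerOp : Submodule ℂ (L2 n F₀ V₀ ν) :=
  (closureGraph ν P₀).comap (LinearMap.inl ℂ (L2 n F₀ V₀ ν) (L2 n F₁ V₁ ν))

/-- The kernel of `P₀^*` in `L²(X, V₁)`. -/
def kerAdj : Submodule ℂ (L2 n F₁ V₁ ν) :=
  (adjointGraph ν P₀).comap (LinearMap.inl ℂ (L2 n F₁ V₁ ν) (L2 n F₀ V₀ ν))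

theorem isClosed_kerOp : IsClosed (kerOp ν P₀ : Set (L2 n F₀ V₀ ν)) := by
  have h : IsClosed (closureGraph ν P₀ : Set (L2 n F₀ V₀ ν × L2 n F₁ V₁ ν)) :=
    Submodule.isClosed_topologicalClosure _
  exact h.preimage (f := fun u : L2 n F₀ V₀ ν => (u, (0 : L2 n F₁ V₁ ν))) (by fun_prop)

theorem isClosed_kerAdj : IsClosed (kerAdj ν P₀ : Set (L2 n F₁ V₁ ν)) := by
  have h : (kerAdj ν P₀ : Set (L2 n F₁ V₁ ν)) =
      ⋂ u : testSections n F₀ V₀, {v | ⟪toL2 ν (P₀ u), v⟫_ℂ = ⟪toL2 ν u, 0⟫_ℂ} := by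
    ext v
    simp only [Set.mem_iInter]
    rfl
  rw [h]
  exact isClosed_iInter fun u => isClosed_eq (by fun_prop) continuous_const

instance : (kerOp ν P₀).HasOrthogonalProjection :=
  haveI : CompleteSpace (kerOp ν P₀) := (isClosed_kerOp ν P₀).completeSpace_coe
  inferInstance

instance : (kerAdj ν P₀).HasOrthogonalProjection :=
  haveI : CompleteSpace (kerAdj ν P₀) := (isClosed_kerAdj ν P₀).completeSpace_coe
  inferInstance

/-- The `L²`-index `dim_G Ker P₀ - dim_G Ker P₀^*`. -/
def l2Index {G : Type*} [Group G] [TopologicalSpace G] [MulAction G X] [MeasurableSpace G]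
    {μ : Measure G} (c d : CutoffPair n X μ) : ℝ :=
  gDim c (kerOp ν P₀) - gDim d (kerAdj ν P₀)

/-- `1 - Q P₀ = S` on test sections, for a possibly unbounded operator `Q`. -/
def LeftRemainder (Q : L2 n F₁ V₁ ν →ₗ.[ℂ] L2 n F₀ V₀ ν)
    (S : L2 n F₀ V₀ ν →L[ℂ] L2 n F₀ V₀ ν) : Prop :=
  ∀ u : testSections n F₀ V₀, ∃ h : toL2 ν (P₀ u) ∈ Q.domain,
    toL2 ν u - Q ⟨toL2 ν (P₀ u), h⟩ = S (toL2 ν u)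

/-- `1 - P₀ Q = S` on test sections, for a possibly unbounded operator `Q`; here `P₀` stands for
its closure, so that `P₀ (Q v) = v - S v` means that `(Q v, v - S v)` lies in its graph. -/
def RightRemainder (Q : L2 n F₁ V₁ ν →ₗ.[ℂ] L2 n F₀ V₀ ν)
    (S : L2 n F₁ V₁ ν →L[ℂ] L2 n F₁ V₁ ν) : Prop :=
  ∀ v : testSections n F₁ V₁, ∃ h : toL2 ν v ∈ Q.domain,
    (Q ⟨toL2 ν v, h⟩, toL2 ν v - S (toL2 ν v)) ∈ closureGraph ν P₀

end Index

end GIndex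

end

noncomputable section

namespace GIndex

set_option linter.unusedSectionVars false

open scoped ENNReal NNReal
open ContinuousLinearMap (adjoint)

/-! ### Hilbert-Schmidt operators and their pairing. -/

section HilbertSchmidt

variable {ι κ : Type*}
  {H : Type*} [NormedAddCommGroup H] [InnerProductSpace ℂ H] [CompleteSpace H]
  {H' : Type*} [NormedAddCommGroup H'] [InnerProductSpace ℂ H'] [CompleteSpace H']
  {H'' : Type*} [NormedAddCommGroup H''] [InnerProductSpace ℂ H''] [CompleteSpace H'']

/-! Let `T` be the closure of `P₀` and `Γ` its graph. From `P₀ (1 - Q P₀) = (1 - P₀ Q) P₀` the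
operator `S₁ ⊕ S₂` maps `Γ` into itself (`map_mem_closureGraph`), that is, `T S₁ = S₂ T`.
Closability of `Q` gives `S₁ p = p` for the projection `p` onto `Ker T`, and `q S₂ = q` for the
projection `q` onto `Ker T*`. Hence `p` and `q` are locally of trace class, and it remains to show
`tr S₁ - tr S₂ = tr (S₁ p) - tr (S₂ q)`.

No functional calculus for unbounded operators is needed. The orthogonal projection onto `Γ` has
bounded blocks, formally `R = (1 + T*T)⁻¹`, `K = T R` and `D = T T* (1 + T T*)⁻¹`. Since `K*K = R -
R²`, the operator `M₀ = 1 - 4 K*K = (1 - 2R)²` is a contraction whose fixed vectors form `Ker T`;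
likewise `M₁ = 1 - 4 K K*` belongs to `Ker T*`. Invariance of `Γ` gives `K* S₂ K = (1 - R) S₁ R`,
and cyclicity of the trace then makes `tr (S₁ M₀ᵏ) - tr (S₂ M₁ᵏ)` independent of `k` (`tr_step`,
`tr_sub_const`). By the mean ergodic theorem the Cesàro means of `M₀ᵏ` and `M₁ᵏ` tend strongly to
`p` and `q`, and the trace follows the limit (`tendsto_tr_comp`).

Cyclicity of the `G`-trace is the analytic input. A `G`-trace class operator factors as `X* Y` with
`X`, `Y` equivariant and locally Hilbert-Schmidt (`locTC_of_isTraceClass`). For such operators,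
inserting the resolution of the identity given by a cutoff pair and substituting `g ↦ g⁻¹`, which
unimodularity permits, moves the cutoffs from one side to the other (`LocHS.hsInner_swap`). All this
is done for an abstract `LocalRep`; `bundleRep` shows that `L²`-sections form one. -/

theorem enorm_sq_eq_ofReal (x : H) : ‖x‖ₑ ^ 2 = ENNReal.ofReal (‖x‖ ^ 2) := by
  rw [ENNReal.ofReal_pow (norm_nonneg _), ofReal_norm]

/-- Parseval with values in `ℝ≥0∞`, where double sums can be exchanged without any summability
condition. -/
theorem tsum_enorm_inner_sq (b : HilbertBasis ι ℂ H) (x : H) :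
    ∑' i, ‖⟪b i, x⟫_ℂ‖ₑ ^ 2 = ‖x‖ₑ ^ 2 := by
  have h := b.summable_inner_mul_inner x x
  have h2 : ∀ i, ⟪x, b i⟫_ℂ * ⟪b i, x⟫_ℂ = ((‖⟪b i, x⟫_ℂ‖ ^ 2 : ℝ) : ℂ) := fun i => by
    rw [← inner_conj_symm x, RCLike.conj_mul]
    norm_cast
  have h3 : HasSum (fun i => ‖⟪b i, x⟫_ℂ‖ ^ 2) (‖x‖ ^ 2) := by
    have := b.hasSum_inner_mul_inner x x
    simp only [h2, inner_self_eq_norm_sq_to_K] at this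
    exact Complex.hasSum_ofReal.1 (by simpa using this)
  simp_rw [enorm_sq_eq_ofReal]
  rw [← h3.tsum_eq, ENNReal.ofReal_tsum_of_nonneg (fun _ => by positivity) h3.summable]

/-- Both sides are the sum of all squared matrix coefficients. As each side involves only one of the
two bases, neither depends on its basis. -/
theorem tsum_enorm_sq_adjoint (b : HilbertBasis ι ℂ H) (f : HilbertBasis κ ℂ H')
    (T : H →L[ℂ] H') : ∑' i, ‖T (b i)‖ₑ ^ 2 = ∑' j, ‖adjoint T (f j)‖ₑ ^ 2 := by
  simp_rw [← tsum_enorm_inner_sq f, ← tsum_enorm_inner_sq b]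
  rw [ENNReal.tsum_comm]
  refine tsum_congr fun j => tsum_congr fun i => ?_
  rw [ContinuousLinearMap.adjoint_inner_right, ← inner_conj_symm, RCLike.enorm_conj]

variable (H) in
/-- The orthonormal basis that is used in the definition of `opTrace`. -/
abbrev stdBasis : HilbertBasis (exists_hilbertBasis ℂ H).choose ℂ H :=
  (exists_hilbertBasis ℂ H).choose_spec.choose

/-- The square of the Hilbert-Schmidt norm. -/
def hsSq (T : H →L[ℂ] H') : ℝ≥0∞ := ∑' i, ‖T (stdBasis H i)‖ₑ ^ 2

theorem hsSq_eq_adjoint (f : HilbertBasis κ ℂ H') (T : H →L[ℂ] H') :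
    hsSq T = ∑' j, ‖adjoint T (f j)‖ₑ ^ 2 :=
  tsum_enorm_sq_adjoint _ f T

theorem hsSq_eq (b : HilbertBasis ι ℂ H) (T : H →L[ℂ] H') : hsSq T = ∑' i, ‖T (b i)‖ₑ ^ 2 := by
  rw [hsSq_eq_adjoint (stdBasis H'), tsum_enorm_sq_adjoint b (stdBasis H')]

theorem hsSq_adjoint (T : H →L[ℂ] H') : hsSq (adjoint T) = hsSq T :=
  (hsSq_eq_adjoint (stdBasis H') T).symm

theorem hsSq_comp_le (A : H' →L[ℂ] H'') (T : H →L[ℂ] H') :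
    hsSq (A ∘L T) ≤ ‖A‖ₑ ^ 2 * hsSq T := by
  unfold hsSq
  rw [← ENNReal.tsum_mul_left]
  refine ENNReal.tsum_le_tsum fun i => ?_
  rw [← mul_pow]
  gcongr
  exact A.le_opENorm _

theorem hsSq_comp_le' (T : H' →L[ℂ] H'') (A : H →L[ℂ] H') :
    hsSq (T ∘L A) ≤ ‖A‖ₑ ^ 2 * hsSq T := by
  rw [← hsSq_adjoint, ContinuousLinearMap.adjoint_comp, ← hsSq_adjoint T]
  refine (hsSq_comp_le _ _).trans_eq ?_
  congr 2
  rw [← ofReal_norm, ← ofReal_norm, LinearIsometryEquiv.norm_map]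

/-- `T` is a Hilbert-Schmidt operator. -/
def IsHS (T : H →L[ℂ] H') : Prop := hsSq T ≠ ⊤

theorem isHS_adjoint {T : H →L[ℂ] H'} : IsHS (adjoint T) ↔ IsHS T := by
  rw [IsHS, hsSq_adjoint, IsHS]

theorem IsHS.comp_left {T : H →L[ℂ] H'} (h : IsHS T) (A : H' →L[ℂ] H'') : IsHS (A ∘L T) :=
  ne_top_of_le_ne_top (ENNReal.mul_ne_top (by simp) h) (hsSq_comp_le A T)

theorem IsHS.comp_right {T : H' →L[ℂ] H''} (h : IsHS T) (A : H →L[ℂ] H') : IsHS (T ∘L A) :=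
  ne_top_of_le_ne_top (ENNReal.mul_ne_top (by simp) h) (hsSq_comp_le' T A)

theorem isHS_iff_summable (b : HilbertBasis ι ℂ H) (T : H →L[ℂ] H') :
    IsHS T ↔ Summable fun i => ‖T (b i)‖ ^ 2 := by
  rw [IsHS, hsSq_eq b]
  simp_rw [enorm_sq_eq_ofReal]
  constructor
  · intro h
    have := ENNReal.summable_toReal h
    simpa [ENNReal.toReal_ofReal, sq_nonneg] using this
  · intro h
    rw [← ENNReal.ofReal_tsum_of_nonneg (fun _ => by positivity) h]
    exact ENNReal.ofReal_ne_top

theorem IsHS.summable_norm_mul {S : H →L[ℂ] H'} {T : H →L[ℂ] H''} (hS : IsHS S) (hT : IsHS T)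
    (b : HilbertBasis ι ℂ H) : Summable fun i => ‖S (b i)‖ * ‖T (b i)‖ := by
  refine Summable.of_nonneg_of_le (fun _ => by positivity) (fun i => ?_)
    (((isHS_iff_summable b S).1 hS).add ((isHS_iff_summable b T).1 hT))
  nlinarith [sq_nonneg (‖S (b i)‖ - ‖T (b i)‖), sq_nonneg (‖S (b i)‖), sq_nonneg (‖T (b i)‖)]

theorem IsHS.summable_inner {S T : H →L[ℂ] H'} (hS : IsHS S) (hT : IsHS T)
    (b : HilbertBasis ι ℂ H) : Summable fun i => ⟪S (b i), T (b i)⟫_ℂ :=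
  Summable.of_norm_bounded (hS.summable_norm_mul hT b) fun _ => norm_inner_le_norm _ _

/-- The Hilbert-Schmidt inner product `∑ ⟨S e_i, T e_i⟩`. -/
def hsInner (S T : H →L[ℂ] H') : ℂ := ∑' i, ⟪S (stdBasis H i), T (stdBasis H i)⟫_ℂ

theorem IsHS.summable_norm_inner_sq {A : H →L[ℂ] H'} (hA : IsHS A)
    (b : HilbertBasis ι ℂ H) (f : HilbertBasis κ ℂ H') :
    Summable fun p : ι × κ => ‖⟪f p.2, A (b p.1)⟫_ℂ‖ ^ 2 := by
  have : ∑' p : ι × κ, ‖⟪f p.2, A (b p.1)⟫_ℂ‖ₑ ^ 2 ≠ ⊤ := by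
    rw [ENNReal.tsum_prod' (f := fun p : ι × κ => ‖⟪f p.2, A (b p.1)⟫_ℂ‖ₑ ^ 2)]
    simp_rw [tsum_enorm_inner_sq f]
    rwa [← hsSq_eq]
  simpa using ENNReal.summable_toReal this

theorem IsHS.summable_inner_mul_inner {S T : H →L[ℂ] H'} (hS : IsHS S) (hT : IsHS T)
    (b : HilbertBasis ι ℂ H) (f : HilbertBasis κ ℂ H') :
    Summable fun p : ι × κ => ⟪S (b p.1), f p.2⟫_ℂ * ⟪f p.2, T (b p.1)⟫_ℂ := by
  refine Summable.of_norm_bounded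
    ((hS.summable_norm_inner_sq b f).add (hT.summable_norm_inner_sq b f)) fun p => ?_
  rw [norm_mul, norm_inner_symm]
  nlinarith [sq_nonneg (‖⟪f p.2, S (b p.1)⟫_ℂ‖ - ‖⟪f p.2, T (b p.1)⟫_ℂ‖),
    sq_nonneg ‖⟪f p.2, S (b p.1)⟫_ℂ‖, sq_nonneg ‖⟪f p.2, T (b p.1)⟫_ℂ‖]

/-- The polarized form of the invariance of the Hilbert-Schmidt norm under adjoints. The double
series of matrix coefficients converges absolutely, so Fubini applies; the reversed order of the
adjoints comes from conjugation. -/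
theorem IsHS.tsum_inner_adjoint {S T : H →L[ℂ] H'} (hS : IsHS S) (hT : IsHS T)
    (b : HilbertBasis ι ℂ H) (f : HilbertBasis κ ℂ H') :
    ∑' i, ⟪S (b i), T (b i)⟫_ℂ = ∑' j, ⟪adjoint T (f j), adjoint S (f j)⟫_ℂ := by
  calc ∑' i, ⟪S (b i), T (b i)⟫_ℂ
      = ∑' i, ∑' j, ⟪S (b i), f j⟫_ℂ * ⟪f j, T (b i)⟫_ℂ :=
        tsum_congr fun i => (f.tsum_inner_mul_inner (S (b i)) (T (b i))).symm
    _ = ∑' j, ∑' i, ⟪S (b i), f j⟫_ℂ * ⟪f j, T (b i)⟫_ℂ :=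
        (Summable.tsum_comm (f := fun i j => ⟪S (b i), f j⟫_ℂ * ⟪f j, T (b i)⟫_ℂ)
          (hS.summable_inner_mul_inner hT b f)).symm
    _ = ∑' j, ∑' i, ⟪adjoint T (f j), b i⟫_ℂ * ⟪b i, adjoint S (f j)⟫_ℂ :=
        tsum_congr fun j => tsum_congr fun i => by
          rw [ContinuousLinearMap.adjoint_inner_left, ContinuousLinearMap.adjoint_inner_right,
            mul_comm]
    _ = ∑' j, ⟪adjoint T (f j), adjoint S (f j)⟫_ℂ :=
        tsum_congr fun j => b.tsum_inner_mul_inner _ _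

theorem hsInner_adjoint {S T : H →L[ℂ] H'} (hS : IsHS S) (hT : IsHS T) :
    hsInner (adjoint T) (adjoint S) = hsInner S T :=
  (hS.tsum_inner_adjoint hT _ _).symm

theorem hsInner_conj (S T : H →L[ℂ] H') : (starRingEnd ℂ) (hsInner S T) = hsInner T S := by
  unfold hsInner
  rw [Complex.conj_tsum]
  simp only [inner_conj_symm]

theorem hsInner_comp_left (A : H' →L[ℂ] H'') (S : H →L[ℂ] H') (T : H →L[ℂ] H'') :
    hsInner (A ∘L S) T = hsInner S (adjoint A ∘L T) := by
  simp [hsInner, ContinuousLinearMap.adjoint_inner_right]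

theorem hsInner_comp_right {S : H →L[ℂ] H'} {T : H'' →L[ℂ] H'} (hS : IsHS S) (hT : IsHS T)
    (A : H →L[ℂ] H'') : hsInner S (T ∘L A) = hsInner (S ∘L adjoint A) T := by
  rw [← hsInner_adjoint hS (hT.comp_right A), ← hsInner_adjoint (hS.comp_right _) hT,
    ContinuousLinearMap.adjoint_comp, ContinuousLinearMap.adjoint_comp, hsInner_comp_left,
    ContinuousLinearMap.adjoint_adjoint]

/-- Hilbert-Schmidt pairings are continuous for the strong topology on bounded sequences. -/
theorem tendsto_hsInner_comp {S : H →L[ℂ] H''} {T : H →L[ℂ] H'} (hS : IsHS S) (hT : IsHS T)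
    {B : ℕ → H' →L[ℂ] H''} {B₀ : H' →L[ℂ] H''} {C : ℝ} (hB : ∀ k, ‖B k‖ ≤ C)
    (hlim : ∀ x, Tendsto (fun k => B k x) atTop (𝓝 (B₀ x))) :
    Tendsto (fun k => hsInner S (B k ∘L T)) atTop (𝓝 (hsInner S (B₀ ∘L T))) := by
  -- Each term converges by strong convergence; the uniform bound on the norms supplies a summable
  -- majorant.
  refine tendsto_tsum_of_dominated_convergence
    (bound := fun i => C * (‖S (stdBasis H i)‖ * ‖T (stdBasis H i)‖))
    ((hS.summable_norm_mul hT _).mul_left C) (fun i => ?_) (.of_forall fun k i => ?_)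
  · exact tendsto_const_nhds.inner (hlim _)
  · calc _ ≤ ‖S (stdBasis H i)‖ * ‖B k (T (stdBasis H i))‖ := norm_inner_le_norm _ _
      _ ≤ ‖S (stdBasis H i)‖ * (C * ‖T (stdBasis H i)‖) := by
        gcongr
        exact (B k).le_of_opNorm_le (hB k) _
      _ = _ := by ring

end HilbertSchmidt

/-! ### Polar decomposition and trace class operators. -/

section TraceClass

variable {H : Type*} [NormedAddCommGroup H] [InnerProductSpace ℂ H] [CompleteSpace H]
  {H' : Type*} [NormedAddCommGroup H'] [InnerProductSpace ℂ H'] [CompleteSpace H']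
  {E : Type*} [NormedAddCommGroup E] [NormedSpace ℂ E]

theorem adjoint_eq_of_nonneg {P : H →L[ℂ] H} (hP : 0 ≤ P) : adjoint P = P :=
  (ContinuousLinearMap.isSelfAdjoint_iff'.1 (IsSelfAdjoint.of_nonneg hP))

/-- A vector `x` orthogonal to the range satisfies `‖P x‖² = ⟪P (P x), x⟫ = 0`, so it lies in the
kernel; being orthogonal to the kernel as well, it vanishes. -/
theorem denseRange_add_ker {P : H →L[ℂ] H} (hP : adjoint P = P) :
    DenseRange (P.toLinearMap.coprod (LinearMap.ker P.toLinearMap).subtype) := by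
  have h : (LinearMap.range (P.toLinearMap.coprod
      (LinearMap.ker P.toLinearMap).subtype)).topologicalClosure = ⊤ := by
    rw [Submodule.topologicalClosure_eq_top_iff, Submodule.eq_bot_iff]
    intro x hx
    rw [Submodule.mem_orthogonal] at hx
    have hx0 : P x = 0 := by
      have := hx (P (P x)) ⟨(P x, 0), by simp⟩
      rw [← hP, ContinuousLinearMap.adjoint_inner_left, hP, inner_self_eq_zero] at this
      exact this
    have := hx x ⟨(0, ⟨x, hx0⟩), by simp⟩
    simpa using this
  rw [DenseRange, ← LinearMap.coe_range, ← Submodule.dense_iff_topologicalClosure_eq_top] at *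
  exact h

/-- A bounded operator is determined by its values on the range and the kernel of a self-adjoint
operator. -/
theorem ext_range_ker {P : H →L[ℂ] H} (hP : adjoint P = P) {A B : H →L[ℂ] E}
    (hr : ∀ x, A (P x) = B (P x)) (hk : ∀ x, P x = 0 → A x = B x) : A = B := by
  refine DFunLike.coe_injective ((denseRange_add_ker hP).equalizer A.continuous B.continuous ?_)
  ext ⟨x, y, hy⟩
  simp [hr x, hk y hy]

theorem inner_abs_apply (T : H →L[ℂ] H) (x y : H) :
    ⟪CFC.abs T x, CFC.abs T y⟫_ℂ = ⟪T x, T y⟫_ℂ := by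
  have h : ∀ z, CFC.abs T (CFC.abs T z) = adjoint T (T z) := fun z => congr($(CFC.abs_mul_abs T) z)
  rw [← ContinuousLinearMap.adjoint_inner_right (CFC.abs T),
    adjoint_eq_of_nonneg (CFC.abs_nonneg T), h, ContinuousLinearMap.adjoint_inner_right]

theorem norm_abs_apply (T : H →L[ℂ] H) (x : H) : ‖CFC.abs T x‖ = ‖T x‖ := by
  have h2 := inner_abs_apply T x x
  rw [inner_self_eq_norm_sq_to_K, inner_self_eq_norm_sq_to_K] at h2
  have h3 : ‖CFC.abs T x‖ ^ 2 = ‖T x‖ ^ 2 := by exact_mod_cast h2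
  exact (sq_eq_sq₀ (norm_nonneg _) (norm_nonneg _)).1 h3

/-- The polar decomposition. -/
theorem exists_polar (T : H →L[ℂ] H) : ∃ W : H →L[ℂ] H, T = W ∘L CFC.abs T ∧
    CFC.abs T = adjoint W ∘L T ∧
    ∀ U : H →L[ℂ] H, U ∘L T = T ∘L U → U ∘L CFC.abs T = CFC.abs T ∘L U → U ∘L W = W ∘L U := by
  set P := CFC.abs T with hPdef
  have hP : adjoint P = P := adjoint_eq_of_nonneg (CFC.abs_nonneg T)
  -- The partial isometry is prescribed on the dense subspace `ran P + ker P` by `P x + y ↦ T x`. It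
  -- is well defined and contractive because `‖T x‖ = ‖P x‖` and `P x` is orthogonal to `y`.
  let f : H × LinearMap.ker P.toLinearMap →ₗ[ℂ] H := T.toLinearMap ∘ₗ LinearMap.fst ℂ _ _
  let e := P.toLinearMap.coprod (LinearMap.ker P.toLinearMap).subtype
  have hbd : ∀ x, ‖f x‖ ≤ 1 * ‖e x‖ := by
    rintro ⟨x, y, hy⟩
    have hy' : P y = 0 := hy
    have horth : ⟪P x, y⟫_ℂ = 0 := by
      rw [← hP, ContinuousLinearMap.adjoint_inner_left, hy', inner_zero_right]
    have h1 : ‖P x + y‖ * ‖P x + y‖ = _ :=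
      norm_add_sq_eq_norm_sq_add_norm_sq_of_inner_eq_zero (P x) y horth
    have h2 : ‖T x‖ = ‖P x‖ := (norm_abs_apply T x).symm
    have : ‖T x‖ ≤ ‖P x + y‖ := by
      rw [h2]
      nlinarith [norm_nonneg (P x), norm_nonneg (P x + y), norm_nonneg y]
    simpa [f, e] using this
  have hdense := denseRange_add_ker hP
  let W := f.extendOfNorm e
  have hW : ∀ x, W (e x) = f x := LinearMap.extendOfNorm_eq hdense ⟨1, hbd⟩
  have hWr : ∀ x, W (P x) = T x := fun x => by
    have := hW (x, 0)
    simpa [f, e] using this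
  have hWk : ∀ x, P x = 0 → W x = 0 := fun x hx => by
    have := hW (0, ⟨x, hx⟩)
    simpa [f, e] using this
  refine ⟨W, ?_, ?_, ?_⟩
  · ext x
    exact (hWr x).symm
  · ext x
    have : innerSL ℂ (P x) = innerSL ℂ (adjoint W (T x)) := by
      refine ext_range_ker hP (fun y => ?_) (fun y hy => ?_)
      · simp only [innerSL_apply_apply, ContinuousLinearMap.adjoint_inner_left, hWr]
        exact inner_abs_apply T x y
      · simp only [innerSL_apply_apply, ContinuousLinearMap.adjoint_inner_left, hWk y hy,
          inner_zero_right]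
        rw [← hP, ContinuousLinearMap.adjoint_inner_left, hy, inner_zero_right]
    refine ext_inner_right ℂ fun y => ?_
    simpa using congr($this y)
  -- This clause later makes the polar part of an equivariant operator equivariant.
  · intro U hUT hUP
    have h1 : ∀ x, U (T x) = T (U x) := fun x => congr($hUT x)
    have h2 : ∀ x, U (P x) = P (U x) := fun x => congr($hUP x)
    refine ext_range_ker hP (fun x => ?_) (fun x hx => ?_)
    · simp [hWr, h1, h2]
    · simp [hWk x hx, hWk (U x) (by rw [← h2, hx, map_zero])]

/-- With the polar part `W` one has `|A* B| = W* A* B`, so the diagonal entries are the pairings `⟪A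
W e, B e⟫` of two Hilbert-Schmidt operators. -/
theorem isTraceClass_adjoint_comp {A B : H →L[ℂ] H'} (hA : IsHS A) (hB : IsHS B) :
    IsTraceClass (adjoint A ∘L B) := by
  obtain ⟨W, -, hW, -⟩ := exists_polar (adjoint A ∘L B)
  refine ⟨_, stdBasis H, ?_⟩
  rw [hW]
  refine Summable.of_nonneg_of_le (fun _ => norm_nonneg _) (fun i => ?_)
    ((hA.comp_right W).summable_norm_mul hB (stdBasis H))
  simp only [ContinuousLinearMap.comp_apply, ContinuousLinearMap.adjoint_inner_right]
  exact norm_inner_le_norm _ _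

/-- A positive operator is its own absolute value, and the diagonal entries of `A* A` are the
squares `‖A b‖²`. -/
theorem isHS_of_isTraceClass {A : H →L[ℂ] H'} (h : IsTraceClass (adjoint A ∘L A)) : IsHS A := by
  obtain ⟨w, b, hb⟩ := h
  rw [isHS_iff_summable b]
  have hnn : 0 ≤ adjoint A ∘L A := by
    rw [ContinuousLinearMap.nonneg_iff_isPositive]
    exact ContinuousLinearMap.isPositive_adjoint_comp_self A
  rw [CFC.abs_of_nonneg _ hnn] at hb
  refine hb.congr fun i => ?_
  simp only [ContinuousLinearMap.comp_apply, ContinuousLinearMap.adjoint_inner_right]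
  rw [inner_self_eq_norm_sq_to_K]
  simp

theorem opTrace_adjoint_comp (A B : H →L[ℂ] H') : opTrace (adjoint A ∘L B) = hsInner A B := by
  simp [opTrace, hsInner, ContinuousLinearMap.adjoint_inner_right]

end TraceClass

/-! ### Averaging over the group and locally Hilbert-Schmidt operators. -/

section LocalRep

/-- A unitary representation `U` of `G` on a Hilbert space, together with an equivariant family
`M` of multiplication operators, indexed by a set `𝓣` of test functions on which `G` acts by `τ`,
such that the pairs in `cut` are cutoff pairs. -/
structure LocalRep {G : Type*} [Group G] [TopologicalSpace G] [MeasurableSpace G] (μ : Measure G)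
    {𝓣 : Type*} (τ : G → 𝓣 → 𝓣) (cut : Set (𝓣 × 𝓣))
    (H : Type*) [NormedAddCommGroup H] [InnerProductSpace ℂ H] [CompleteSpace H] where
  U : G → H →L[ℂ] H
  M : 𝓣 → H →L[ℂ] H
  core : Submodule ℂ H
  dense_core : Dense (core : Set H)
  adjoint_U : ∀ g, adjoint (U g) = U g⁻¹
  U_comp_U_inv : ∀ g, U g ∘L U g⁻¹ = ContinuousLinearMap.id ℂ H
  adjoint_M : ∀ φ, ∃ ψ, adjoint (M φ) = M ψ
  M_translate : ∀ g φ, M (τ g φ) = U g ∘L M φ ∘L U g⁻¹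
  continuous_core : ∀ φ, ∀ w ∈ core, Continuous fun g => M (τ g φ) w
  upper_core : ∀ φ, ∃ b : ℝ≥0, ∀ w ∈ core, ∫⁻ g, ‖M (τ g φ) w‖ₑ ^ 2 ∂μ ≤ b * ‖w‖ₑ ^ 2
  lower_core : ∃ φ, ∃ a : ℝ≥0, a ≠ 0 ∧
    ∀ w ∈ core, a * ‖w‖ₑ ^ 2 ≤ ∫⁻ g, ‖M (τ g φ) w‖ₑ ^ 2 ∂μ
  adjoint_cut : ∀ d ∈ cut, adjoint (M d.1) = M d.1 ∧ adjoint (M d.2) = M d.2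
  integral_core : ∀ d ∈ cut, ∀ v ∈ core, ∀ w ∈ core,
    ∫ g, ⟪M (τ g d.1) v, M (τ g d.2) w⟫_ℂ ∂μ = ⟪v, w⟫_ℂ

variable {G : Type*} [Group G] [TopologicalSpace G] [IsTopologicalGroup G] [MeasurableSpace G]
  [BorelSpace G] {μ : Measure G} [μ.IsInvInvariant]
  {𝓣 : Type*} {τ : G → 𝓣 → 𝓣} {cut : Set (𝓣 × 𝓣)}
  {H : Type*} [NormedAddCommGroup H] [InnerProductSpace ℂ H] [CompleteSpace H]
  {H₀ : Type*} [NormedAddCommGroup H₀] [InnerProductSpace ℂ H₀] [CompleteSpace H₀]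
  {H₁ : Type*} [NormedAddCommGroup H₁] [InnerProductSpace ℂ H₁] [CompleteSpace H₁]
  {H₂ : Type*} [NormedAddCommGroup H₂] [InnerProductSpace ℂ H₂] [CompleteSpace H₂]
  {L : LocalRep μ τ cut H} {L₀ : LocalRep μ τ cut H₀} {L₁ : LocalRep μ τ cut H₁}
  {L₂ : LocalRep μ τ cut H₂}

namespace LocalRep

theorem U_inv_comp_U (L : LocalRep μ τ cut H) (g : G) :
    L.U g⁻¹ ∘L L.U g = ContinuousLinearMap.id ℂ H := by
  simpa using L.U_comp_U_inv g⁻¹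

theorem U_U_inv_apply (L : LocalRep μ τ cut H) (g : G) (x : H) : L.U g (L.U g⁻¹ x) = x :=
  congr($(L.U_comp_U_inv g) x)

theorem U_inv_U_apply (L : LocalRep μ τ cut H) (g : G) (x : H) : L.U g⁻¹ (L.U g x) = x :=
  congr($(L.U_inv_comp_U g) x)

theorem norm_U_apply (L : LocalRep μ τ cut H) (g : G) (x : H) : ‖L.U g x‖ = ‖x‖ := by
  rw [← sq_eq_sq₀ (norm_nonneg _) (norm_nonneg _), ← inner_self_eq_norm_sq (𝕜 := ℂ) (L.U g x),
    ← ContinuousLinearMap.adjoint_inner_right, L.adjoint_U, U_inv_U_apply, inner_self_eq_norm_sq]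

theorem hsSq_U_comp (L : LocalRep μ τ cut H) (g : G) (T : H₀ →L[ℂ] H) :
    hsSq (L.U g ∘L T) = hsSq T := by
  simp only [hsSq, ContinuousLinearMap.comp_apply, enorm_sq_eq_ofReal, norm_U_apply]

theorem hsSq_comp_U (L : LocalRep μ τ cut H) (g : G) (T : H →L[ℂ] H₀) :
    hsSq (T ∘L L.U g) = hsSq T := by
  rw [← hsSq_adjoint, ContinuousLinearMap.adjoint_comp, L.adjoint_U, hsSq_U_comp, hsSq_adjoint]

theorem norm_M_translate_le (L : LocalRep μ τ cut H) (φ : 𝓣) (g : G) (w : H) :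
    ‖L.M (τ g φ) w‖ ≤ ‖L.M φ‖ * ‖w‖ := by
  rw [L.M_translate, ContinuousLinearMap.comp_apply, norm_U_apply, ContinuousLinearMap.comp_apply,
    ← L.norm_U_apply g⁻¹ w]
  exact (L.M φ).le_opNorm _

/-- The norm of `M (τ g φ)` is bounded independently of `g`, so approximating `w` from the core
gives a uniform approximation in `g`. -/
theorem continuous_M (L : LocalRep μ τ cut H) (φ : 𝓣) (w : H) :
    Continuous fun g => L.M (τ g φ) w := by
  refine continuous_of_uniform_approx_of_continuous fun u hu => ?_
  obtain ⟨ε, hε, hεu⟩ := Metric.mem_uniformity_dist.1 hu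
  obtain ⟨w', hw', hdist⟩ := Metric.dense_iff.1 L.dense_core w (ε / (‖L.M φ‖ + 1)) (by positivity)
  refine ⟨fun g => L.M (τ g φ) w', L.continuous_core φ w' hdist, fun g => hεu ?_⟩
  rw [dist_eq_norm, ← map_sub]
  rw [Metric.mem_ball, dist_comm, dist_eq_norm, lt_div_iff₀ (by positivity)] at hw'
  refine (L.norm_M_translate_le φ g _).trans_lt (lt_of_le_of_lt ?_ hw')
  nlinarith [norm_nonneg (w - w'), norm_nonneg (L.M φ)]

theorem measurable_enorm_M_sq (L : LocalRep μ τ cut H) (φ : 𝓣) (w : H) :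
    Measurable fun g => ‖L.M (τ g φ) w‖ₑ ^ 2 :=
  (L.continuous_M φ w).enorm.measurable.pow_const 2

theorem exists_seq_core (L : LocalRep μ τ cut H) (w : H) :
    ∃ u : ℕ → H, (∀ k, u k ∈ L.core) ∧ Tendsto u atTop (𝓝 w) :=
  mem_closure_iff_seq_limit.1 (L.dense_core w)

theorem tendsto_const_mul_enorm_sq {u : ℕ → H} {w : H} (hu : Tendsto u atTop (𝓝 w)) (b : ℝ≥0) :
    Tendsto (fun k => (b : ℝ≥0∞) * ‖u k‖ₑ ^ 2) atTop (𝓝 (b * ‖w‖ₑ ^ 2)) :=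
  ENNReal.Tendsto.const_mul (ENNReal.Tendsto.pow hu.enorm) (Or.inr ENNReal.coe_ne_top)

/-- Fatou's lemma along a sequence of core vectors. -/
theorem upper (L : LocalRep μ τ cut H) (φ : 𝓣) :
    ∃ b : ℝ≥0, ∀ w, ∫⁻ g, ‖L.M (τ g φ) w‖ₑ ^ 2 ∂μ ≤ b * ‖w‖ₑ ^ 2 := by
  obtain ⟨b, hb⟩ := L.upper_core φ
  refine ⟨b, fun w => ?_⟩
  obtain ⟨u, hu, hlim⟩ := L.exists_seq_core w
  calc ∫⁻ g, ‖L.M (τ g φ) w‖ₑ ^ 2 ∂μ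
      = ∫⁻ g, liminf (fun k => ‖L.M (τ g φ) (u k)‖ₑ ^ 2) atTop ∂μ := by
        refine lintegral_congr fun g => (Tendsto.liminf_eq ?_).symm
        exact ENNReal.Tendsto.pow (((L.M (τ g φ)).continuous.tendsto w).comp hlim).enorm
    _ ≤ liminf (fun k => ∫⁻ g, ‖L.M (τ g φ) (u k)‖ₑ ^ 2 ∂μ) atTop :=
        lintegral_liminf_le fun k => L.measurable_enorm_M_sq φ _
    _ ≤ liminf (fun k => (b : ℝ≥0∞) * ‖u k‖ₑ ^ 2) atTop :=
        liminf_le_liminf (.of_forall fun k => hb _ (hu k))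
    _ = b * ‖w‖ₑ ^ 2 := (tendsto_const_mul_enorm_sq hlim b).liminf_eq

theorem enorm_sq_le_two_mul (x y : H) : ‖x‖ₑ ^ 2 ≤ 2 * ‖y‖ₑ ^ 2 + 2 * ‖x - y‖ₑ ^ 2 := by
  have h : ‖x‖ ^ 2 ≤ 2 * ‖y‖ ^ 2 + 2 * ‖x - y‖ ^ 2 := by
    have := norm_add_le y (x - y)
    rw [add_sub_cancel] at this
    nlinarith [sq_nonneg (‖y‖ - ‖x - y‖), norm_nonneg x, norm_nonneg y, norm_nonneg (x - y)]
  simp only [enorm_sq_eq_ofReal]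
  refine (ENNReal.ofReal_le_ofReal h).trans_eq ?_
  rw [ENNReal.ofReal_add (by positivity) (by positivity), ENNReal.ofReal_mul zero_le_two,
    ENNReal.ofReal_mul zero_le_two, ENNReal.ofReal_ofNat]

/-- Fatou points the wrong way here. The error made in replacing `w` by a core vector is controlled
instead by the upper bound. -/
theorem lower (L : LocalRep μ τ cut H) : ∃ φ, ∃ a : ℝ≥0, a ≠ 0 ∧
    ∀ w, a * ‖w‖ₑ ^ 2 ≤ ∫⁻ g, ‖L.M (τ g φ) w‖ₑ ^ 2 ∂μ := by
  obtain ⟨φ, a, ha, hlow⟩ := L.lower_core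
  obtain ⟨b, hb⟩ := L.upper φ
  -- The factor two is lost to `‖x‖² ≤ 2 ‖y‖² + 2 ‖x - y‖²`.
  refine ⟨φ, a / 2, by simpa using ha, fun w => ?_⟩
  obtain ⟨u, hu, hlim⟩ := L.exists_seq_core w
  have key : ∀ k, a * ‖u k‖ₑ ^ 2 ≤
      2 * ∫⁻ g, ‖L.M (τ g φ) w‖ₑ ^ 2 ∂μ + (2 * b : ℝ≥0) * ‖u k - w‖ₑ ^ 2 := fun k => by
    calc a * ‖u k‖ₑ ^ 2 ≤ ∫⁻ g, ‖L.M (τ g φ) (u k)‖ₑ ^ 2 ∂μ := hlow _ (hu k)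
      _ ≤ ∫⁻ g, (2 * ‖L.M (τ g φ) w‖ₑ ^ 2 + 2 * ‖L.M (τ g φ) (u k - w)‖ₑ ^ 2) ∂μ := by
        refine lintegral_mono fun g => ?_
        simp only [map_sub]
        exact enorm_sq_le_two_mul _ _
      _ = 2 * ∫⁻ g, ‖L.M (τ g φ) w‖ₑ ^ 2 ∂μ + 2 * ∫⁻ g, ‖L.M (τ g φ) (u k - w)‖ₑ ^ 2 ∂μ := by
        rw [lintegral_add_left ((L.measurable_enorm_M_sq φ w).const_mul 2),
          lintegral_const_mul _ (L.measurable_enorm_M_sq φ _),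
          lintegral_const_mul _ (L.measurable_enorm_M_sq φ _)]
      _ ≤ _ := by
        rw [ENNReal.coe_mul, mul_assoc]
        gcongr
        · simp
        · exact hb _
  have hlim0 : Tendsto (fun k => u k - w) atTop (𝓝 0) := by
    simpa using hlim.sub_const w
  have h2 := le_of_tendsto_of_tendsto' (tendsto_const_mul_enorm_sq hlim a)
    (tendsto_const_nhds.add (tendsto_const_mul_enorm_sq hlim0 (2 * b))) key
  rw [enorm_zero, zero_pow two_ne_zero, mul_zero, add_zero] at h2
  rw [ENNReal.coe_div two_ne_zero, ENNReal.div_eq_inv_mul, mul_assoc]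
  rw [ENNReal.coe_ofNat]
  exact ENNReal.inv_mul_le_iff two_ne_zero ENNReal.ofNat_ne_top |>.2 h2

theorem integrable_norm_sq (L : LocalRep μ τ cut H) (φ : 𝓣) :
    ∃ b : ℝ, ∀ w, Integrable (fun g => ‖L.M (τ g φ) w‖ ^ 2) μ ∧
      ∫ g, ‖L.M (τ g φ) w‖ ^ 2 ∂μ ≤ b * ‖w‖ ^ 2 := by
  obtain ⟨b, hb⟩ := L.upper φ
  refine ⟨b, fun w => ?_⟩
  have hm : AEStronglyMeasurable (fun g => ‖L.M (τ g φ) w‖ ^ 2) μ :=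
    ((L.continuous_M φ w).norm.pow 2).measurable.aestronglyMeasurable
  have hfin : b * ‖w‖ₑ ^ 2 ≠ ⊤ := ENNReal.mul_ne_top (by simp) (by simp)
  have heq : ∫⁻ g, ENNReal.ofReal (‖L.M (τ g φ) w‖ ^ 2) ∂μ ≤ b * ‖w‖ₑ ^ 2 := by
    simpa only [← enorm_sq_eq_ofReal] using hb w
  constructor
  · refine ⟨hm, ?_⟩
    rw [hasFiniteIntegral_iff_ofReal (.of_forall fun _ => by positivity)]
    exact heq.trans_lt hfin.lt_top
  · rw [integral_eq_lintegral_of_nonneg_ae (.of_forall fun _ => by positivity) hm]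
    refine (ENNReal.toReal_mono hfin heq).trans_eq ?_
    simp

theorem integrable_inner (L : LocalRep μ τ cut H) (φ ψ : 𝓣) (v w : H) :
    Integrable (fun g => ⟪L.M (τ g φ) v, L.M (τ g ψ) w⟫_ℂ) μ := by
  obtain ⟨b, hb⟩ := L.integrable_norm_sq φ
  obtain ⟨b', hb'⟩ := L.integrable_norm_sq ψ
  refine ((hb v).1.add (hb' w).1).mono' ?_ (.of_forall fun g => ?_)
  · exact ((L.continuous_M φ v).inner (L.continuous_M ψ w)).measurable.aestronglyMeasurable
  · refine (norm_inner_le_norm _ _).trans ?_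
    simp only [Pi.add_apply]
    nlinarith [sq_nonneg (‖L.M (τ g φ) v‖ - ‖L.M (τ g ψ) w‖), sq_nonneg ‖L.M (τ g φ) v‖,
      sq_nonneg ‖L.M (τ g ψ) w‖]

theorem integral_norm_inner_le (L : LocalRep μ τ cut H) (φ ψ : 𝓣) :
    ∃ b b' : ℝ, ∀ v w, ∫ g, ‖⟪L.M (τ g φ) v, L.M (τ g ψ) w⟫_ℂ‖ ∂μ ≤
      b * ‖v‖ ^ 2 + b' * ‖w‖ ^ 2 := by
  obtain ⟨b, hb⟩ := L.integrable_norm_sq φ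
  obtain ⟨b', hb'⟩ := L.integrable_norm_sq ψ
  refine ⟨b, b', fun v w => ?_⟩
  refine le_trans ?_ (add_le_add (hb v).2 (hb' w).2)
  rw [← integral_add (hb v).1 (hb' w).1]
  refine integral_mono (L.integrable_inner φ ψ v w).norm ((hb v).1.add (hb' w).1) fun g => ?_
  refine (norm_inner_le_norm _ _).trans ?_
  nlinarith [sq_nonneg (‖L.M (τ g φ) v‖ - ‖L.M (τ g ψ) w‖), sq_nonneg ‖L.M (τ g φ) v‖,
    sq_nonneg ‖L.M (τ g ψ) w‖]

/-- The sesquilinear form `∫ ⟨M (g φ) v, M (g ψ) w⟩ dg`. -/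
def averageForm (L : LocalRep μ τ cut H) (φ ψ : 𝓣) : H →ₗ⋆[ℂ] H →ₗ[ℂ] ℂ :=
  LinearMap.mk₂'ₛₗ (starRingEnd ℂ) (RingHom.id ℂ)
    (fun v w => ∫ g, ⟪L.M (τ g φ) v, L.M (τ g ψ) w⟫_ℂ ∂μ)
    (fun v v' w => by
      simp only [map_add, inner_add_left]
      exact integral_add (L.integrable_inner φ ψ v w) (L.integrable_inner φ ψ v' w))
    (fun c v w => by
      simp only [map_smul, inner_smul_left, smul_eq_mul, integral_const_mul])
    (fun v w w' => by
      simp only [map_add, inner_add_right]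
      exact integral_add (L.integrable_inner φ ψ v w) (L.integrable_inner φ ψ v w'))
    (fun c v w => by
      simp only [map_smul, inner_smul_right, smul_eq_mul, integral_const_mul, RingHom.id_apply])

theorem norm_averageForm_le (L : LocalRep μ τ cut H) (φ ψ : 𝓣) :
    ∃ C : ℝ, ∀ v w, ‖L.averageForm φ ψ v w‖ ≤ C * ‖v‖ * ‖w‖ := by
  obtain ⟨b, b', hb⟩ := L.integral_norm_inner_le φ ψ
  refine ⟨b + b', fun v w => ?_⟩
  rcases eq_or_ne v 0 with rfl | hv
  · simp
  rcases eq_or_ne w 0 with rfl | hw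
  · simp
  have hv' : (‖v‖ : ℂ) ≠ 0 := by simpa using hv
  have hw' : (‖w‖ : ℂ) ≠ 0 := by simpa using hw
  -- The available bound is a sum of squares; rescaling to unit vectors turns it into a product of
  -- norms.
  have h1 : L.averageForm φ ψ v w =
      ‖v‖ * (‖w‖ * L.averageForm φ ψ ((‖v‖ : ℂ)⁻¹ • v) ((‖w‖ : ℂ)⁻¹ • w)) := by
    simp only [map_smulₛₗ, LinearMap.smul_apply, smul_eq_mul, map_inv₀, Complex.conj_ofReal,
      RingHom.id_apply]
    field_simp
  have hn : ∀ x : H, x ≠ 0 → ‖((‖x‖ : ℂ)⁻¹ • x)‖ = 1 := fun x hx => by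
    rw [norm_smul, norm_inv, Complex.norm_real, norm_norm, inv_mul_cancel₀ (norm_ne_zero_iff.2 hx)]
  have h2 := (norm_integral_le_integral_norm _).trans (hb ((‖v‖ : ℂ)⁻¹ • v) ((‖w‖ : ℂ)⁻¹ • w))
  rw [hn v hv, hn w hw] at h2
  have h3 : ‖L.averageForm φ ψ ((‖v‖ : ℂ)⁻¹ • v) ((‖w‖ : ℂ)⁻¹ • w)‖ ≤ b + b' := by
    rw [one_pow, mul_one, mul_one] at h2
    exact h2
  rw [h1, norm_mul, norm_mul, Complex.norm_real, Complex.norm_real, norm_norm, norm_norm]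
  calc ‖v‖ * (‖w‖ * _) ≤ ‖v‖ * (‖w‖ * (b + b')) := by gcongr
    _ = _ := by ring

theorem integral_cut (L : LocalRep μ τ cut H) (d : 𝓣 × 𝓣) (hd : d ∈ cut) (v w : H) :
    ∫ g, ⟪L.M (τ g d.1) v, L.M (τ g d.2) w⟫_ℂ ∂μ = ⟪v, w⟫_ℂ := by
  obtain ⟨C, hC⟩ := L.norm_averageForm_le d.1 d.2
  let B := (L.averageForm d.1 d.2).mkContinuous₂ C hC
  have hB : Continuous fun p : H × H => B p.1 p.2 := by fun_prop
  have hdense : Dense ((L.core : Set H) ×ˢ (L.core : Set H)) := L.dense_core.prod L.dense_core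
  have := Continuous.ext_on hdense hB
    (g := fun p : H × H => ⟪p.1, p.2⟫_ℂ) (by fun_prop)
    fun p hp => L.integral_core d hd p.1 hp.1 p.2 hp.2
  exact congr_fun this (v, w)

/-- The operator `A` is equivariant. -/
def Equivariant (L₀ : LocalRep μ τ cut H₀) (L₁ : LocalRep μ τ cut H₁) (A : H₀ →L[ℂ] H₁) : Prop :=
  ∀ g, A ∘L L₀.U g = L₁.U g ∘L A

namespace Equivariant

theorem apply {A : H₀ →L[ℂ] H₁} (hA : Equivariant L₀ L₁ A) (g : G) (x : H₀) :
    A (L₀.U g x) = L₁.U g (A x) := congr($(hA g) x)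

theorem adjoint {A : H₀ →L[ℂ] H₁} (hA : Equivariant L₀ L₁ A) :
    Equivariant L₁ L₀ (adjoint A) := fun g => by
  have := congr(ContinuousLinearMap.adjoint $(hA g⁻¹))
  rw [ContinuousLinearMap.adjoint_comp, ContinuousLinearMap.adjoint_comp, L₀.adjoint_U,
    L₁.adjoint_U, inv_inv] at this
  exact this.symm

theorem comp {B : H₁ →L[ℂ] H₂} {A : H₀ →L[ℂ] H₁} (hB : Equivariant L₁ L₂ B)
    (hA : Equivariant L₀ L₁ A) : Equivariant L₀ L₂ (B ∘L A) := fun g => by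
  ext x
  simp [hA.apply, hB.apply]

theorem sub {A B : H₀ →L[ℂ] H₁} (hA : Equivariant L₀ L₁ A) (hB : Equivariant L₀ L₁ B) :
    Equivariant L₀ L₁ (A - B) := fun g => by
  ext x
  simp [hA.apply, hB.apply]

theorem smul {A : H₀ →L[ℂ] H₁} (hA : Equivariant L₀ L₁ A) (c : ℂ) :
    Equivariant L₀ L₁ (c • A) := fun g => by
  ext x
  simp [hA.apply]

theorem sum {ι : Type*} {s : Finset ι} {A : ι → H₀ →L[ℂ] H₁}
    (hA : ∀ i ∈ s, Equivariant L₀ L₁ (A i)) : Equivariant L₀ L₁ (∑ i ∈ s, A i) := fun g => by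
  ext x
  simp only [ContinuousLinearMap.comp_apply, _root_.sum_apply, map_sum]
  exact Finset.sum_congr rfl fun i hi => (hA i hi).apply g x

theorem one : Equivariant L L (1 : H →L[ℂ] H) := fun _ => rfl

theorem mul {A B : H →L[ℂ] H} (hA : Equivariant L L A) (hB : Equivariant L L B) :
    Equivariant L L (A * B) := hA.comp hB

theorem pow {A : H →L[ℂ] H} (hA : Equivariant L L A) (k : ℕ) : Equivariant L L (A ^ k) := by
  induction k with
  | zero => simpa using one
  | succ k ih => rw [pow_succ]; exact ih.mul hA

end Equivariant

/-- Taking the adjoint and conjugating by the unitary `U g` preserve the Hilbert-Schmidt norm. Since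
`A` is equivariant, together they carry the translation by `g` on one side into a translation by
`g⁻¹` on the other. -/
theorem hsSq_M_comp_translate {A : H₀ →L[ℂ] H₁} (hA : Equivariant L₀ L₁ A) {φ φ' ψ ψ' : 𝓣}
    (hφ : adjoint (L₀.M φ) = L₀.M φ') (hψ : adjoint (L₁.M ψ) = L₁.M ψ') (g : G) :
    hsSq (L₀.M (τ g φ) ∘L adjoint A ∘L L₁.M ψ) = hsSq (L₁.M (τ g⁻¹ ψ') ∘L A ∘L L₀.M φ') := by
  rw [L₀.M_translate, L₁.M_translate, ← hsSq_adjoint]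
  simp only [ContinuousLinearMap.adjoint_comp, ContinuousLinearMap.adjoint_adjoint, hφ, hψ,
    L₀.adjoint_U, inv_inv]
  rw [← L₁.hsSq_U_comp g ((L₁.U g⁻¹ ∘L L₁.M ψ' ∘L L₁.U g) ∘L A ∘L L₀.M φ'),
    ← L₀.hsSq_comp_U g⁻¹ (L₁.U g ∘L _)]
  congr 1
  ext x
  simp [hA.apply, L₁.U_U_inv_apply]

theorem hsInner_conj_U (L₀ : LocalRep μ τ cut H₀) (L₁ : LocalRep μ τ cut H₁) {S T : H₀ →L[ℂ] H₁}
    (hS : IsHS S) (hT : IsHS T) (g : G) :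
    hsInner (L₁.U g⁻¹ ∘L S ∘L L₀.U g) (L₁.U g⁻¹ ∘L T ∘L L₀.U g) = hsInner S T := by
  rw [hsInner_comp_left, L₁.adjoint_U, inv_inv,
    ← ContinuousLinearMap.comp_assoc (L₁.U g), L₁.U_comp_U_inv, ContinuousLinearMap.id_comp,
    hsInner_comp_right (hS.comp_right _) hT, L₀.adjoint_U, ContinuousLinearMap.comp_assoc,
    L₀.U_comp_U_inv, ContinuousLinearMap.comp_id]

/-- The bilinear counterpart of `hsSq_M_comp_translate`: it is the identity of integrands behind
`LocHS.hsInner_swap`. -/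
theorem hsInner_M_comp_translate {A B : H₀ →L[ℂ] H₁} (hA : Equivariant L₀ L₁ A)
    (hB : Equivariant L₀ L₁ B) {c d : 𝓣 × 𝓣} (hc : c ∈ cut) (hd : d ∈ cut)
    (hA₁ : IsHS (A ∘L L₀.M c.1)) (hB₁ : IsHS (B ∘L L₀.M c.2)) (g : G) :
    hsInner (L₁.M (τ g d.1) ∘L A ∘L L₀.M c.1) (L₁.M (τ g d.2) ∘L B ∘L L₀.M c.2) =
      hsInner (L₀.M (τ g⁻¹ c.2) ∘L adjoint B ∘L L₁.M d.2)
        (L₀.M (τ g⁻¹ c.1) ∘L adjoint A ∘L L₁.M d.1) := by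
  have hc' := L₀.adjoint_cut c hc
  have hd' := L₁.adjoint_cut d hd
  have key : ∀ (T : H₀ →L[ℂ] H₁) (hT : Equivariant L₀ L₁ T) (γ δ : 𝓣),
      adjoint (L₀.M γ) = L₀.M γ → adjoint (L₁.M δ) = L₁.M δ →
      adjoint (L₀.M (τ g⁻¹ γ) ∘L adjoint T ∘L L₁.M δ) =
        L₁.U g⁻¹ ∘L (L₁.M (τ g δ) ∘L T ∘L L₀.M γ) ∘L L₀.U g := fun T hT γ δ hγ hδ => by
    rw [L₀.M_translate, L₁.M_translate]
    simp only [ContinuousLinearMap.adjoint_comp, ContinuousLinearMap.adjoint_adjoint, hγ, hδ,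
      L₀.adjoint_U, inv_inv]
    ext x
    simp [hT.apply, L₁.U_inv_U_apply]
  have hA₂ := hA₁.comp_left (L₁.M (τ g d.1))
  have hB₂ := hB₁.comp_left (L₁.M (τ g d.2))
  have e1 := key A hA c.1 d.1 hc'.1 hd'.1
  have e2 := key B hB c.2 d.2 hc'.2 hd'.2
  have hA₃ : IsHS (L₀.M (τ g⁻¹ c.1) ∘L adjoint A ∘L L₁.M d.1) := by
    rw [← isHS_adjoint, e1]
    exact (hA₂.comp_right _).comp_left _
  have hB₃ : IsHS (L₀.M (τ g⁻¹ c.2) ∘L adjoint B ∘L L₁.M d.2) := by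
    rw [← isHS_adjoint, e2]
    exact (hB₂.comp_right _).comp_left _
  rw [← hsInner_adjoint hB₃ hA₃, e1, e2, hsInner_conj_U L₀ L₁ hA₂ hB₂]

theorem IsHS.countable_support {ι : Type*} {T : H₀ →L[ℂ] H} (hT : IsHS T)
    (b : HilbertBasis ι ℂ H₀) : {i | T (b i) ≠ 0}.Countable := by
  refine (((isHS_iff_summable b T).1 hT).countable_support).mono fun i hi => ?_
  simpa using hi

theorem lintegral_hsSq_le (L : LocalRep μ τ cut H) {ψ : 𝓣} {b : ℝ≥0}
    (hb : ∀ w, ∫⁻ g, ‖L.M (τ g ψ) w‖ₑ ^ 2 ∂μ ≤ b * ‖w‖ₑ ^ 2) {T : H₀ →L[ℂ] H} (hT : IsHS T) :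
    ∫⁻ g, hsSq (L.M (τ g ψ) ∘L T) ∂μ ≤ b * hsSq T := by
  -- The Hilbert space need not be separable. Sum and integral can be exchanged because only
  -- countably many basis vectors contribute.
  have hcount := (IsHS.countable_support hT (stdBasis H₀))
  set s := {i | T (stdBasis H₀ i) ≠ 0} with hs
  have : Countable s := hcount
  have h1 : ∀ g, hsSq (L.M (τ g ψ) ∘L T) = ∑' i : s, ‖L.M (τ g ψ) (T (stdBasis H₀ i))‖ₑ ^ 2 := by
    intro g
    rw [tsum_subtype_eq_of_support_subset (f := fun i => ‖L.M (τ g ψ) (T (stdBasis H₀ i))‖ₑ ^ 2)]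
    · rfl
    · intro i hi h0
      simp [h0] at hi
  simp_rw [h1]
  rw [lintegral_tsum fun i => ((L.continuous_M ψ _).enorm.measurable.pow_const 2).aemeasurable,
    hsSq,
    ← ENNReal.tsum_mul_left]
  refine (ENNReal.tsum_le_tsum fun i => hb _).trans ?_
  exact ENNReal.tsum_comp_le_tsum_of_injective Subtype.val_injective
    fun i => (b : ℝ≥0∞) * ‖T (stdBasis H₀ i)‖ₑ ^ 2

/-- The equivariant operators that are locally Hilbert-Schmidt. -/
structure LocHS (L₀ : LocalRep μ τ cut H₀) (L₁ : LocalRep μ τ cut H₁) (A : H₀ →L[ℂ] H₁) :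
    Prop where
  equivariant : Equivariant L₀ L₁ A
  isHS : ∀ φ, IsHS (A ∘L L₀.M φ)

namespace LocHS

/-- The cutoff has to change sides. The lower bound inserts translated multipliers to the left of
`A*`, `hsSq_M_comp_translate` and the substitution `g ↦ g⁻¹` turn the integrand into one for `A`,
and the upper bound then removes the other multiplier. -/
theorem adjoint {A : H₀ →L[ℂ] H₁} (hA : LocHS L₀ L₁ A) : LocHS L₁ L₀ (adjoint A) := by
  refine ⟨hA.equivariant.adjoint, fun ψ => ?_⟩
  obtain ⟨φ, a, ha, hlow⟩ := L₀.lower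
  obtain ⟨φ', hφ⟩ := L₀.adjoint_M φ
  obtain ⟨ψ', hψ⟩ := L₁.adjoint_M ψ
  obtain ⟨b, hb⟩ := L₁.upper ψ'
  have hle : a * hsSq (ContinuousLinearMap.adjoint A ∘L L₁.M ψ) ≤ b * hsSq (A ∘L L₀.M φ') := by
    -- Finite partial sums are used because countability of the support is not known before the sum
    -- is known to be finite.
    rw [hsSq, ← ENNReal.tsum_mul_left, ENNReal.tsum_eq_iSup_sum]
    refine iSup_le fun s => ?_
    calc _ ≤ ∑ j ∈ s, ∫⁻ g, ‖L₀.M (τ g φ)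
            ((ContinuousLinearMap.adjoint A ∘L L₁.M ψ) (stdBasis H₁ j))‖ₑ ^ 2 ∂μ :=
          Finset.sum_le_sum fun j _ => hlow _
      _ = ∫⁻ g, ∑ j ∈ s, ‖L₀.M (τ g φ)
            ((ContinuousLinearMap.adjoint A ∘L L₁.M ψ) (stdBasis H₁ j))‖ₑ ^ 2 ∂μ :=
          (lintegral_finsetSum' _ fun j _ =>
            ((L₀.continuous_M φ _).enorm.measurable.pow_const 2).aemeasurable).symm
      _ ≤ ∫⁻ g, hsSq (L₁.M (τ g⁻¹ ψ') ∘L A ∘L L₀.M φ') ∂μ := by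
          refine lintegral_mono fun g => ?_
          rw [← hsSq_M_comp_translate hA.equivariant hφ hψ]
          exact ENNReal.sum_le_tsum s
      _ = ∫⁻ g, hsSq (L₁.M (τ g ψ') ∘L A ∘L L₀.M φ') ∂μ :=
          lintegral_inv_eq_self (μ := μ) fun g => hsSq (L₁.M (τ g ψ') ∘L A ∘L L₀.M φ')
      _ ≤ _ := L₁.lintegral_hsSq_le hb (hA.isHS φ')
  intro htop
  rw [htop, ENNReal.mul_top (by simpa using ha), top_le_iff] at hle
  exact ENNReal.mul_ne_top ENNReal.coe_ne_top (hA.isHS φ') hle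

theorem comp_left {A : H₀ →L[ℂ] H₁} (hA : LocHS L₀ L₁ A) {B : H₁ →L[ℂ] H₂}
    (hB : Equivariant L₁ L₂ B) : LocHS L₀ L₂ (B ∘L A) :=
  ⟨hB.comp hA.equivariant, fun φ => (hA.isHS φ).comp_left B⟩

/-- Not formal, since `B` need not commute with the multipliers; passing to adjoints puts `B` on the
harmless side. -/
theorem comp_right {A : H₁ →L[ℂ] H₂} (hA : LocHS L₁ L₂ A) {B : H₀ →L[ℂ] H₁}
    (hB : Equivariant L₀ L₁ B) : LocHS L₀ L₂ (A ∘L B) := by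
  have := (hA.adjoint.comp_left hB.adjoint).adjoint
  rwa [ContinuousLinearMap.adjoint_comp, ContinuousLinearMap.adjoint_adjoint,
    ContinuousLinearMap.adjoint_adjoint] at this

end LocHS

/-- The resolution of the identity is inserted in every term of the pairing; summability of the
integrals of the norms lets sum and integral be exchanged. -/
theorem hsInner_eq_integral (L : LocalRep μ τ cut H) {φ ψ : 𝓣}
    (hcut : ∀ v w, ∫ g, ⟪L.M (τ g φ) v, L.M (τ g ψ) w⟫_ℂ ∂μ = ⟪v, w⟫_ℂ) {S T : H₀ →L[ℂ] H}
    (hS : IsHS S) (hT : IsHS T) :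
    hsInner S T = ∫ g, hsInner (L.M (τ g φ) ∘L S) (L.M (τ g ψ) ∘L T) ∂μ := by
  have hcount := (IsHS.countable_support hS (stdBasis H₀))
  set s := {i | S (stdBasis H₀ i) ≠ 0} with hs
  have : Countable s := hcount
  have hsub : ∀ (A B : H →L[ℂ] H), hsInner (A ∘L S) (B ∘L T) =
      ∑' i : s, ⟪A (S (stdBasis H₀ i)), B (T (stdBasis H₀ i))⟫_ℂ := by
    intro A B
    rw [tsum_subtype_eq_of_support_subset
      (f := fun i => ⟪A (S (stdBasis H₀ i)), B (T (stdBasis H₀ i))⟫_ℂ)]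
    · rfl
    · intro i hi h0
      simp [h0] at hi
  obtain ⟨b, b', hb⟩ := L.integral_norm_inner_le φ ψ
  have hsum : Summable fun i : s => ∫ g, ‖⟪L.M (τ g φ) (S (stdBasis H₀ i)),
      L.M (τ g ψ) (T (stdBasis H₀ i))⟫_ℂ‖ ∂μ := by
    refine Summable.of_nonneg_of_le (fun _ => integral_nonneg fun _ => norm_nonneg _)
      (fun i => hb _ _) ?_
    have := (((isHS_iff_summable (stdBasis H₀) S).1 hS).mul_left b).add
      (((isHS_iff_summable (stdBasis H₀) T).1 hT).mul_left b')
    exact this.subtype s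
  have := (hasSum_integral_of_summable_integral_norm
    (fun i : s => L.integrable_inner φ ψ (S (stdBasis H₀ i)) (T (stdBasis H₀ i))) hsum).tsum_eq
  simp_rw [hsub, ← this, hcut]
  simpa using hsub (ContinuousLinearMap.id ℂ H) (ContinuousLinearMap.id ℂ H)

theorem integral_cut_swap (L : LocalRep μ τ cut H) {d : 𝓣 × 𝓣} (hd : d ∈ cut) (v w : H) :
    ∫ g, ⟪L.M (τ g d.2) v, L.M (τ g d.1) w⟫_ℂ ∂μ = ⟪v, w⟫_ℂ := by
  rw [← inner_conj_symm v w, ← L.integral_cut d hd w v, ← integral_conj]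
  simp only [inner_conj_symm]

/-- The trace identity: `tr (c₁ A* B c₂) = tr (d₂ B A* d₁)`. -/
theorem LocHS.hsInner_swap {A B : H₀ →L[ℂ] H₁} (hA : LocHS L₀ L₁ A) (hB : LocHS L₀ L₁ B)
    {c d : 𝓣 × 𝓣} (hc : c ∈ cut) (hd : d ∈ cut) :
    hsInner (A ∘L L₀.M c.1) (B ∘L L₀.M c.2) =
      hsInner (ContinuousLinearMap.adjoint B ∘L L₁.M d.2)
        (ContinuousLinearMap.adjoint A ∘L L₁.M d.1) := by
  -- Both pairings become integrals over the group, the left one by means of `d` and the right one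
  -- by means of `c`; the integrands agree after `g ↦ g⁻¹`.
  rw [L₁.hsInner_eq_integral (L₁.integral_cut d hd) (hA.isHS _) (hB.isHS _),
    L₀.hsInner_eq_integral (L₀.integral_cut_swap hc) (hB.adjoint.isHS _) (hA.adjoint.isHS _),
    ← integral_inv_eq_self]
  refine integral_congr_ae (.of_forall fun g => ?_)
  simp only
  rw [hsInner_M_comp_translate hA.equivariant hB.equivariant hc hd (hA.isHS _) (hB.isHS _),
    inv_inv]

end LocalRep

end LocalRep

/-! ### The local trace: cyclicity, continuity and factorization. -/

section LocalTrace

variable {G : Type*} [Group G] [TopologicalSpace G] [IsTopologicalGroup G] [MeasurableSpace G]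
  [BorelSpace G] {μ : Measure G} [μ.IsInvInvariant]
  {𝓣 : Type*} {τ : G → 𝓣 → 𝓣} {cut : Set (𝓣 × 𝓣)}
  {H : Type*} [NormedAddCommGroup H] [InnerProductSpace ℂ H] [CompleteSpace H]
  {H₀ : Type*} [NormedAddCommGroup H₀] [InnerProductSpace ℂ H₀] [CompleteSpace H₀]
  {H₁ : Type*} [NormedAddCommGroup H₁] [InnerProductSpace ℂ H₁] [CompleteSpace H₁]
  {H₂ : Type*} [NormedAddCommGroup H₂] [InnerProductSpace ℂ H₂] [CompleteSpace H₂]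
  {L : LocalRep μ τ cut H} {L₀ : LocalRep μ τ cut H₀} {L₁ : LocalRep μ τ cut H₁}
  {L₂ : LocalRep μ τ cut H₂}

namespace LocalRep

/-- The trace of `c₁ S c₂`. -/
def tr (L : LocalRep μ τ cut H) (c : 𝓣 × 𝓣) (S : H →L[ℂ] H) : ℂ :=
  opTrace (L.M c.1 ∘L S ∘L L.M c.2)

theorem M_comp_adjoint_comp (L : LocalRep μ τ cut H) {c : 𝓣 × 𝓣} (hc : c ∈ cut)
    (X Y : H →L[ℂ] H₂) :
    L.M c.1 ∘L (adjoint X ∘L Y) ∘L L.M c.2 = adjoint (X ∘L L.M c.1) ∘L (Y ∘L L.M c.2) := by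
  rw [ContinuousLinearMap.adjoint_comp, (L.adjoint_cut c hc).1]
  rfl

theorem tr_adjoint_comp (L : LocalRep μ τ cut H) {c : 𝓣 × 𝓣} (hc : c ∈ cut)
    (X Y : H →L[ℂ] H₂) :
    L.tr c (adjoint X ∘L Y) = hsInner (X ∘L L.M c.1) (Y ∘L L.M c.2) := by
  rw [tr, L.M_comp_adjoint_comp hc, opTrace_adjoint_comp]

/-- `hsInner_swap` rewrites both traces as pairings of operators on `H₂`. There the multipliers no
longer separate `B` from the inner product, and `B` passes across it as an adjoint. -/
theorem tr_comm {X : H₁ →L[ℂ] H₂} {Y : H₀ →L[ℂ] H₂} {B : H₁ →L[ℂ] H₀} (hX : LocHS L₁ L₂ X)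
    (hY : LocHS L₀ L₂ Y) (hB : Equivariant L₁ L₀ B) {c d : 𝓣 × 𝓣} (hc : c ∈ cut) (hd : d ∈ cut) :
    L₁.tr c (adjoint X ∘L Y ∘L B) = L₀.tr d (B ∘L adjoint X ∘L Y) := by
  have h : B ∘L adjoint X ∘L Y = adjoint (X ∘L adjoint B) ∘L Y := by
    rw [ContinuousLinearMap.adjoint_comp, ContinuousLinearMap.adjoint_adjoint]
    rfl
  have hXB := hX.comp_right hB.adjoint
  rw [L₁.tr_adjoint_comp hc X (Y ∘L B), h, L₀.tr_adjoint_comp hd,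
    hX.hsInner_swap (hY.comp_right hB) hc hc, hXB.hsInner_swap hY hd hc,
    ContinuousLinearMap.adjoint_comp, ContinuousLinearMap.adjoint_comp,
    ContinuousLinearMap.adjoint_adjoint, ContinuousLinearMap.comp_assoc,
    ContinuousLinearMap.comp_assoc, hsInner_comp_left, ContinuousLinearMap.adjoint_adjoint]

/-- Products of two locally Hilbert-Schmidt operators. -/
def LocTC (L : LocalRep μ τ cut H) (S : H →L[ℂ] H) : Prop :=
  ∃ X Y : H →L[ℂ] H, LocHS L L X ∧ LocHS L L Y ∧ S = adjoint X ∘L Y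

namespace LocTC

variable {S : H →L[ℂ] H}

theorem comp_right (hS : LocTC L S) {B : H →L[ℂ] H} (hB : Equivariant L L B) :
    LocTC L (S ∘L B) := by
  obtain ⟨X, Y, hX, hY, rfl⟩ := hS
  exact ⟨X, Y ∘L B, hX, hY.comp_right hB, rfl⟩

theorem comp_left (hS : LocTC L S) {B : H →L[ℂ] H} (hB : Equivariant L L B) :
    LocTC L (B ∘L S) := by
  obtain ⟨X, Y, hX, hY, rfl⟩ := hS
  refine ⟨X ∘L adjoint B, Y, hX.comp_right hB.adjoint, hY, ?_⟩
  rw [ContinuousLinearMap.adjoint_comp, ContinuousLinearMap.adjoint_adjoint]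
  rfl

theorem tr_comp_comm (hS : LocTC L S) {B : H →L[ℂ] H} (hB : Equivariant L L B) {c d : 𝓣 × 𝓣}
    (hc : c ∈ cut) (hd : d ∈ cut) : L.tr c (S ∘L B) = L.tr d (B ∘L S) := by
  obtain ⟨X, Y, hX, hY, rfl⟩ := hS
  exact LocalRep.tr_comm hX hY hB hc hd

theorem tr_eq (hS : LocTC L S) {c d : 𝓣 × 𝓣} (hc : c ∈ cut) (hd : d ∈ cut) :
    L.tr c S = L.tr d S :=
  hS.tr_comp_comm Equivariant.one hc hd

theorem summable (hS : LocTC L S) {c : 𝓣 × 𝓣} (hc : c ∈ cut) :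
    Summable fun i => ⟪stdBasis H i, (L.M c.1 ∘L S ∘L L.M c.2) (stdBasis H i)⟫_ℂ := by
  obtain ⟨X, Y, hX, hY, rfl⟩ := hS
  rw [L.M_comp_adjoint_comp hc]
  simp_rw [ContinuousLinearMap.comp_apply (adjoint _), ContinuousLinearMap.adjoint_inner_right]
  exact (hX.isHS _).summable_inner (hY.isHS _) _

theorem tr_comp_sub (hS : LocTC L S) {A B : H →L[ℂ] H} (hA : Equivariant L L A)
    (hB : Equivariant L L B) {c : 𝓣 × 𝓣} (hc : c ∈ cut) :
    L.tr c (S ∘L (A - B)) = L.tr c (S ∘L A) - L.tr c (S ∘L B) := by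
  rw [tr, tr, tr, opTrace, opTrace, opTrace,
    ← ((hS.comp_right hA).summable hc).tsum_sub ((hS.comp_right hB).summable hc)]
  simp

theorem tr_comp_smul (c : 𝓣 × 𝓣) (A : H →L[ℂ] H) (r : ℂ) :
    L.tr c (S ∘L (r • A)) = r * L.tr c (S ∘L A) := by
  rw [tr, tr, opTrace, opTrace, ← tsum_mul_left]
  simp

theorem tr_comp_sum (hS : LocTC L S) {ι : Type*} {s : Finset ι} {A : ι → H →L[ℂ] H}
    (hA : ∀ i ∈ s, Equivariant L L (A i)) {c : 𝓣 × 𝓣} (hc : c ∈ cut) :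
    L.tr c (S ∘L ∑ i ∈ s, A i) = ∑ i ∈ s, L.tr c (S ∘L A i) := by
  simp only [tr, opTrace]
  rw [← Summable.tsum_finsetSum fun i hi => (hS.comp_right (hA i hi)).summable hc]
  simp [_root_.sum_apply]

/-- After a swap the trace is a Hilbert-Schmidt pairing in which the varying operator stands to the
left of a fixed Hilbert-Schmidt operator, so strong convergence suffices. -/
theorem tendsto_tr_comp (hS : LocTC L S) {B : ℕ → H →L[ℂ] H} {B₀ : H →L[ℂ] H}
    (hBe : ∀ k, Equivariant L L (B k)) (hB₀ : Equivariant L L B₀) {C : ℝ} (hB : ∀ k, ‖B k‖ ≤ C)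
    (hlim : ∀ x, Tendsto (fun k => B k x) atTop (𝓝 (B₀ x))) {c : 𝓣 × 𝓣} (hc : c ∈ cut) :
    Tendsto (fun k => L.tr c (S ∘L B k)) atTop (𝓝 (L.tr c (S ∘L B₀))) := by
  obtain ⟨X, Y, hX, hY, rfl⟩ := hS
  have key : ∀ A : H →L[ℂ] H, Equivariant L L A → L.tr c ((adjoint X ∘L Y) ∘L A) =
      hsInner (adjoint Y ∘L L.M c.2) (A ∘L (adjoint X ∘L L.M c.1)) := fun A hA => by
    rw [ContinuousLinearMap.comp_assoc, L.tr_adjoint_comp hc X (Y ∘L A),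
      hX.hsInner_swap (hY.comp_right hA) hc hc, ContinuousLinearMap.adjoint_comp,
      ContinuousLinearMap.comp_assoc, hsInner_comp_left, ContinuousLinearMap.adjoint_adjoint]
  simp_rw [fun k => key (B k) (hBe k), key B₀ hB₀]
  exact tendsto_hsInner_comp (hY.adjoint.isHS _) (hX.adjoint.isHS _) hB hlim

end LocTC

theorem Equivariant.abs {S : H →L[ℂ] H} (hS : Equivariant L L S) :
    Equivariant L L (CFC.abs S) := fun g =>
  (show Commute S (L.U g) from hS g).cfcAbs_left (by
    rw [ContinuousLinearMap.star_eq_adjoint, L.adjoint_U]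
    exact hS g⁻¹)

theorem Equivariant.sqrt {S : H →L[ℂ] H} (hS : Equivariant L L S) :
    Equivariant L L (CFC.sqrt S) := fun g => by
  have h1 : Commute S (L.U g) := hS g
  exact h1.cfcₙ_nnreal NNReal.sqrt

/-- The factorization is `S = (W |S|^(1/2)) |S|^(1/2)`. The root is locally Hilbert-Schmidt because
`(|S|^(1/2) M)* (|S|^(1/2) M) = M* |S| M` is of trace class. -/
theorem locTC_of_isTraceClass {S : H →L[ℂ] H} (hS : Equivariant L L S)
    (h : ∀ φ ψ, IsTraceClass (L.M φ ∘L CFC.abs S ∘L L.M ψ)) : LocTC L S := by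
  have h0 := CFC.abs_nonneg S
  have hA := hS.abs
  obtain ⟨W, hW, -, hWU⟩ := exists_polar S
  have hWe : Equivariant L L W := fun g => (hWU (L.U g) (hS g).symm (hA g).symm).symm
  set Y := CFC.sqrt (CFC.abs S) with hY
  have hYY : Y ∘L Y = CFC.abs S := CFC.sqrt_mul_sqrt_self _ h0
  have hYadj : adjoint Y = Y := adjoint_eq_of_nonneg (CFC.sqrt_nonneg _)
  have hYL : LocHS L L Y := by
    refine ⟨hA.sqrt, fun φ => isHS_of_isTraceClass ?_⟩
    obtain ⟨ψ, hψ⟩ := L.adjoint_M φ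
    have := h ψ φ
    rw [← hYY] at this
    rwa [ContinuousLinearMap.adjoint_comp, hψ, hYadj]
  refine ⟨adjoint (W ∘L Y), Y, (hYL.comp_left hWe).adjoint, hYL, ?_⟩
  rw [ContinuousLinearMap.adjoint_adjoint, ContinuousLinearMap.comp_assoc, hYY]
  exact hW

theorem isTraceClass_of_locHS {X Y : H →L[ℂ] H} (hX : LocHS L L X) (hY : LocHS L L Y) (φ ψ : 𝓣) :
    IsTraceClass (L.M φ ∘L (adjoint X ∘L Y) ∘L L.M ψ) := by
  obtain ⟨φ', hφ⟩ := L.adjoint_M φ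
  have : L.M φ = adjoint (L.M φ') := by rw [← hφ, ContinuousLinearMap.adjoint_adjoint]
  have h := isTraceClass_adjoint_comp (hX.isHS φ') (hY.isHS ψ)
  rwa [ContinuousLinearMap.adjoint_comp, ← this] at h

section Projection

variable {p : H →L[ℂ] H}

theorem locHS_of_projection (hp : Equivariant L L p) (hadj : adjoint p = p) (hidem : p ∘L p = p)
    (h : LocTC L p) : LocHS L L p := by
  obtain ⟨X, Y, hX, hY, hXY⟩ := h
  refine ⟨hp, fun φ => isHS_of_isTraceClass ?_⟩
  obtain ⟨ψ, hψ⟩ := L.adjoint_M φ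
  rw [ContinuousLinearMap.adjoint_comp, hadj, hψ, ContinuousLinearMap.comp_assoc,
    ← ContinuousLinearMap.comp_assoc p, hidem, hXY]
  exact isTraceClass_of_locHS hX hY ψ φ

/-- The two cutoffs may differ, so `c₁ p c₂` need not be self-adjoint; reality comes from the swap
identity. It is needed because `gDim` keeps only the real part. -/
theorem conj_tr_of_projection (hp : LocHS L L p) (hadj : adjoint p = p) (hidem : p ∘L p = p)
    {c : 𝓣 × 𝓣} (hc : c ∈ cut) : (starRingEnd ℂ) (L.tr c p) = L.tr c p := by
  have h : L.tr c p = hsInner (p ∘L L.M c.1) (p ∘L L.M c.2) := by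
    rw [← L.tr_adjoint_comp hc, hadj, hidem]
  have h2 := hp.hsInner_swap hp hc hc
  rw [hadj] at h2
  rw [h, hsInner_conj, h2]

end Projection

end LocalRep

end LocalTrace

/-! ### The orthogonal projection onto the graph of a closed operator. -/

section Graph

variable {H₀ : Type*} [NormedAddCommGroup H₀] [InnerProductSpace ℂ H₀] [CompleteSpace H₀]
  {H₁ : Type*} [NormedAddCommGroup H₁] [InnerProductSpace ℂ H₁] [CompleteSpace H₁]

/-- The block matrix `(R, K*; K, D)` is the orthogonal projection of `H₀ ⊕ H₁` onto `Γ`. -/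
structure IsGraphProjection (Γ : Submodule ℂ (H₀ × H₁)) (R : H₀ →L[ℂ] H₀) (K : H₀ →L[ℂ] H₁)
    (D : H₁ →L[ℂ] H₁) : Prop where
  adjoint_R : adjoint R = R
  adjoint_D : adjoint D = D
  mem_left : ∀ u, (R u, K u) ∈ Γ
  mem_right : ∀ v, (adjoint K v, D v) ∈ Γ
  left_of_mem : ∀ p ∈ Γ, R p.1 + adjoint K p.2 = p.1
  right_of_mem : ∀ p ∈ Γ, K p.1 + D p.2 = p.2

theorem exists_isGraphProjection {Γ : Submodule ℂ (H₀ × H₁)} (hΓ : IsClosed (Γ : Set (H₀ × H₁))) :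
    ∃ R K D, IsGraphProjection Γ R K D := by
  -- The product type carries the supremum norm; orthogonality requires the Hilbert sum.
  let e := WithLp.prodContinuousLinearEquiv 2 ℂ H₀ H₁
  let Γ' : Submodule ℂ (WithLp 2 (H₀ × H₁)) := Γ.comap (e : WithLp 2 (H₀ × H₁) →ₗ[ℂ] H₀ × H₁)
  have hΓ' : IsClosed (Γ' : Set (WithLp 2 (H₀ × H₁))) := hΓ.preimage e.continuous
  have : CompleteSpace Γ' := hΓ'.completeSpace_coe
  let Pr : H₀ × H₁ →L[ℂ] H₀ × H₁ :=
    (e : WithLp 2 (H₀ × H₁) →L[ℂ] H₀ × H₁) ∘L Γ'.starProjection ∘L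
      (e.symm : H₀ × H₁ →L[ℂ] WithLp 2 (H₀ × H₁))
  have hmem : ∀ x, Pr x ∈ Γ := fun x => Γ'.starProjection_apply_mem (e.symm x)
  have hfix : ∀ x ∈ Γ, Pr x = x := fun x hx => by
    have h1 : e.symm x ∈ Γ' := by simpa [Γ'] using hx
    simp [Pr, Submodule.starProjection_eq_self_iff.2 h1]
  have hsymm : ∀ x y, ⟪(Pr x).1, y.1⟫_ℂ + ⟪(Pr x).2, y.2⟫_ℂ =
      ⟪x.1, (Pr y).1⟫_ℂ + ⟪x.2, (Pr y).2⟫_ℂ := fun x y =>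
    Γ'.inner_starProjection_left_eq_right (e.symm x) (e.symm y)
  let R := ContinuousLinearMap.fst ℂ H₀ H₁ ∘L Pr ∘L ContinuousLinearMap.inl ℂ H₀ H₁
  let K := ContinuousLinearMap.snd ℂ H₀ H₁ ∘L Pr ∘L ContinuousLinearMap.inl ℂ H₀ H₁
  let K' := ContinuousLinearMap.fst ℂ H₀ H₁ ∘L Pr ∘L ContinuousLinearMap.inr ℂ H₀ H₁
  let D := ContinuousLinearMap.snd ℂ H₀ H₁ ∘L Pr ∘L ContinuousLinearMap.inr ℂ H₀ H₁
  have hK' : adjoint K = K' := by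
    refine ((ContinuousLinearMap.eq_adjoint_iff _ _).2 fun x y => ?_).symm
    simpa [K, K'] using hsymm (0, x) (y, 0)
  have hadd : ∀ x : H₀ × H₁, Pr x = Pr (x.1, 0) + Pr (0, x.2) := fun x => by
    rw [← map_add]
    simp
  refine ⟨R, K, D, ?_, ?_, fun u => hmem (u, 0), fun v => ?_, fun p hp => ?_, fun p hp => ?_⟩
  · refine ((ContinuousLinearMap.eq_adjoint_iff _ _).2 fun x y => ?_).symm
    simpa [R] using hsymm (x, 0) (y, 0)
  · refine ((ContinuousLinearMap.eq_adjoint_iff _ _).2 fun x y => ?_).symm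
    simpa [D] using hsymm (0, x) (0, y)
  · rw [hK']
    exact hmem (0, v)
  · rw [hK']
    have := congr(($(hfix p hp)).1)
    rwa [hadd] at this
  · have := congr(($(hfix p hp)).2)
    rwa [hadd] at this

/-- Applied with `C = 1 - 2R` or `C = 1 - 2D`. Self-adjointness gives `‖C u‖² = ‖u‖² - 4 ‖K u‖² ≤
‖u‖²`, and the operator in question is `C²`. -/
theorem norm_one_sub_le_of_sq {C : H₀ →L[ℂ] H₀} {K : H₀ →L[ℂ] H₁} (hC : adjoint C = C)
    (hsq : ∀ u, C (C u) = u - (4 : ℂ) • adjoint K (K u)) :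
    ‖(1 : H₀ →L[ℂ] H₀) - (4 : ℂ) • (adjoint K ∘L K)‖ ≤ 1 := by
  have hC1 : ‖C‖ ≤ 1 := by
    refine ContinuousLinearMap.opNorm_le_bound _ zero_le_one fun u => ?_
    rw [one_mul]
    refine le_of_sq_le_sq ?_ (norm_nonneg _)
    rw [← inner_self_eq_norm_sq (𝕜 := ℂ) (C u), ← ContinuousLinearMap.adjoint_inner_right, hC, hsq,
      inner_sub_right, inner_smul_right, ContinuousLinearMap.adjoint_inner_right, map_sub,
      inner_self_eq_norm_sq, inner_self_eq_norm_sq_to_K]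
    have : RCLike.re ((4 : ℂ) * ((‖K u‖ : ℂ)) ^ 2) = 4 * ‖K u‖ ^ 2 := by
      norm_cast
    refine (sub_le_sub_left this.ge _).trans ?_
    nlinarith [sq_nonneg ‖K u‖]
  have h2 : (1 : H₀ →L[ℂ] H₀) - (4 : ℂ) • (adjoint K ∘L K) = C * C := by
    ext u
    simp [hsq]
  rw [h2]
  exact (norm_mul_le _ _).trans (mul_le_one₀ hC1 (norm_nonneg _) hC1)

namespace IsGraphProjection

variable {Γ : Submodule ℂ (H₀ × H₁)} {R : H₀ →L[ℂ] H₀} {K : H₀ →L[ℂ] H₁} {D : H₁ →L[ℂ] H₁}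

theorem R_R_add (h : IsGraphProjection Γ R K D) (u : H₀) :
    R (R u) + adjoint K (K u) = R u :=
  h.left_of_mem _ (h.mem_left u)

theorem K_adjoint_add (h : IsGraphProjection Γ R K D) (v : H₁) : K (adjoint K v) + D (D v) = D v :=
  h.right_of_mem _ (h.mem_right v)

theorem inner_left (h : IsGraphProjection Γ R K D) {p : H₀ × H₁} (hp : p ∈ Γ) (u : H₀) :
    ⟪p.1, R u⟫_ℂ + ⟪p.2, K u⟫_ℂ = ⟪p.1, u⟫_ℂ := by
  rw [← ContinuousLinearMap.adjoint_inner_left R, ← ContinuousLinearMap.adjoint_inner_left K,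
    h.adjoint_R, ← inner_add_left, h.left_of_mem p hp]

theorem inner_right (h : IsGraphProjection Γ R K D) {p : H₀ × H₁} (hp : p ∈ Γ) (v : H₁) :
    ⟪p.1, adjoint K v⟫_ℂ + ⟪p.2, D v⟫_ℂ = ⟪p.2, v⟫_ℂ := by
  rw [← ContinuousLinearMap.adjoint_inner_left D, ContinuousLinearMap.adjoint_inner_right K,
    h.adjoint_D, ← inner_add_left, h.right_of_mem p hp]

/-- `hdom` says that the domain is dense. If `K x = 0`, then `x - R x` is orthogonal to the domain,
hence `R x = x`. -/
theorem K_eq_zero_iff (h : IsGraphProjection Γ R K D)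
    (hdom : ∀ x : H₀, (∀ p ∈ Γ, ⟪p.1, x⟫_ℂ = 0) → x = 0) (x : H₀) :
    K x = 0 ↔ (x, (0 : H₁)) ∈ Γ := by
  constructor
  · intro hx
    have hRx : R x = x := by
      refine sub_eq_zero.1 (hdom _ fun p hp => ?_)
      have := h.inner_left hp x
      rw [hx, inner_zero_right, add_zero] at this
      rw [inner_sub_right, this, sub_self]
    have := h.mem_left x
    rwa [hRx, hx] at this
  · intro hx
    have h1 := h.left_of_mem _ hx
    have h2 := h.right_of_mem _ hx
    simpa using h2

/-- `hval` says that `Γ` is the graph of a single-valued operator. It forces `D v = 0` when `K* v =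
0`, and then `(0, v)` is orthogonal to `Γ`. -/
theorem adjoint_K_eq_zero_iff (h : IsGraphProjection Γ R K D)
    (hval : ∀ y : H₁, ((0 : H₀), y) ∈ Γ → y = 0) (v : H₁) :
    adjoint K v = 0 ↔ ∀ p ∈ Γ, ⟪p.2, v⟫_ℂ = 0 := by
  constructor
  · intro hv p hp
    have h1 := h.mem_right v
    rw [hv] at h1
    rw [← h.inner_right hp v, hv, hval _ h1]
    simp
  · intro hv
    refine ext_inner_left ℂ fun u => ?_
    rw [ContinuousLinearMap.adjoint_inner_right, inner_zero_right]
    exact hv _ (h.mem_left u)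

theorem norm_one_sub_le_left (h : IsGraphProjection Γ R K D) :
    ‖(1 : H₀ →L[ℂ] H₀) - (4 : ℂ) • (adjoint K ∘L K)‖ ≤ 1 := by
  refine norm_one_sub_le_of_sq (C := 1 - (2 : ℂ) • R) ?_ fun u => ?_
  · rw [map_sub, map_smulₛₗ, h.adjoint_R, ← ContinuousLinearMap.star_eq_adjoint, map_ofNat,
      star_one]
  · have h1 : adjoint K (K u) = R u - R (R u) := eq_sub_of_add_eq' (h.R_R_add u)
    simp only [_root_.sub_apply, one_apply_eq_self, _root_.smul_apply, map_sub, map_smul, h1]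
    module

theorem norm_one_sub_le_right (h : IsGraphProjection Γ R K D) :
    ‖(1 : H₁ →L[ℂ] H₁) - (4 : ℂ) • (K ∘L adjoint K)‖ ≤ 1 := by
  have := norm_one_sub_le_of_sq (C := 1 - (2 : ℂ) • D) (K := adjoint K) ?_ fun v => ?_
  · simpa using this
  · rw [map_sub, map_smulₛₗ, h.adjoint_D, ← ContinuousLinearMap.star_eq_adjoint, map_ofNat,
      star_one]
  · have h1 : K (adjoint K v) = D v - D (D v) := eq_sub_of_add_eq (h.K_adjoint_add v)
    simp only [_root_.sub_apply, one_apply_eq_self, _root_.smul_apply, map_sub, map_smul,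
      ContinuousLinearMap.adjoint_adjoint, h1]
    module

end IsGraphProjection

end Graph

/-! ### The index formula for equivariant closed operators. -/

section AbstractIndex

variable {G : Type*} [Group G] [TopologicalSpace G] [IsTopologicalGroup G] [MeasurableSpace G]
  [BorelSpace G] {μ : Measure G} [μ.IsInvInvariant]
  {𝓣 : Type*} {τ : G → 𝓣 → 𝓣} {cut : Set (𝓣 × 𝓣)}
  {H : Type*} [NormedAddCommGroup H] [InnerProductSpace ℂ H] [CompleteSpace H]
  {H₀ : Type*} [NormedAddCommGroup H₀] [InnerProductSpace ℂ H₀] [CompleteSpace H₀]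
  {H₁ : Type*} [NormedAddCommGroup H₁] [InnerProductSpace ℂ H₁] [CompleteSpace H₁]
  {L : LocalRep μ τ cut H} {L₀ : LocalRep μ τ cut H₀} {L₁ : LocalRep μ τ cut H₁}
  {Γ : Submodule ℂ (H₀ × H₁)} {R : H₀ →L[ℂ] H₀} {K : H₀ →L[ℂ] H₁} {D : H₁ →L[ℂ] H₁}

namespace LocalRep

theorem equivariant_starProjection {N : Submodule ℂ H} [N.HasOrthogonalProjection]
    (hN : ∀ g, ∀ x ∈ N, L.U g x ∈ N) : Equivariant L L N.starProjection := fun g => by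
  ext x
  refine Submodule.eq_starProjection_of_mem_orthogonal (hN g _ (N.starProjection_apply_mem x)) ?_
  change L.U g x - L.U g (N.starProjection x) ∈ Nᗮ
  rw [← map_sub, Submodule.mem_orthogonal]
  intro n hn
  rw [← ContinuousLinearMap.adjoint_inner_left, L.adjoint_U]
  exact (Submodule.mem_orthogonal _ _).1 (N.sub_starProjection_mem_orthogonal x) _ (hN _ _ hn)

/-- `U g ⊕ U g` is unitary and preserves `Γ`, so it commutes with the projection onto `Γ`: the
difference `p` of the two images of `(u, 0)` lies in `Γ` and is orthogonal to itself. -/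
theorem equivariant_of_isGraphProjection (h : IsGraphProjection Γ R K D)
    (hΓ : ∀ g, ∀ p ∈ Γ, (L₀.U g p.1, L₁.U g p.2) ∈ Γ) :
    Equivariant L₀ L₀ R ∧ Equivariant L₀ L₁ K := by
  have key : ∀ g u, R (L₀.U g u) - L₀.U g (R u) = 0 ∧ K (L₀.U g u) - L₁.U g (K u) = 0 := by
    intro g u
    set p : H₀ × H₁ := (R (L₀.U g u), K (L₀.U g u)) - (L₀.U g (R u), L₁.U g (K u)) with hp
    have hpΓ : p ∈ Γ := Γ.sub_mem (h.mem_left _) (hΓ g _ (h.mem_left u))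
    have h1 := h.inner_left hpΓ (L₀.U g u)
    have h2 := h.inner_left (hΓ g⁻¹ p hpΓ) u
    simp only [← L₀.adjoint_U, ← L₁.adjoint_U, ContinuousLinearMap.adjoint_inner_left] at h2
    have h3 : ⟪p.1, p.1⟫_ℂ + ⟪p.2, p.2⟫_ℂ = 0 := by
      calc ⟪p.1, p.1⟫_ℂ + ⟪p.2, p.2⟫_ℂ = ⟪p.1, R (L₀.U g u) - L₀.U g (R u)⟫_ℂ +
            ⟪p.2, K (L₀.U g u) - L₁.U g (K u)⟫_ℂ := rfl
        _ = 0 := by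
          rw [inner_sub_right, inner_sub_right]
          linear_combination h1 - h2
    have h4 : ‖p.1‖ ^ 2 + ‖p.2‖ ^ 2 = 0 := by
      rw [inner_self_eq_norm_sq_to_K, inner_self_eq_norm_sq_to_K] at h3
      exact Complex.ofReal_injective (by simpa using h3)
    have h5 : ‖p.1‖ = 0 := by nlinarith [sq_nonneg ‖p.1‖, sq_nonneg ‖p.2‖]
    have h6 : ‖p.2‖ = 0 := by nlinarith [sq_nonneg ‖p.1‖, sq_nonneg ‖p.2‖]
    exact ⟨norm_eq_zero.1 h5, norm_eq_zero.1 h6⟩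
  constructor
  · intro g
    ext u
    exact sub_eq_zero.1 (key g u).1
  · intro g
    ext u
    exact sub_eq_zero.1 (key g u).2

/-- The Cesàro means of the powers of a contraction. -/
def cesaro (A : H →L[ℂ] H) (N : ℕ) : H →L[ℂ] H := (N : ℂ)⁻¹ • ∑ k ∈ Finset.range N, A ^ k

theorem norm_cesaro_le {A : H →L[ℂ] H} (hA : ‖A‖ ≤ 1) (N : ℕ) : ‖cesaro A N‖ ≤ 1 := by
  have hk : ∀ k, ‖A ^ k‖ ≤ 1 := fun k => by
    induction k with
    | zero => exact ContinuousLinearMap.norm_id_le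
    | succ k ih =>
      rw [pow_succ]
      exact (norm_mul_le _ _).trans (mul_le_one₀ ih (norm_nonneg _) hA)
  have h1 : ‖∑ k ∈ Finset.range N, A ^ k‖ ≤ N := by
    refine (norm_sum_le _ _).trans ((Finset.sum_le_sum fun k _ => hk k).trans ?_)
    simp
  rw [cesaro, norm_smul, norm_inv, Complex.norm_natCast]
  exact (mul_le_mul_of_nonneg_left h1 (by positivity)).trans (inv_mul_le_one)

/-- Von Neumann's mean ergodic theorem. The powers themselves are avoided, as averages converge
without spectral information. -/
theorem tendsto_cesaro {A : H →L[ℂ] H} (hA : ‖A‖ ≤ 1) {N : Submodule ℂ H}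
    [N.HasOrthogonalProjection] (hN : ∀ x, A x = x ↔ x ∈ N) (x : H) :
    Tendsto (fun k => cesaro A k x) atTop (𝓝 (N.starProjection x)) := by
  have h := A.tendsto_birkhoffAverage_orthogonalProjection hA x
  have hE : A.eqLocus (1 : H →L[ℂ] H) = N := by
    ext y
    exact hN y
  subst hE
  refine Tendsto.congr (fun k => ?_) h
  simp [cesaro, birkhoffAverage, birkhoffSum, _root_.sum_apply]

theorem Equivariant.cesaro {A : H →L[ℂ] H} (hA : Equivariant L L A) (N : ℕ) :
    Equivariant L L (cesaro A N) :=
  (Equivariant.sum fun k _ => hA.pow k).smul _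

theorem LocTC.tr_comp_cesaro {S A : H →L[ℂ] H} (hS : LocTC L S) (hA : Equivariant L L A)
    {c : 𝓣 × 𝓣} (hc : c ∈ cut) (N : ℕ) :
    L.tr c (S ∘L LocalRep.cesaro A N) =
      (N : ℂ)⁻¹ * ∑ k ∈ Finset.range N, L.tr c (S ∘L (A ^ k)) := by
  rw [LocalRep.cesaro, LocTC.tr_comp_smul, hS.tr_comp_sum (fun k _ => hA.pow k) hc]

variable {S₀ : H₀ →L[ℂ] H₀} {S₁ : H₁ →L[ℂ] H₁}

/-- The only place where the invariance of `Γ` under `S₀ ⊕ S₁` enters. With `K M₀ᵏ = M₁ᵏ K` and two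
uses of cyclicity, `tr (S₁ M₁ᵏ K K*) = tr (M₀ᵏ K* S₁ K) = tr (M₀ᵏ (1 - R) S₀ R) = tr (S₀ R M₀ᵏ (1 -
R))`, and `R` commutes with `M₀` while `R (1 - R) = K* K`. -/
theorem tr_step (h : IsGraphProjection Γ R K D)
    (hΓ : ∀ g, ∀ p ∈ Γ, (L₀.U g p.1, L₁.U g p.2) ∈ Γ) (hS : ∀ p ∈ Γ, (S₀ p.1, S₁ p.2) ∈ Γ)
    (hS₀ : LocTC L₀ S₀) (hS₁ : LocTC L₁ S₁) {c : 𝓣 × 𝓣} (hc : c ∈ cut) (k : ℕ) :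
    L₁.tr c (S₁ ∘L (((1 : H₁ →L[ℂ] H₁) - (4 : ℂ) • (K ∘L adjoint K)) ^ k) ∘L (K ∘L adjoint K)) =
      L₀.tr c (S₀ ∘L (((1 : H₀ →L[ℂ] H₀) - (4 : ℂ) • (adjoint K ∘L K)) ^ k) ∘L
        (adjoint K ∘L K)) := by
  obtain ⟨hR, hK⟩ := equivariant_of_isGraphProjection h hΓ
  set M₀ := (1 : H₀ →L[ℂ] H₀) - (4 : ℂ) • (adjoint K ∘L K) with hM₀
  set M₁ := (1 : H₁ →L[ℂ] H₁) - (4 : ℂ) • (K ∘L adjoint K) with hM₁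
  have hM₀e : Equivariant L₀ L₀ M₀ := Equivariant.one.sub ((hK.adjoint.comp hK).smul _)
  have hKM : ∀ k x, K ((M₀ ^ k) x) = (M₁ ^ k) (K x) := by
    intro k
    induction k with
    | zero => simp
    | succ k ih =>
      intro x
      rw [pow_succ, pow_succ, mul_apply_eq_comp, mul_apply_eq_comp, ih]
      simp [hM₀, hM₁]
  have hRM : ∀ k x, R ((M₀ ^ k) x) = (M₀ ^ k) (R x) := by
    have hKK : ∀ x, adjoint K (K x) = R x - R (R x) := fun x => eq_sub_of_add_eq' (h.R_R_add x)
    intro k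
    induction k with
    | zero => simp
    | succ k ih =>
      intro x
      rw [pow_succ, mul_apply_eq_comp, mul_apply_eq_comp, ih]
      simp [hM₀, hKK]
  -- The pair `(S₀ R u, S₁ K u)` lies in `Γ` and is therefore fixed by the projection; this is its
  -- first component.
  have hKSK : adjoint K ∘L S₁ ∘L K = (1 - R) ∘L S₀ ∘L R := by
    ext u
    have := h.left_of_mem _ (hS _ (h.mem_left u))
    simp only [ContinuousLinearMap.comp_apply, _root_.sub_apply, one_apply_eq_self]
    exact eq_sub_of_add_eq' this
  have e1 : S₁ ∘L (M₁ ^ k) ∘L (K ∘L adjoint K) = S₁ ∘L K ∘L ((M₀ ^ k) ∘L adjoint K) := by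
    ext x
    change S₁ ((M₁ ^ k) (K (adjoint K x))) = S₁ (K ((M₀ ^ k) (adjoint K x)))
    rw [hKM]
  have e2 : ((M₀ ^ k) ∘L adjoint K) ∘L S₁ ∘L K = ((M₀ ^ k) ∘L (1 - R)) ∘L (S₀ ∘L R) := by
    rw [ContinuousLinearMap.comp_assoc, hKSK]
    rfl
  have e3 : (S₀ ∘L R) ∘L ((M₀ ^ k) ∘L (1 - R)) = S₀ ∘L (M₀ ^ k) ∘L (adjoint K ∘L K) := by
    ext x
    have : adjoint K (K x) = R x - R (R x) := eq_sub_of_add_eq' (h.R_R_add x)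
    change S₀ (R ((M₀ ^ k) ((1 - R) x))) = S₀ ((M₀ ^ k) (adjoint K (K x)))
    rw [hRM, this, _root_.sub_apply, one_apply_eq_self, map_sub R]
  obtain ⟨X, Y, hX, hY, hXY⟩ := hS₁
  rw [e1, hXY, ContinuousLinearMap.comp_assoc]
  have := tr_comm hX (hY.comp_right hK) ((hM₀e.pow k).comp hK.adjoint) hc hc
  rw [ContinuousLinearMap.comp_assoc] at this
  rw [this, ← e3, (hS₀.comp_right hR).tr_comp_comm ((hM₀e.pow k).comp (Equivariant.one.sub hR))
    hc hc, ← e2, hXY]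
  rfl

/-- Passing from `k` to `k + 1` subtracts four times the two sides of `tr_step`, which cancel. -/
theorem tr_sub_const (h : IsGraphProjection Γ R K D)
    (hΓ : ∀ g, ∀ p ∈ Γ, (L₀.U g p.1, L₁.U g p.2) ∈ Γ) (hS : ∀ p ∈ Γ, (S₀ p.1, S₁ p.2) ∈ Γ)
    (hS₀ : LocTC L₀ S₀) (hS₁ : LocTC L₁ S₁) {c : 𝓣 × 𝓣} (hc : c ∈ cut) (k : ℕ) :
    L₀.tr c (S₀ ∘L (((1 : H₀ →L[ℂ] H₀) - (4 : ℂ) • (adjoint K ∘L K)) ^ k)) -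
      L₁.tr c (S₁ ∘L (((1 : H₁ →L[ℂ] H₁) - (4 : ℂ) • (K ∘L adjoint K)) ^ k)) =
    L₀.tr c S₀ - L₁.tr c S₁ := by
  obtain ⟨hR, hK⟩ := equivariant_of_isGraphProjection h hΓ
  have hs := tr_step h hΓ hS hS₀ hS₁ hc
  set M₀ := (1 : H₀ →L[ℂ] H₀) - (4 : ℂ) • (adjoint K ∘L K) with hM₀
  set M₁ := (1 : H₁ →L[ℂ] H₁) - (4 : ℂ) • (K ∘L adjoint K) with hM₁
  have hM₀e : Equivariant L₀ L₀ M₀ := Equivariant.one.sub ((hK.adjoint.comp hK).smul _)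
  have hM₁e : Equivariant L₁ L₁ M₁ := Equivariant.one.sub ((hK.comp hK.adjoint).smul _)
  induction k with
  | zero => rfl
  | succ k ih =>
    have e₀ : M₀ ^ (k + 1) = M₀ ^ k - (4 : ℂ) • ((M₀ ^ k) ∘L (adjoint K ∘L K)) := by
      calc M₀ ^ (k + 1) = M₀ ^ k * (1 - (4 : ℂ) • (adjoint K ∘L K)) := pow_succ _ _
        _ = _ := by
          rw [mul_sub, mul_one, mul_smul_comm]
          rfl
    have e₁ : M₁ ^ (k + 1) = M₁ ^ k - (4 : ℂ) • ((M₁ ^ k) ∘L (K ∘L adjoint K)) := by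
      calc M₁ ^ (k + 1) = M₁ ^ k * (1 - (4 : ℂ) • (K ∘L adjoint K)) := pow_succ _ _
        _ = _ := by
          rw [mul_sub, mul_one, mul_smul_comm]
          rfl
    rw [e₀, e₁,
      hS₀.tr_comp_sub (hM₀e.pow k) (((hM₀e.pow k).comp (hK.adjoint.comp hK)).smul _) hc,
      hS₁.tr_comp_sub (hM₁e.pow k) (((hM₁e.pow k).comp (hK.comp hK.adjoint)).smul _) hc,
      LocTC.tr_comp_smul, LocTC.tr_comp_smul, ← ih, hs k]
    ring

/-- The index formula for an equivariant closed operator with graph `Γ` that is intertwined with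
itself by `S₀` and `S₁`. -/
theorem tr_comp_starProjection_sub (hclosed : IsClosed (Γ : Set (H₀ × H₁)))
    (hdom : ∀ x : H₀, (∀ p ∈ Γ, ⟪p.1, x⟫_ℂ = 0) → x = 0)
    (hval : ∀ y : H₁, ((0 : H₀), y) ∈ Γ → y = 0)
    (hΓ : ∀ g, ∀ p ∈ Γ, (L₀.U g p.1, L₁.U g p.2) ∈ Γ) (hS : ∀ p ∈ Γ, (S₀ p.1, S₁ p.2) ∈ Γ)
    {N₀ : Submodule ℂ H₀} [N₀.HasOrthogonalProjection] (hN₀ : ∀ x, x ∈ N₀ ↔ (x, (0 : H₁)) ∈ Γ)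
    {N₁ : Submodule ℂ H₁} [N₁.HasOrthogonalProjection]
    (hN₁ : ∀ y, y ∈ N₁ ↔ ∀ p ∈ Γ, ⟪p.2, y⟫_ℂ = 0)
    (hN₀e : Equivariant L₀ L₀ N₀.starProjection) (hN₁e : Equivariant L₁ L₁ N₁.starProjection)
    (hS₀ : LocTC L₀ S₀) (hS₁ : LocTC L₁ S₁) {c : 𝓣 × 𝓣} (hc : c ∈ cut) :
    L₀.tr c (S₀ ∘L N₀.starProjection) - L₁.tr c (S₁ ∘L N₁.starProjection) =
      L₀.tr c S₀ - L₁.tr c S₁ := by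
  obtain ⟨R, K, D, h⟩ := exists_isGraphProjection hclosed
  obtain ⟨hR, hK⟩ := equivariant_of_isGraphProjection h hΓ
  have hconst := tr_sub_const h hΓ hS hS₀ hS₁ hc
  have hn₀ := h.norm_one_sub_le_left
  have hn₁ := h.norm_one_sub_le_right
  have hfix₀ : ∀ x, ((1 : H₀ →L[ℂ] H₀) - (4 : ℂ) • (adjoint K ∘L K)) x = x ↔ x ∈ N₀ := by
    intro x
    rw [hN₀, ← h.K_eq_zero_iff hdom]
    simp only [_root_.sub_apply, one_apply_eq_self, _root_.smul_apply, sub_eq_self, smul_eq_zero,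
      OfNat.ofNat_ne_zero, false_or, ContinuousLinearMap.comp_apply]
    refine ⟨fun h0 => ?_, fun h0 => by rw [h0, map_zero]⟩
    rw [← inner_self_eq_zero (𝕜 := ℂ), ← ContinuousLinearMap.adjoint_inner_right, h0,
      inner_zero_right]
  have hfix₁ : ∀ y, ((1 : H₁ →L[ℂ] H₁) - (4 : ℂ) • (K ∘L adjoint K)) y = y ↔ y ∈ N₁ := by
    intro y
    rw [hN₁, ← h.adjoint_K_eq_zero_iff hval]
    simp only [_root_.sub_apply, one_apply_eq_self, _root_.smul_apply, sub_eq_self, smul_eq_zero,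
      OfNat.ofNat_ne_zero, false_or, ContinuousLinearMap.comp_apply]
    refine ⟨fun h0 => ?_, fun h0 => by rw [h0, map_zero]⟩
    rw [← inner_self_eq_zero (𝕜 := ℂ), ContinuousLinearMap.adjoint_inner_right, h0,
      inner_zero_left]
  set M₀ := (1 : H₀ →L[ℂ] H₀) - (4 : ℂ) • (adjoint K ∘L K) with hM₀
  set M₁ := (1 : H₁ →L[ℂ] H₁) - (4 : ℂ) • (K ∘L adjoint K) with hM₁
  have hM₀e : Equivariant L₀ L₀ M₀ := Equivariant.one.sub ((hK.adjoint.comp hK).smul _)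
  have hM₁e : Equivariant L₁ L₁ M₁ := Equivariant.one.sub ((hK.comp hK.adjoint).smul _)
  have t₀ := hS₀.tendsto_tr_comp hM₀e.cesaro hN₀e (norm_cesaro_le hn₀)
    (tendsto_cesaro hn₀ hfix₀) hc
  have t₁ := hS₁.tendsto_tr_comp hM₁e.cesaro hN₁e (norm_cesaro_le hn₁)
    (tendsto_cesaro hn₁ hfix₁) hc
  refine tendsto_nhds_unique (t₀.sub t₁) (tendsto_const_nhds.congr' ?_)
  -- The empty average is zero, so the constant value holds only for `N ≠ 0`.
  filter_upwards [eventually_ne_atTop 0] with N hN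
  rw [hS₀.tr_comp_cesaro hM₀e hc, hS₁.tr_comp_cesaro hM₁e hc, ← mul_sub, ← Finset.sum_sub_distrib,
    Finset.sum_congr rfl fun k _ => hconst k, Finset.sum_const, Finset.card_range, nsmul_eq_mul,
    inv_mul_cancel_left₀ (by exact_mod_cast hN)]

end LocalRep

end AbstractIndex

/-! ### Unimodularity and inversion. -/

section Haar

/-- A regular Haar measure that is right invariant is invariant under inversion. -/
theorem isInvInvariant_of_isMulRightInvariant {G : Type*} [Group G] [TopologicalSpace G]
    [IsTopologicalGroup G] [LocallyCompactSpace G] [MeasurableSpace G] [BorelSpace G]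
    (μ : Measure G) [μ.IsHaarMeasure] [μ.Regular] [μ.IsMulRightInvariant] :
    μ.IsInvInvariant := by
  constructor
  -- Right invariance of `μ` makes `μ.inv` left invariant, hence a multiple `c` of `μ`. Inverting
  -- twice gives `c² = 1`, after cancelling the measure of a compact set with nonempty interior.
  let c : ℝ≥0∞ := Measure.haarScalarFactor μ.inv μ
  have hc : μ.inv = c • μ := Measure.isMulLeftInvariant_eq_smul_of_regular μ.inv μ
  have h1 : Measure.map Inv.inv (Measure.map Inv.inv μ) = c ^ 2 • μ := by
    rw [← Measure.inv_def μ, hc, Measure.map_smul, ← Measure.inv_def μ, hc, smul_smul, pow_two]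
  have h2 : μ = c ^ 2 • μ := by
    rw [Measure.map_map continuous_inv.measurable continuous_inv.measurable] at h1
    have h0 : (Inv.inv : G → G) ∘ Inv.inv = id := inv_involutive.comp_self
    rwa [h0, Measure.map_id] at h1
  have K : TopologicalSpace.PositiveCompacts G := Classical.arbitrary _
  have h3 : c ^ 2 * μ K = 1 ^ 2 * μ K := by
    conv_rhs => rw [h2]
    simp
  have h4 : c ^ 2 = 1 ^ 2 :=
    (ENNReal.mul_left_inj (Measure.measure_pos_of_nonempty_interior _ K.interior_nonempty).ne'
      K.isCompact.measure_lt_top.ne).1 h3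
  have h5 : c = 1 := (ENNReal.pow_right_strictMono two_ne_zero).injective h4
  rw [hc, h5, one_smul]

end Haar

/-! ### Isometries preserve the Riemannian volume. -/

section InvariantVolume

variable {n : ℕ} {X : Type*} [TopologicalSpace X] [ChartedSpace (EuclideanSpace ℝ (Fin n)) X]
  [IsManifold (𝓡 n) ∞ X]
  [RiemannianBundle (fun x : X => TangentSpace (𝓡 n) x)]
  {G : Type*} [Group G] [MulAction G X]

/-- The chart `e ∘ g⁻¹`. -/
def translateChart [ContinuousConstSMul G X] (g : G)
    (e : OpenPartialHomeomorph X (EuclideanSpace ℝ (Fin n))) :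
    OpenPartialHomeomorph X (EuclideanSpace ℝ (Fin n)) :=
  (Homeomorph.smul g⁻¹).toOpenPartialHomeomorph.trans e

theorem translateChart_mem [ContinuousConstSMul G X] (hG : IsIsometricAction n G X) (g : G)
    {e : OpenPartialHomeomorph X (EuclideanSpace ℝ (Fin n))}
    (he : e ∈ IsManifold.maximalAtlas (𝓡 n) ∞ X) :
    translateChart g e ∈ IsManifold.maximalAtlas (𝓡 n) ∞ X := by
  rw [IsManifold.mem_maximalAtlas_iff_contMDiffOn]
  constructor
  · refine (contMDiffOn_of_mem_maximalAtlas he).comp (hG.smooth g⁻¹).contMDiffOn ?_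
    intro x hx
    simpa [translateChart] using hx
  · have h := (hG.smooth g).comp_contMDiffOn (contMDiffOn_symm_of_mem_maximalAtlas he)
    refine (h.mono fun y hy => ?_).congr fun y hy => ?_
    · simpa [translateChart] using hy
    · simp [translateChart, Homeomorph.smul]

theorem gramMatrix_translateChart [ContinuousConstSMul G X] (hG : IsIsometricAction n G X) (g : G)
    (e : OpenPartialHomeomorph X (EuclideanSpace ℝ (Fin n))) (y : EuclideanSpace ℝ (Fin n)) :
    gramMatrix n (translateChart g e) y = gramMatrix n e y := by
  have hsymm : ⇑(translateChart g e).symm = (fun x : X => g • x) ∘ e.symm := by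
    ext z
    simp [translateChart, Homeomorph.smul]
  have hg : ∀ g : G, MDifferentiable (𝓡 n) (𝓡 n) (fun x : X => g • x) := fun g =>
    (hG.smooth g).mdifferentiable (by simp)
  unfold gramMatrix
  rw [hsymm]
  ext i j
  simp only [Matrix.of_apply]
  -- The point `y` is arbitrary and may lie outside the target of the chart. Where `e.symm` is not
  -- differentiable, neither is its translate, and both derivatives take the default value zero.
  by_cases hd : MDifferentiableAt (𝓡 n) (𝓡 n) e.symm y
  · rw [mfderiv_comp y (hg g _) hd]
    exact hG.inner_map g (e.symm y) _ _
  · have hd' : ¬ MDifferentiableAt (𝓡 n) (𝓡 n) ((fun x : X => g • x) ∘ e.symm) y := by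
      intro h
      refine hd ?_
      have := (hg g⁻¹ _).comp y h
      refine this.congr_of_eventuallyEq (.of_forall fun z => ?_)
      simp
    rw [mfderiv_zero_of_not_mdifferentiableAt hd, mfderiv_zero_of_not_mdifferentiableAt hd']
    exact (inner_zero_left _).trans (inner_zero_left _).symm

theorem measurePreserving_smul_of_isRiemannianVolume [SecondCountableTopology X]
    [ContinuousConstSMul G X] [MeasurableSpace X] [BorelSpace X] {ν : Measure X}
    (hν : IsRiemannianVolume n ν) (hG : IsIsometricAction n G X) (g : G) :
    MeasurePreserving (fun x : X => g • x) ν ν := by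
  have hm : Measurable (fun x : X => g • x) := (continuous_const_smul g).measurable
  refine ⟨hm, ?_⟩
  obtain ⟨s, hs, hcover⟩ := TopologicalSpace.countable_cover_nhds
    fun x : X => chart_source_mem_nhds (EuclideanSpace ℝ (Fin n)) x
  -- On one chart domain, a set and its preimage have the same image under `e` and `e ∘ g`
  -- respectively, and the two charts have the same density.
  refine Measure.ext_of_biUnion_eq_univ hs hcover fun x _ => ?_
  ext A hA
  set e := chartAt (EuclideanSpace ℝ (Fin n)) x with he
  have hem : e ∈ IsManifold.maximalAtlas (𝓡 n) ∞ X := IsManifold.chart_mem_maximalAtlas x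
  have hB : MeasurableSet (A ∩ e.source) := hA.inter e.open_source.measurableSet
  rw [Measure.restrict_apply hA, Measure.restrict_apply hA, Measure.map_apply hm hB,
    hν e hem _ hB inter_subset_right,
    hν (translateChart g⁻¹ e) (translateChart_mem hG g⁻¹ hem) _ (hm hB) fun y hy => by
      simpa [translateChart, Homeomorph.smul] using hy.2]
  simp only [gramMatrix_translateChart hG]
  congr 2
  have : ⇑(translateChart g⁻¹ e) = e ∘ fun x => g • x := by
    ext z
    simp [translateChart, Homeomorph.smul]
  rw [this, image_comp, image_preimage_eq _ (MulAction.surjective g)]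

end InvariantVolume

/-! ### Translates of test functions and of sections. -/

section TestFunctions

variable {n : ℕ} {X : Type*} [TopologicalSpace X] [ChartedSpace (EuclideanSpace ℝ (Fin n)) X]
  [RiemannianBundle (fun x : X => TangentSpace (𝓡 n) x)]
  {G : Type*} [Group G] [MulAction G X]

/-- The translate `x ↦ φ (g⁻¹ x)` of a test function. -/
def TestFun.translate [ContinuousConstSMul G X] (hG : IsIsometricAction n G X) (g : G)
    (φ : TestFun n X) : TestFun n X where
  toFun x := φ (g⁻¹ • x)
  smooth := φ.smooth.comp (hG.smooth g⁻¹)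
  compact := φ.compact.comp_homeomorph (Homeomorph.smul g⁻¹)

/-- The complex conjugate of a test function. -/
def TestFun.conj (φ : TestFun n X) : TestFun n X where
  toFun x := (starRingEnd ℂ) (φ x)
  smooth := (Complex.conjCLE.contDiff (n := ∞)).contMDiff.comp φ.smooth
  compact := φ.compact.comp_left (map_zero _)

end TestFunctions

section TranslateSection

variable {n : ℕ} {X : Type*} [TopologicalSpace X] [ChartedSpace (EuclideanSpace ℝ (Fin n)) X]
  [RiemannianBundle (fun x : X => TangentSpace (𝓡 n) x)]
  {G : Type*} [Group G] [TopologicalSpace G] [MulAction G X]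
  {F : Type*} [NormedAddCommGroup F] [NormedSpace ℂ F]
  {V : X → Type*} [TopologicalSpace (TotalSpace F V)]
  [∀ x, NormedAddCommGroup (V x)] [∀ x, InnerProductSpace ℂ (V x)] [FiberBundle F V]

/-- The section `g · s`. -/
def BundleAction.translate (ρ : BundleAction n G F V) (g : G) (s : ∀ x, V x) (x : X) : V x :=
  cast (congrArg V (smul_inv_smul g x)) (ρ.act g (g⁻¹ • x) (s (g⁻¹ • x)))

/-- The fibres over `g • g⁻¹ • x` and `x` are different types. Comparing points of the total space
removes the cast. -/
theorem totalSpace_mk_cast {x y : X} (h : x = y) (v : V x) :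
    (⟨y, cast (congrArg V h) v⟩ : TotalSpace F V) = ⟨x, v⟩ := by
  subst h
  rfl

theorem BundleAction.mk_translate (ρ : BundleAction n G F V) (g : G) (s : ∀ x, V x) (x : X) :
    (⟨x, ρ.translate g s x⟩ : TotalSpace F V) =
      ⟨g • g⁻¹ • x, ρ.act g (g⁻¹ • x) (s (g⁻¹ • x))⟩ :=
  totalSpace_mk_cast (smul_inv_smul g x) _

theorem BundleAction.isTranslate_translate (ρ : BundleAction n G F V) (g : G) (s : ∀ x, V x) :
    ρ.IsTranslate g s (ρ.translate g s) := fun x => by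
  have h := ρ.mk_translate g s (g • x)
  have h2 : ∀ y, y = x →
      (⟨g • y, ρ.act g y (s y)⟩ : TotalSpace F V) = ⟨g • x, ρ.act g x (s x)⟩ := by
    rintro y rfl
    rfl
  rw [h2 _ (inv_smul_smul g x)] at h
  exact (TotalSpace.mk_inj).1 h

/-- Identities between translated sections can thus be checked at the points `g • x`, where no cast
occurs. -/
theorem BundleAction.IsTranslate.unique {ρ : BundleAction n G F V} {g : G} {s s₁ s₂ : ∀ x, V x}
    (h₁ : ρ.IsTranslate g s s₁) (h₂ : ρ.IsTranslate g s s₂) : s₁ = s₂ := by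
  ext x
  obtain ⟨y, rfl⟩ := MulAction.surjective g x
  exact (h₁ y).trans (h₂ y).symm

variable [VectorBundle ℂ F V] [VectorBundle ℝ F V]

theorem BundleAction.translate_mem (ρ : BundleAction n G F V) [ContinuousConstSMul G X]
    (hG : IsIsometricAction n G X) (g : G) (s : testSections n F V) :
    ρ.translate g s.1 ∈ testSections n F V := by
  obtain ⟨K, hK, hs⟩ := s.2.2
  refine ⟨?_, (fun x => g • x) '' K, hK.image (continuous_const_smul g), fun x hx => ?_⟩
  · have h := (ρ.smooth_act g).comp (s.2.1.comp (hG.smooth g⁻¹))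
    refine h.congr fun x => ?_
    exact ρ.mk_translate g s.1 x
  · obtain ⟨y, rfl⟩ := MulAction.surjective g x
    rw [ρ.isTranslate_translate g s.1 y, hs y fun hy => hx ⟨y, hy, rfl⟩, map_zero]

/-- The operator `s ↦ g · s` on test sections. -/
def BundleAction.translateTest (ρ : BundleAction n G F V) [ContinuousConstSMul G X]
    (hG : IsIsometricAction n G X) (g : G) : testSections n F V →ₗ[ℂ] testSections n F V where
  toFun s := ⟨ρ.translate g s.1, ρ.translate_mem hG g s⟩
  map_add' s t := by
    refine Subtype.ext ((ρ.isTranslate_translate g _).unique fun x => ?_)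
    have h1 := ρ.isTranslate_translate g s.1 x
    have h2 := ρ.isTranslate_translate g t.1 x
    change ρ.translate g s.1 (g • x) + ρ.translate g t.1 (g • x) = ρ.act g x (s.1 x + t.1 x)
    rw [h1, h2, map_add]
  map_smul' c s := by
    refine Subtype.ext ((ρ.isTranslate_translate g _).unique fun x => ?_)
    have h1 := ρ.isTranslate_translate g s.1 x
    change c • ρ.translate g s.1 (g • x) = ρ.act g x (c • s.1 x)
    rw [h1, map_smul]

theorem BundleAction.translateTest_smul (ρ : BundleAction n G F V) [ContinuousConstSMul G X]
    (hG : IsIsometricAction n G X) (g : G) (s : testSections n F V) (x : X) :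
    (ρ.translateTest hG g s).1 (g • x) = ρ.act g x (s.1 x) :=
  ρ.isTranslate_translate g s.1 x

theorem BundleAction.translateTest_inv (ρ : BundleAction n G F V) [ContinuousConstSMul G X]
    (hG : IsIsometricAction n G X) (g : G) (s : testSections n F V) :
    ρ.translateTest hG g (ρ.translateTest hG g⁻¹ s) = s := by
  refine Subtype.ext ((ρ.isTranslate_translate g _).unique fun x => ?_)
  have h : ∀ x, (⟨x, s.1 x⟩ : TotalSpace F V) =
      ⟨g • g⁻¹ • x, ρ.act g (g⁻¹ • x) ((ρ.translateTest hG g⁻¹ s).1 (g⁻¹ • x))⟩ := by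
    intro x
    rw [translateTest_smul, ← ρ.act_mul]
    have h2 : ∀ k : G, k = 1 →
        (⟨x, s.1 x⟩ : TotalSpace F V) = ⟨k • x, ρ.act k x (s.1 x)⟩ := by
      rintro k rfl
      exact (ρ.act_one x (s.1 x)).symm
    exact h2 _ (mul_inv_cancel g)
  have h3 := h (g • x)
  have h2 : ∀ y, y = x → (⟨g • y, ρ.act g y ((ρ.translateTest hG g⁻¹ s).1 y)⟩ : TotalSpace F V) =
      ⟨g • x, ρ.act g x ((ρ.translateTest hG g⁻¹ s).1 x)⟩ := by
    rintro y rfl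
    rfl
  rw [h2 _ (inv_smul_smul g x)] at h3
  exact (TotalSpace.mk_inj).1 h3

end TranslateSection

/-! ### Density of test sections and adjoints of multiplication operators. -/

section L2Lemmas

variable {n : ℕ} {X : Type*} [TopologicalSpace X] [ChartedSpace (EuclideanSpace ℝ (Fin n)) X]
  {F : Type*} [NormedAddCommGroup F] [NormedSpace ℂ F]
  {V : X → Type*} [TopologicalSpace (TotalSpace F V)]
  [∀ x, NormedAddCommGroup (V x)] [∀ x, InnerProductSpace ℂ (V x)] [FiberBundle F V]
  [VectorBundle ℂ F V] [VectorBundle ℝ F V] [IsSmoothHermitian n F V]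
  [MeasurableSpace X] [BorelSpace X] [T2Space X]
  (ν : Measure X) [IsFiniteMeasureOnCompacts ν]

theorem denseRange_toL2 : DenseRange (toL2 ν : testSections n F V →ₗ[ℂ] L2 n F V ν) :=
  UniformSpace.Completion.denseRange_coe (α := PreL2 n F V ν)

theorem inner_toL2 (s t : testSections n F V) :
    ⟪toL2 ν s, toL2 ν t⟫_ℂ = ∫ x, ⟪s.1 x, t.1 x⟫_ℂ ∂ν :=
  UniformSpace.Completion.inner_coe (E := PreL2 n F V ν) s t

theorem norm_toL2_sq (s : testSections n F V) : ‖toL2 ν s‖ ^ 2 = ∫ x, ‖s.1 x‖ ^ 2 ∂ν := by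
  rw [← inner_self_eq_norm_sq (𝕜 := ℂ), inner_toL2, ← integral_re (integrable_inner_section ν s s)]
  simp only [inner_self_eq_norm_sq]

theorem mulOp_toL2 (φ : TestFun n X) (s : testSections n F V) :
    mulOp n F V ν φ (toL2 ν s) = toL2 ν (φ.mulTest s) :=
  UniformSpace.Completion.map_coe (ContinuousLinearMap.uniformContinuous _) _

theorem ext_toL2 {E : Type*} [TopologicalSpace E] [T2Space E] {A B : L2 n F V ν → E}
    (hA : Continuous A) (hB : Continuous B) (h : ∀ s, A (toL2 ν s) = B (toL2 ν s))
    (w : L2 n F V ν) :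
    A w = B w :=
  congr_fun ((denseRange_toL2 ν).equalizer hA hB (funext h)) w

theorem adjoint_mulOp (φ : TestFun n X) :
    adjoint (mulOp n F V ν φ) = mulOp n F V ν φ.conj := by
  refine ((ContinuousLinearMap.eq_adjoint_iff _ _).2 fun v w => ?_).symm
  refine ext_toL2 ν (A := fun v => ⟪mulOp n F V ν φ.conj v, w⟫_ℂ)
    (B := fun v => ⟪v, mulOp n F V ν φ w⟫_ℂ) (by fun_prop) (by fun_prop) (fun s => ?_) v
  refine ext_toL2 ν (A := fun w => ⟪mulOp n F V ν φ.conj (toL2 ν s), w⟫_ℂ)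
    (B := fun w => ⟪toL2 ν s, mulOp n F V ν φ w⟫_ℂ) (by fun_prop) (by fun_prop) (fun t => ?_) w
  rw [mulOp_toL2, mulOp_toL2, inner_toL2, inner_toL2]
  refine integral_congr_ae (.of_forall fun x => ?_)
  change ⟪(starRingEnd ℂ) (φ x) • s.1 x, t.1 x⟫_ℂ = ⟪s.1 x, φ x • t.1 x⟫_ℂ
  rw [inner_smul_left, inner_smul_right, Complex.conj_conj]

end L2Lemmas

/-! ### Averages of functions under a proper cocompact action. -/

section ProperAction

variable {X : Type*} [TopologicalSpace X] {G : Type*} [Group G] [TopologicalSpace G]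
  [IsTopologicalGroup G] [MulAction G X] [ProperSMul G X]

/-- The preimage of `K × L` under the proper map `(g, x) ↦ (g⁻¹ x, x)`. -/
theorem isCompact_setOf_inv_smul_mem {K L : Set X} (hK : IsCompact K) (hL : IsCompact L) :
    IsCompact {p : G × X | p.1⁻¹ • p.2 ∈ K ∧ p.2 ∈ L} := by
  have h := (ProperSMul.isProperMap_smul_pair (G := G) (X := X)).comp
    ((Homeomorph.inv G).prodCongr (Homeomorph.refl X)).isProperMap
  exact h.isCompact_preimage (hK.prod hL)

theorem isCompact_setOf_exists_inv_smul_mem {K L : Set X} (hK : IsCompact K) (hL : IsCompact L) :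
    IsCompact {g : G | ∃ x ∈ L, g⁻¹ • x ∈ K} := by
  have h := (isCompact_setOf_inv_smul_mem (G := G) hK hL).image continuous_fst
  convert! h using 1
  ext g
  simp only [mem_ofPred_eq, mem_image, Prod.exists, exists_and_right, exists_eq_right]
  exact exists_congr fun x => and_comm

variable [MeasurableSpace G] [BorelSpace G] (μ : Measure G) [μ.IsHaarMeasure]

/-- The average of a continuous function with compact support is continuous. -/
theorem continuous_integral_inv_smul [LocallyCompactSpace X] {E : Type*} [NormedAddCommGroup E]
    [NormedSpace ℝ E] {f : X → E} (hf : Continuous f) (hc : HasCompactSupport f) :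
    Continuous fun x => ∫ g : G, f (g⁻¹ • x) ∂μ := by
  refine continuous_iff_continuousAt.2 fun x₀ => ?_
  obtain ⟨L, hL, hx₀⟩ := exists_compact_mem_nhds x₀
  refine ContinuousOn.continuousAt ?_ hx₀
  refine continuousOn_integral_of_compact_support (f := fun x (g : G) => f (g⁻¹ • x))
    (isCompact_setOf_exists_inv_smul_mem hc hL) ?_ ?_
  · refine Continuous.continuousOn ?_
    exact hf.comp (continuous_snd.inv.smul continuous_fst)
  · intro x g hx hg
    by_contra h
    exact hg ⟨x, hx, subset_tsupport _ h⟩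

theorem integral_inv_smul_smul {E : Type*} [NormedAddCommGroup E]
    [NormedSpace ℝ E] (f : X → E) (h : G) (x : X) :
    ∫ g : G, f (g⁻¹ • h • x) ∂μ = ∫ g : G, f (g⁻¹ • x) ∂μ := by
  rw [← integral_mul_left_eq_self (fun g : G => f (g⁻¹ • x)) h⁻¹]
  simp [mul_smul]

theorem hasCompactSupport_inv_smul [T2Space X] {E : Type*} [NormedAddCommGroup E] {f : X → E}
    (hc : HasCompactSupport f) (x : X) :
    HasCompactSupport fun g : G => f (g⁻¹ • x) :=
  HasCompactSupport.intro' (isCompact_setOf_exists_inv_smul_mem hc (isCompact_singleton (x := x)))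
    (by
      have : {g : G | ∃ y ∈ ({x} : Set X), g⁻¹ • y ∈ tsupport f} =
          (fun g : G => g⁻¹ • x) ⁻¹' tsupport f := by
        ext g
        simp
      rw [this]
      exact (isClosed_tsupport f).preimage (continuous_inv.smul continuous_const))
    fun g hg => by
      by_contra h
      exact hg ⟨x, rfl, subset_tsupport _ h⟩

theorem exists_le_of_invariant [CompactSpace (Quotient (MulAction.orbitRel G X))] {f : X → ℝ}
    (hf : Continuous f) (hinv : ∀ (g : G) x, f (g • x) = f x) : ∃ C, ∀ x, f x ≤ C := by
  let q : Quotient (MulAction.orbitRel G X) → ℝ := Quotient.lift f fun a b hab => by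
    obtain ⟨g, rfl⟩ := hab
    exact hinv g b
  have hq : Continuous q := hf.quotient_lift _
  obtain ⟨C, hC⟩ := (isCompact_range hq).bddAbove
  exact ⟨C, fun x => hC ⟨Quotient.mk _ x, rfl⟩⟩

theorem exists_pos_le_of_invariant [CompactSpace (Quotient (MulAction.orbitRel G X))] {f : X → ℝ}
    (hf : Continuous f) (hinv : ∀ (g : G) x, f (g • x) = f x) (hpos : ∀ x, 0 < f x) :
    ∃ a, 0 < a ∧ ∀ x, a ≤ f x := by
  obtain ⟨C, hC⟩ := exists_le_of_invariant (hf.inv₀ fun x => (hpos x).ne')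
    fun g x => congrArg (·⁻¹) (hinv g x)
  -- `C` bounds `1 / f` but may fail to be positive when `X` is empty; the maximum repairs this.
  refine ⟨(max C 1)⁻¹, by positivity, fun x => ?_⟩
  rw [inv_le_comm₀ (by positivity) (hpos x)]
  exact (hC x).trans (le_max_left _ _)

end ProperAction

section Bump

/-- The quotient map is open, so by cocompactness the translates of finitely many bump supports
cover `X`; the sum of these bumps meets every orbit. -/
theorem exists_testFun_ne_zero (n : ℕ) (X : Type*) [TopologicalSpace X]
    [ChartedSpace (EuclideanSpace ℝ (Fin n)) X] [IsManifold (𝓡 n) ∞ X] [T2Space X]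
    (G : Type*) [Group G] [MulAction G X] [ContinuousConstSMul G X]
    [CompactSpace (Quotient (MulAction.orbitRel G X))] :
    ∃ φ : TestFun n X, ∀ x : X, ∃ g : G, φ (g⁻¹ • x) ≠ 0 := by
  let f : ∀ x : X, SmoothBumpFunction (𝓡 n) x := fun x => Classical.arbitrary _
  let pr : X → Quotient (MulAction.orbitRel G X) := Quotient.mk _
  have hopen : IsOpenMap pr := isOpenMap_quotient_mk'_mul
  obtain ⟨t, ht⟩ := isCompact_univ.elim_finite_subcover
    (fun x => pr '' Function.support (f x)) (fun x => hopen _ (f x).isOpen_support) (by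
      rintro ⟨x⟩ -
      exact mem_iUnion.2 ⟨x, x, (f x).c_mem_support, rfl⟩)
  refine ⟨⟨fun y => ((∑ x ∈ t, f x y : ℝ) : ℂ), ?_, ?_⟩, fun y => ?_⟩
  · have h1 : ContMDiff (𝓡 n) 𝓘(ℝ, ℝ) ∞ fun y => ∑ x ∈ t, f x y :=
      contMDiff_finsetSum fun x _ => (f x).contMDiff
    exact (Complex.ofRealCLM.contDiff (n := ∞)).contMDiff.comp h1
  · refine HasCompactSupport.intro (t.isCompact_biUnion fun x _ => (f x).hasCompactSupport)
      fun y hy => ?_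
    simp only [mem_iUnion, not_exists] at hy
    rw [Finset.sum_eq_zero fun x hx => image_eq_zero_of_notMem_tsupport (hy x hx),
      Complex.ofReal_zero]
  · obtain ⟨x, hx, z, hz, hzy⟩ : ∃ x ∈ t, pr y ∈ pr '' Function.support (f x) := by
      simpa using ht (mem_univ (pr y))
    obtain ⟨g, rfl⟩ : z ∈ MulAction.orbit G y := Quotient.exact hzy
    refine ⟨g⁻¹, ?_⟩
    simp only [inv_inv]
    refine Complex.ofReal_ne_zero.2 (ne_of_gt ?_)
    exact Finset.sum_pos' (fun x _ => (f x).nonneg)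
      ⟨x, hx, lt_of_le_of_ne (f x).nonneg (Ne.symm hz)⟩

end Bump

/-! ### The unitary action on square integrable sections. -/

section UnitaryAction

variable {n : ℕ} {X : Type*} [TopologicalSpace X] [ChartedSpace (EuclideanSpace ℝ (Fin n)) X]
  [RiemannianBundle (fun x : X => TangentSpace (𝓡 n) x)]
  {G : Type*} [Group G] [TopologicalSpace G] [MulAction G X] [ContinuousConstSMul G X]
  {F : Type*} [NormedAddCommGroup F] [NormedSpace ℂ F]
  {V : X → Type*} [TopologicalSpace (TotalSpace F V)]
  [∀ x, NormedAddCommGroup (V x)] [∀ x, InnerProductSpace ℂ (V x)] [FiberBundle F V]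
  [VectorBundle ℂ F V] [VectorBundle ℝ F V] [IsSmoothHermitian n F V]
  [MeasurableSpace X] [BorelSpace X] [T2Space X]
  {ν : Measure X} [IsFiniteMeasureOnCompacts ν]
  (ρ : BundleAction n G F V) (hG : IsIsometricAction n G X)

theorem norm_toL2_translateTest {g : G} (hν : MeasurePreserving (fun x : X => g • x) ν ν)
    (s : testSections n F V) : ‖toL2 ν (ρ.translateTest hG g s)‖ = ‖toL2 ν s‖ := by
  rw [← sq_eq_sq₀ (norm_nonneg _) (norm_nonneg _), norm_toL2_sq, norm_toL2_sq,
    ← hν.integral_comp (Homeomorph.smul g).measurableEmbedding]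
  simp only [ρ.translateTest_smul, ρ.norm_act]

variable (ν) in
/-- The unitary operator by which `g` acts on `L²(X, V)`. -/
def unitaryOp (g : G) : L2 n F V ν →L[ℂ] L2 n F V ν :=
  (toL2 ν ∘ₗ ρ.translateTest hG g).extendOfNorm (toL2 ν)

theorem unitaryOp_toL2 {g : G} (hν : MeasurePreserving (fun x : X => g • x) ν ν)
    (s : testSections n F V) :
    unitaryOp ν ρ hG g (toL2 ν s) = toL2 ν (ρ.translateTest hG g s) := by
  have h : ∃ C, ∀ s, ‖(toL2 ν ∘ₗ ρ.translateTest hG g) s‖ ≤ C * ‖toL2 ν s‖ :=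
    ⟨1, fun s => by rw [one_mul]; exact (norm_toL2_translateTest ρ hG hν s).le⟩
  exact LinearMap.extendOfNorm_eq (f := toL2 ν ∘ₗ ρ.translateTest hG g) (e := toL2 ν)
    (denseRange_toL2 (F := F) (V := V) ν) h s

theorem norm_unitaryOp {g : G} (hν : MeasurePreserving (fun x : X => g • x) ν ν) (w : L2 n F V ν) :
    ‖unitaryOp ν ρ hG g w‖ = ‖w‖ := by
  refine ext_toL2 ν (A := fun w => ‖unitaryOp ν ρ hG g w‖) (B := fun w => ‖w‖) (by fun_prop)
    (by fun_prop) (fun s => ?_) w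
  rw [unitaryOp_toL2 ρ hG hν, norm_toL2_translateTest ρ hG hν]

theorem unitaryOp_comp_inv (hν : ∀ g : G, MeasurePreserving (fun x : X => g • x) ν ν) (g : G) :
    unitaryOp ν ρ hG g ∘L unitaryOp ν ρ hG g⁻¹ = ContinuousLinearMap.id ℂ (L2 n F V ν) := by
  ext w
  refine ext_toL2 ν (A := unitaryOp ν ρ hG g ∘L unitaryOp ν ρ hG g⁻¹) (B := id) (by fun_prop)
    (by fun_prop) (fun s => ?_) w
  rw [ContinuousLinearMap.comp_apply, unitaryOp_toL2 ρ hG (hν _), unitaryOp_toL2 ρ hG (hν _),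
    ρ.translateTest_inv, id]

theorem adjoint_unitaryOp (hν : ∀ g : G, MeasurePreserving (fun x : X => g • x) ν ν) (g : G) :
    adjoint (unitaryOp ν ρ hG g) = unitaryOp ν ρ hG g⁻¹ := by
  refine ((ContinuousLinearMap.eq_adjoint_iff _ _).2 fun v w => ?_).symm
  let e : L2 n F V ν →ₗᵢ[ℂ] L2 n F V ν := ⟨unitaryOp ν ρ hG g, norm_unitaryOp ρ hG (hν g)⟩
  have h1 := e.inner_map_map (unitaryOp ν ρ hG g⁻¹ v) w
  have h2 : e (unitaryOp ν ρ hG g⁻¹ v) = v := congr($(unitaryOp_comp_inv ρ hG hν g) v)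
  rw [← h1, h2]
  rfl

/-- Lets `Commutes`, which is phrased through closures of graphs, be read as commutation with a
unitary operator. -/
theorem mem_graphL2_iff {g : G} (hν : MeasurePreserving (fun x : X => g • x) ν ν)
    (p : L2 n F V ν × L2 n F V ν) :
    p ∈ ρ.graphL2 ν g ↔ p.2 = unitaryOp ν ρ hG g p.1 := by
  constructor
  · intro hp
    have hcl : IsClosed {p : L2 n F V ν × L2 n F V ν | p.2 = unitaryOp ν ρ hG g p.1} :=
      isClosed_eq (by fun_prop) (by fun_prop)
    refine closure_minimal ?_ hcl hp
    rintro _ ⟨s, s', hss', rfl⟩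
    have : s' = ρ.translateTest hG g s :=
      Subtype.ext (hss'.unique (ρ.isTranslate_translate g s.1))
    change toL2 ν s' = unitaryOp ν ρ hG g (toL2 ν s)
    rw [unitaryOp_toL2 ρ hG hν, this]
  · obtain ⟨v, w⟩ := p
    intro h
    obtain rfl : w = unitaryOp ν ρ hG g v := h
    have hcl : IsClosed {v : L2 n F V ν | (v, unitaryOp ν ρ hG g v) ∈ ρ.graphL2 ν g} :=
      isClosed_closure.preimage (by fun_prop)
    refine (denseRange_toL2 ν).induction_on
      (p := fun v => (v, unitaryOp ν ρ hG g v) ∈ ρ.graphL2 ν g) v hcl fun s => ?_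
    refine subset_closure ⟨s, ρ.translateTest hG g s, ρ.isTranslate_translate g s.1, ?_⟩
    rw [unitaryOp_toL2 ρ hG hν]

theorem commutes_iff (hν : ∀ g : G, MeasurePreserving (fun x : X => g • x) ν ν)
    (S : L2 n F V ν →L[ℂ] L2 n F V ν) :
    ρ.Commutes ν S ↔ ∀ g, S ∘L unitaryOp ν ρ hG g = unitaryOp ν ρ hG g ∘L S := by
  constructor
  · intro h g
    ext v
    exact (mem_graphL2_iff ρ hG (hν g) _).1
      (h g (v, unitaryOp ν ρ hG g v) ((mem_graphL2_iff ρ hG (hν g) _).2 rfl))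
  · intro h g p hp
    rw [mem_graphL2_iff ρ hG (hν g)] at hp ⊢
    change S p.2 = unitaryOp ν ρ hG g (S p.1)
    rw [hp]
    exact congr($(h g) p.1)

theorem mulOp_translate (hν : ∀ g : G, MeasurePreserving (fun x : X => g • x) ν ν) (g : G)
    (φ : TestFun n X) :
    mulOp n F V ν (φ.translate hG g) =
      unitaryOp ν ρ hG g ∘L mulOp n F V ν φ ∘L unitaryOp ν ρ hG g⁻¹ := by
  ext w
  refine ext_toL2 ν (A := mulOp n F V ν (φ.translate hG g))
    (B := unitaryOp ν ρ hG g ∘L mulOp n F V ν φ ∘L unitaryOp ν ρ hG g⁻¹) (by fun_prop)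
    (by fun_prop) (fun s => ?_) w
  rw [ContinuousLinearMap.comp_apply, ContinuousLinearMap.comp_apply, unitaryOp_toL2 ρ hG (hν _),
    mulOp_toL2, mulOp_toL2, unitaryOp_toL2 ρ hG (hν _)]
  congr 1
  refine Subtype.ext (BundleAction.IsTranslate.unique
    (s := (φ.mulTest (ρ.translateTest hG g⁻¹ s)).1) (fun x => ?_)
    (ρ.isTranslate_translate g _))
  have h := ρ.translateTest_smul hG g (ρ.translateTest hG g⁻¹ s) x
  rw [ρ.translateTest_inv] at h
  change φ (g⁻¹ • g • x) • s.1 (g • x) = ρ.act g x (φ x • (ρ.translateTest hG g⁻¹ s).1 x)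
  rw [inv_smul_smul, h, map_smul]

end UnitaryAction

/-! ### Sections of a `G`-bundle as a `LocalRep`. -/

section Averaging

variable {n : ℕ} {X : Type*} [TopologicalSpace X] [ChartedSpace (EuclideanSpace ℝ (Fin n)) X]
  [RiemannianBundle (fun x : X => TangentSpace (𝓡 n) x)]
  {G : Type*} [Group G] [TopologicalSpace G] [IsTopologicalGroup G] [MeasurableSpace G]
  [BorelSpace G] [MulAction G X] [ProperSMul G X]
  {F : Type*} [NormedAddCommGroup F] [NormedSpace ℂ F]
  {V : X → Type*} [TopologicalSpace (TotalSpace F V)]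
  [∀ x, NormedAddCommGroup (V x)] [∀ x, InnerProductSpace ℂ (V x)] [FiberBundle F V]
  [VectorBundle ℂ F V] [VectorBundle ℝ F V] [IsSmoothHermitian n F V]
  [MeasurableSpace X] [BorelSpace X] [T2Space X]
  {ν : Measure X} [IsFiniteMeasureOnCompacts ν]
  (μ : Measure G) [μ.IsHaarMeasure] (hG : IsIsometricAction n G X)

theorem continuous_norm_sq_section (s : testSections n F V) : Continuous fun x => ‖s.1 x‖ ^ 2 := by
  have := Complex.continuous_re.comp (continuous_inner_section s s)
  refine this.congr fun x => ?_
  exact inner_self_eq_norm_sq (𝕜 := ℂ) (s.1 x)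

theorem TestFun.continuous (φ : TestFun n X) : Continuous φ.toFun := φ.smooth.continuous

theorem continuous_mulOp_translate (φ : TestFun n X) (s : testSections n F V) :
    Continuous fun g : G => mulOp n F V ν (φ.translate hG g) (toL2 ν s) := by
  refine continuous_iff_continuousAt.2 fun g₀ => ?_
  rw [ContinuousAt, tendsto_iff_norm_sub_tendsto_zero]
  have hsq : ∀ g : G, ‖mulOp n F V ν (φ.translate hG g) (toL2 ν s) -
      mulOp n F V ν (φ.translate hG g₀) (toL2 ν s)‖ =
      √(∫ x, ‖φ (g⁻¹ • x) - φ (g₀⁻¹ • x)‖ ^ 2 * ‖s.1 x‖ ^ 2 ∂ν) := fun g => by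
    rw [mulOp_toL2, mulOp_toL2, ← map_sub, ← Real.sqrt_sq (norm_nonneg _), norm_toL2_sq]
    congr 2
    ext x
    change ‖φ (g⁻¹ • x) • s.1 x - φ (g₀⁻¹ • x) • s.1 x‖ ^ 2 = _
    rw [← sub_smul, norm_smul, mul_pow]
  simp_rw [hsq]
  obtain ⟨K, hK, hs⟩ := s.2.2
  have hcont : Continuous fun g : G =>
      ∫ x, ‖φ (g⁻¹ • x) - φ (g₀⁻¹ • x)‖ ^ 2 * ‖s.1 x‖ ^ 2 ∂ν := by
    rw [← continuousOn_univ]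
    refine continuousOn_integral_of_compact_support
      (f := fun (g : G) x => ‖φ (g⁻¹ • x) - φ (g₀⁻¹ • x)‖ ^ 2 * ‖s.1 x‖ ^ 2) hK ?_ ?_
    · refine Continuous.continuousOn ?_
      refine Continuous.mul ?_ ((continuous_norm_sq_section s).comp continuous_snd)
      exact ((φ.continuous.comp (continuous_fst.inv.smul continuous_snd)).sub
        (φ.continuous.comp (continuous_snd.const_smul _))).norm.pow 2
    · intro g x _ hx
      simp [hs x hx]
  have := (Real.continuous_sqrt.comp hcont).tendsto g₀
  simpa [Function.comp_def] using this

/-- The integral over `G` of the localized inner products of two sections. -/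
theorem integral_inner_mulOp (φ ψ : TestFun n X) (s t : testSections n F V) :
    ∫ g : G, ⟪mulOp n F V ν (φ.translate hG g) (toL2 ν s),
      mulOp n F V ν (ψ.translate hG g) (toL2 ν t)⟫_ℂ ∂μ =
    ∫ x, (∫ g : G, (starRingEnd ℂ) (φ (g⁻¹ • x)) * ψ (g⁻¹ • x) ∂μ) * ⟪s.1 x, t.1 x⟫_ℂ ∂ν := by
  have h1 : ∀ g : G, ⟪mulOp n F V ν (φ.translate hG g) (toL2 ν s),
      mulOp n F V ν (ψ.translate hG g) (toL2 ν t)⟫_ℂ =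
      ∫ x, (starRingEnd ℂ) (φ (g⁻¹ • x)) * ψ (g⁻¹ • x) * ⟪s.1 x, t.1 x⟫_ℂ ∂ν := fun g => by
    rw [mulOp_toL2, mulOp_toL2, inner_toL2]
    refine integral_congr_ae (.of_forall fun x => ?_)
    change ⟪φ (g⁻¹ • x) • s.1 x, ψ (g⁻¹ • x) • t.1 x⟫_ℂ = _
    rw [inner_smul_left, inner_smul_right]
    exact (mul_assoc _ _ _).symm
  simp_rw [h1, ← integral_mul_const]
  obtain ⟨K, hK, hs⟩ := s.2.2
  -- Compact support on `G × X`, which comes from properness, permits the exchange although `μ` is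
  -- not assumed σ-finite.
  refine integral_integral_swap_of_hasCompactSupport ?_ ?_
  · refine Continuous.mul (Continuous.mul ?_ ?_) ?_
    · exact Complex.continuous_conj.comp
        (φ.continuous.comp (continuous_fst.inv.smul continuous_snd))
    · exact ψ.continuous.comp (continuous_fst.inv.smul continuous_snd)
    · exact (continuous_inner_section s t).comp continuous_snd
  · refine HasCompactSupport.of_support_subset_isCompact
      (isCompact_setOf_inv_smul_mem (G := G) ψ.compact hK) fun p hp => ⟨?_, ?_⟩
    · by_contra h
      refine hp ?_
      simp [Function.uncurry, image_eq_zero_of_notMem_tsupport h]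
    · by_contra h
      refine hp ?_
      simp [Function.uncurry, hs _ h]

theorem integral_norm_sq_mulOp (φ : TestFun n X) (s : testSections n F V) :
    ∫ g : G, ‖mulOp n F V ν (φ.translate hG g) (toL2 ν s)‖ ^ 2 ∂μ =
      ∫ x, (∫ g : G, ‖φ (g⁻¹ • x)‖ ^ 2 ∂μ) * ‖s.1 x‖ ^ 2 ∂ν := by
  have h := integral_inner_mulOp (ν := ν) μ hG φ φ s s
  simp only [inner_self_eq_norm_sq_to_K, RCLike.conj_mul] at h
  have h2 : ∀ x : X, ∫ g : G, ((‖φ (g⁻¹ • x)‖ : ℂ)) ^ 2 ∂μ =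
      ((∫ g : G, ‖φ (g⁻¹ • x)‖ ^ 2 ∂μ : ℝ) : ℂ) := fun x => by
    rw [← integral_complex_ofReal]
    simp
  apply Complex.ofReal_injective
  rw [← integral_complex_ofReal, ← integral_complex_ofReal]
  simpa [h2] using h

theorem integrable_norm_sq_mulOp (φ : TestFun n X) (s : testSections n F V) :
    Integrable (fun g : G => ‖mulOp n F V ν (φ.translate hG g) (toL2 ν s)‖ ^ 2) μ := by
  obtain ⟨K, hK, hs⟩ := s.2.2
  refine ((continuous_mulOp_translate hG φ s).norm.pow 2).integrable_of_hasCompactSupport ?_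
  refine HasCompactSupport.of_support_subset_isCompact
    (isCompact_setOf_exists_inv_smul_mem (G := G) φ.compact hK) fun g hg => ?_
  by_contra h
  refine hg ?_
  have h0 : (φ.translate hG g).mulTest s = 0 := by
    ext x
    change φ (g⁻¹ • x) • s.1 x = 0
    by_cases hx : x ∈ K
    · rw [image_eq_zero_of_notMem_tsupport fun h' => h ⟨x, hx, h'⟩, zero_smul]
    · rw [hs x hx, smul_zero]
  simp [mulOp_toL2, h0]

theorem lintegral_mulOp_eq (φ : TestFun n X) (s : testSections n F V) :
    ∫⁻ g : G, ‖mulOp n F V ν (φ.translate hG g) (toL2 ν s)‖ₑ ^ 2 ∂μ =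
      ENNReal.ofReal (∫ x, (∫ g : G, ‖φ (g⁻¹ • x)‖ ^ 2 ∂μ) * ‖s.1 x‖ ^ 2 ∂ν) := by
  simp only [enorm_sq_eq_ofReal]
  rw [← integral_norm_sq_mulOp μ hG φ s, ofReal_integral_eq_lintegral_ofReal
    (integrable_norm_sq_mulOp μ hG φ s) (.of_forall fun _ => by positivity)]

theorem integrable_mul_norm_sq_section {f : X → ℝ} (hf : Continuous f) (s : testSections n F V) :
    Integrable (fun x => f x * ‖s.1 x‖ ^ 2) ν := by
  obtain ⟨K, hK, hs⟩ := s.2.2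
  exact (hf.mul (continuous_norm_sq_section s)).integrable_of_hasCompactSupport
    (HasCompactSupport.intro hK fun x hx => by simp [hs x hx])

theorem continuous_integral_norm_sq [LocallyCompactSpace X] (φ : TestFun n X) :
    Continuous fun x => ∫ g : G, ‖φ (g⁻¹ • x)‖ ^ 2 ∂μ :=
  continuous_integral_inv_smul μ (f := fun x => ‖φ x‖ ^ 2) (φ.continuous.norm.pow 2)
    (φ.compact.comp_left (g := fun z : ℂ => ‖z‖ ^ 2) (by simp))

variable [CompactSpace (Quotient (MulAction.orbitRel G X))]

/-- By Fubini the integral weights `‖s‖²` by the group average of `|φ|²`, a continuous invariant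
function, which is bounded by cocompactness. -/
theorem exists_lintegral_mulOp_le [LocallyCompactSpace X] (φ : TestFun n X) :
    ∃ b : ℝ≥0, ∀ s : testSections n F V,
      ∫⁻ g : G, ‖mulOp n F V ν (φ.translate hG g) (toL2 ν s)‖ₑ ^ 2 ∂μ ≤ b * ‖toL2 ν s‖ₑ ^ 2 := by
  have hcont := continuous_integral_norm_sq (G := G) μ φ
  obtain ⟨C, hC⟩ := exists_le_of_invariant (G := G) hcont
    fun g x => integral_inv_smul_smul μ (fun x => ‖φ x‖ ^ 2) g x
  refine ⟨(max C 0).toNNReal, fun s => ?_⟩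
  rw [lintegral_mulOp_eq, enorm_sq_eq_ofReal, norm_toL2_sq, ← ENNReal.ofReal,
    ← ENNReal.ofReal_mul (le_max_right _ _), ← integral_const_mul]
  refine ENNReal.ofReal_le_ofReal (integral_mono (integrable_mul_norm_sq_section hcont s)
    (integrable_mul_norm_sq_section continuous_const s) fun x => ?_)
  exact mul_le_mul_of_nonneg_right ((hC x).trans (le_max_left _ _)) (by positivity)

/-- For a test function that meets every orbit the average of `|φ|²` is positive everywhere, hence
bounded below. -/
theorem exists_le_lintegral_mulOp [LocallyCompactSpace X] [IsManifold (𝓡 n) ∞ X] :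
    ∃ φ : TestFun n X, ∃ a : ℝ≥0, a ≠ 0 ∧ ∀ s : testSections n F V,
      a * ‖toL2 ν s‖ₑ ^ 2 ≤
        ∫⁻ g : G, ‖mulOp n F V ν (φ.translate hG g) (toL2 ν s)‖ₑ ^ 2 ∂μ := by
  obtain ⟨φ, hφ⟩ := exists_testFun_ne_zero n X G
  have hcont := continuous_integral_norm_sq (G := G) μ φ
  have hpos : ∀ x : X, 0 < ∫ g : G, ‖φ (g⁻¹ • x)‖ ^ 2 ∂μ := fun x => by
    obtain ⟨g, hg⟩ := hφ x
    refine Continuous.integral_pos_of_hasCompactSupport_nonneg_nonzero (x := g) ?_ ?_ ?_ ?_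
    · exact (φ.continuous.comp (continuous_inv.smul continuous_const)).norm.pow 2
    · exact hasCompactSupport_inv_smul (f := fun x => ‖φ x‖ ^ 2)
        (φ.compact.comp_left (g := fun z : ℂ => ‖z‖ ^ 2) (by simp)) x
    · intro g
      positivity
    · simpa using hg
  obtain ⟨a, ha, hle⟩ := exists_pos_le_of_invariant (G := G) hcont
    (fun g x => integral_inv_smul_smul μ (fun x => ‖φ x‖ ^ 2) g x) hpos
  refine ⟨φ, a.toNNReal, by simpa using ha, fun s => ?_⟩
  rw [lintegral_mulOp_eq, enorm_sq_eq_ofReal, norm_toL2_sq, ← ENNReal.ofReal,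
    ← ENNReal.ofReal_mul ha.le, ← integral_const_mul]
  refine ENNReal.ofReal_le_ofReal (integral_mono
    (integrable_mul_norm_sq_section continuous_const s) (integrable_mul_norm_sq_section hcont s)
    fun x => ?_)
  exact mul_le_mul_of_nonneg_right (hle x) (by positivity)

theorem conj_of_nonneg {φ : TestFun n X} (h : ∀ x, ∃ r : ℝ, 0 ≤ r ∧ φ x = r) (x : X) :
    (starRingEnd ℂ) (φ x) = φ x := by
  obtain ⟨r, -, hr⟩ := h x
  rw [hr, Complex.conj_ofReal]

theorem adjoint_mulOp_of_nonneg {φ : TestFun n X} (h : ∀ x, ∃ r : ℝ, 0 ≤ r ∧ φ x = r) :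
    adjoint (mulOp n F V ν φ) = mulOp n F V ν φ := by
  have hφ : φ.conj = φ := by
    obtain ⟨f, hf, hf'⟩ := φ
    have : (fun x => (starRingEnd ℂ) (f x)) = f := funext (conj_of_nonneg h)
    simp only [TestFun.conj, this]
  rw [adjoint_mulOp, hφ]

theorem integral_inner_mulOp_cutoff (c : CutoffPair n X μ) (s t : testSections n F V) :
    ∫ g : G, ⟪mulOp n F V ν (c.c₁.translate hG g) (toL2 ν s),
      mulOp n F V ν (c.c₂.translate hG g) (toL2 ν t)⟫_ℂ ∂μ = ⟪toL2 ν s, toL2 ν t⟫_ℂ := by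
  rw [integral_inner_mulOp, inner_toL2]
  refine integral_congr_ae (.of_forall fun x => ?_)
  simp only [conj_of_nonneg c.nonneg₁, c.integral_eq_one, one_mul]

/-- The `L²`-sections of a `G`-vector bundle with the action of `G` and the multiplication by test
functions. -/
def bundleRep [LocallyCompactSpace X] [IsManifold (𝓡 n) ∞ X] (ρ : BundleAction n G F V)
    (hν : ∀ g : G, MeasurePreserving (fun x : X => g • x) ν ν) :
    LocalRep μ (TestFun.translate hG) {d | ∃ c : CutoffPair n X μ, d = (c.c₁, c.c₂)}
      (L2 n F V ν) where
  U := unitaryOp ν ρ hG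
  M := mulOp n F V ν
  core := LinearMap.range (toL2 ν)
  dense_core := denseRange_toL2 ν
  adjoint_U := adjoint_unitaryOp ρ hG hν
  U_comp_U_inv := unitaryOp_comp_inv ρ hG hν
  adjoint_M φ := ⟨φ.conj, adjoint_mulOp ν φ⟩
  M_translate g φ := mulOp_translate ρ hG hν g φ
  continuous_core := by
    rintro φ _ ⟨s, rfl⟩
    exact continuous_mulOp_translate hG φ s
  upper_core φ := by
    obtain ⟨b, hb⟩ := exists_lintegral_mulOp_le (F := F) (V := V) (ν := ν) μ hG φ
    refine ⟨b, ?_⟩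
    rintro _ ⟨s, rfl⟩
    exact hb s
  lower_core := by
    obtain ⟨φ, a, ha, h⟩ := exists_le_lintegral_mulOp (F := F) (V := V) (ν := ν) μ hG
    refine ⟨φ, a, ha, ?_⟩
    rintro _ ⟨s, rfl⟩
    exact h s
  adjoint_cut := by
    rintro _ ⟨c, rfl⟩
    exact ⟨adjoint_mulOp_of_nonneg c.nonneg₁, adjoint_mulOp_of_nonneg c.nonneg₂⟩
  integral_core := by
    rintro _ ⟨c, rfl⟩ _ ⟨s, rfl⟩ _ ⟨t, rfl⟩
    exact integral_inner_mulOp_cutoff μ hG c s t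

end Averaging

/-! ### The closure of `P₀` and its remainders. -/

section ClosureGraph

variable {n : ℕ} {X : Type*} [TopologicalSpace X] [ChartedSpace (EuclideanSpace ℝ (Fin n)) X]
  {F₀ : Type*} [NormedAddCommGroup F₀] [NormedSpace ℂ F₀]
  {V₀ : X → Type*} [TopologicalSpace (TotalSpace F₀ V₀)]
  [∀ x, NormedAddCommGroup (V₀ x)] [∀ x, InnerProductSpace ℂ (V₀ x)] [FiberBundle F₀ V₀]
  {F₁ : Type*} [NormedAddCommGroup F₁] [NormedSpace ℂ F₁]
  {V₁ : X → Type*} [TopologicalSpace (TotalSpace F₁ V₁)]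
  [∀ x, NormedAddCommGroup (V₁ x)] [∀ x, InnerProductSpace ℂ (V₁ x)] [FiberBundle F₁ V₁]
  [VectorBundle ℂ F₀ V₀] [VectorBundle ℝ F₀ V₀] [VectorBundle ℂ F₁ V₁] [VectorBundle ℝ F₁ V₁]
  [IsSmoothHermitian n F₀ V₀] [IsSmoothHermitian n F₁ V₁]
  [MeasurableSpace X] [BorelSpace X] [T2Space X]
  {ν : Measure X} [IsFiniteMeasureOnCompacts ν]
  {P₀ : testSections n F₀ V₀ →ₗ[ℂ] testSections n F₁ V₁}

theorem isClosed_closureGraph :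
    IsClosed (closureGraph ν P₀ : Set (L2 n F₀ V₀ ν × L2 n F₁ V₁ ν)) :=
  Submodule.isClosed_topologicalClosure _

theorem toL2_mem_closureGraph (u : testSections n F₀ V₀) :
    (toL2 ν u, toL2 ν (P₀ u)) ∈ closureGraph ν P₀ :=
  subset_closure ⟨u, rfl⟩

/-- A closed condition holds on the graph of the closure as soon as it holds for test sections. -/
theorem closureGraph_induction {p : L2 n F₀ V₀ ν × L2 n F₁ V₁ ν} (hp : p ∈ closureGraph ν P₀)
    {C : Set (L2 n F₀ V₀ ν × L2 n F₁ V₁ ν)} (hC : IsClosed C)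
    (h : ∀ u, (toL2 ν u, toL2 ν (P₀ u)) ∈ C) : p ∈ C := by
  refine closure_minimal ?_ hC hp
  rintro _ ⟨u, rfl⟩
  exact h u

theorem eq_zero_of_inner_closureGraph {x : L2 n F₀ V₀ ν}
    (hx : ∀ p ∈ closureGraph ν P₀, ⟪p.1, x⟫_ℂ = 0) : x = 0 := by
  have h := ext_toL2 ν (A := fun w => ⟪w, x⟫_ℂ) (B := fun _ => 0) (by fun_prop) (by fun_prop)
    (fun s => hx _ (toL2_mem_closureGraph s)) x
  exact inner_self_eq_zero.1 h

/-- A densely defined formal adjoint makes `P₀` closable. -/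
theorem closureGraph_eq_zero {P₀' : testSections n F₁ V₁ →ₗ[ℂ] testSections n F₀ V₀}
    (hadj : ∀ u v, ⟪toL2 ν (P₀ u), toL2 ν v⟫_ℂ = ⟪toL2 ν u, toL2 ν (P₀' v)⟫_ℂ)
    {y : L2 n F₁ V₁ ν} (hy : (0, y) ∈ closureGraph ν P₀) : y = 0 := by
  have h : ∀ v, ⟪y, toL2 ν v⟫_ℂ = 0 := fun v => by
    have := closureGraph_induction hy
      (C := {p | ⟪p.2, toL2 ν v⟫_ℂ = ⟪p.1, toL2 ν (P₀' v)⟫_ℂ})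
      (isClosed_eq (by fun_prop) (by fun_prop)) fun u => hadj u v
    simpa using this
  exact inner_self_eq_zero.1 (ext_toL2 ν (A := fun w => ⟪y, w⟫_ℂ) (B := fun _ => 0)
    (by fun_prop) (by fun_prop) h y)

theorem mem_kerOp {x : L2 n F₀ V₀ ν} : x ∈ kerOp ν P₀ ↔ (x, 0) ∈ closureGraph ν P₀ := Iff.rfl

theorem mem_kerAdj {y : L2 n F₁ V₁ ν} :
    y ∈ kerAdj ν P₀ ↔ ∀ p ∈ closureGraph ν P₀, ⟪p.2, y⟫_ℂ = 0 := by
  constructor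
  · intro hy p hp
    refine closureGraph_induction hp (C := {p | ⟪p.2, y⟫_ℂ = 0})
      (isClosed_eq (by fun_prop) (by fun_prop)) fun u => ?_
    exact (hy u).trans (inner_zero_right _)
  · intro hy u
    exact (hy _ (toL2_mem_closureGraph u)).trans (inner_zero_right _).symm

section Remainders

variable {Q : L2 n F₁ V₁ ν →ₗ.[ℂ] L2 n F₀ V₀ ν} {S₁ : L2 n F₀ V₀ ν →L[ℂ] L2 n F₀ V₀ ν}
  {S₂ : L2 n F₁ V₁ ν →L[ℂ] L2 n F₁ V₁ ν}

theorem map_mem_closureGraph (hQ₁ : LeftRemainder ν P₀ Q S₁) (hQ₂ : RightRemainder ν P₀ Q S₂)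
    {p : L2 n F₀ V₀ ν × L2 n F₁ V₁ ν} (hp : p ∈ closureGraph ν P₀) :
    (S₁ p.1, S₂ p.2) ∈ closureGraph ν P₀ := by
  refine closureGraph_induction hp (C := {p | (S₁ p.1, S₂ p.2) ∈ closureGraph ν P₀})
    (isClosed_closureGraph.preimage (by fun_prop)) fun u => ?_
  obtain ⟨h, hu⟩ := hQ₁ u
  obtain ⟨_, hv⟩ := hQ₂ (P₀ u)
  -- On test sections the pair is `(u, P₀ u) - (Q P₀ u, P₀ u - S₂ P₀ u)`, a difference of two points
  -- of the graph.
  have := (closureGraph ν P₀).sub_mem (toL2_mem_closureGraph u) hv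
  rwa [Prod.mk_sub_mk, hu, sub_sub_cancel] at this

/-- If `uₖ → x` and `P₀ uₖ → 0`, then `Q P₀ uₖ = uₖ - S₁ uₖ → x - S₁ x`, and closability of `Q`
forces this limit to vanish. -/
theorem apply_eq_of_mem_kerOp (hQ : Q.IsClosable) (hQ₁ : LeftRemainder ν P₀ Q S₁)
    {x : L2 n F₀ V₀ ν} (hx : x ∈ kerOp ν P₀) : S₁ x = x := by
  obtain ⟨Q', hQ'⟩ := hQ
  have h : (0, x - S₁ x) ∈ Q'.graph := by
    rw [← hQ']
    refine closureGraph_induction (mem_kerOp.1 hx)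
      (C := {p | (p.2, p.1 - S₁ p.1) ∈ Q.graph.topologicalClosure})
      ((Submodule.isClosed_topologicalClosure _).preimage (by fun_prop)) fun u => ?_
    obtain ⟨h, hu⟩ := hQ₁ u
    refine subset_closure ?_
    change (toL2 ν (P₀ u), toL2 ν u - S₁ (toL2 ν u)) ∈ Q.graph
    rw [← hu, sub_sub_cancel]
    exact Q.mem_graph ⟨_, h⟩
  exact (sub_eq_zero.1 (Q'.graph_fst_eq_zero_snd h rfl)).symm

theorem inner_apply_of_mem_kerAdj (hQ₂ : RightRemainder ν P₀ Q S₂) {y : L2 n F₁ V₁ ν}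
    (hy : y ∈ kerAdj ν P₀) (w : L2 n F₁ V₁ ν) : ⟪w - S₂ w, y⟫_ℂ = 0 := by
  refine ext_toL2 ν (A := fun w => ⟪w - S₂ w, y⟫_ℂ) (B := fun _ => 0) (by fun_prop) (by fun_prop)
    (fun v => ?_) w
  obtain ⟨_, hv⟩ := hQ₂ v
  exact mem_kerAdj.1 hy _ hv

theorem comp_starProjection_kerOp (hQ : Q.IsClosable) (hQ₁ : LeftRemainder ν P₀ Q S₁) :
    S₁ ∘L (kerOp ν P₀).starProjection = (kerOp ν P₀).starProjection := by
  ext x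
  exact apply_eq_of_mem_kerOp hQ hQ₁ (Submodule.starProjection_apply_mem _ x)

/-- The range of `1 - S₂` is orthogonal to `Ker P₀*`. The projection is absorbed on the left only,
in contrast to `S₁`, so cyclicity of the trace will be needed. -/
theorem starProjection_kerAdj_comp (hQ₂ : RightRemainder ν P₀ Q S₂) :
    (kerAdj ν P₀).starProjection ∘L S₂ = (kerAdj ν P₀).starProjection := by
  ext w
  have h : (kerAdj ν P₀).starProjection (w - S₂ w) = 0 := by
    rw [Submodule.starProjection_apply_eq_zero_iff, Submodule.mem_orthogonal']
    exact fun y hy => inner_apply_of_mem_kerAdj hQ₂ hy w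
  rw [map_sub, sub_eq_zero] at h
  exact h.symm

end Remainders

end ClosureGraph

section Projections

theorem starProjection_comp_self {H : Type*} [NormedAddCommGroup H] [InnerProductSpace ℂ H]
    (K : Submodule ℂ H) [K.HasOrthogonalProjection] :
    K.starProjection ∘L K.starProjection = K.starProjection :=
  K.isIdempotentElem_starProjection

theorem adjoint_starProjection {H : Type*} [NormedAddCommGroup H] [InnerProductSpace ℂ H]
    [CompleteSpace H] (K : Submodule ℂ H) [K.HasOrthogonalProjection] :
    adjoint K.starProjection = K.starProjection :=
  isSelfAdjoint_starProjection K

theorem abs_starProjection {H : Type*} [NormedAddCommGroup H] [InnerProductSpace ℂ H]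
    [CompleteSpace H] (K : Submodule ℂ H) [K.HasOrthogonalProjection] :
    CFC.abs K.starProjection = K.starProjection := by
  refine CFC.abs_of_nonneg _ ?_
  have h := star_mul_self_nonneg K.starProjection
  rwa [ContinuousLinearMap.star_eq_adjoint, adjoint_starProjection,
    K.isIdempotentElem_starProjection] at h

end Projections

/-! ### From the abstract local trace to the `G`-trace. -/

section BundleRep

variable {n : ℕ} {X : Type*} [TopologicalSpace X] [ChartedSpace (EuclideanSpace ℝ (Fin n)) X]
  [RiemannianBundle (fun x : X => TangentSpace (𝓡 n) x)]
  {G : Type*} [Group G] [TopologicalSpace G] [IsTopologicalGroup G] [MeasurableSpace G]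
  [BorelSpace G] [MulAction G X] [ProperSMul G X]
  [CompactSpace (Quotient (MulAction.orbitRel G X))]
  {F₀ : Type*} [NormedAddCommGroup F₀] [NormedSpace ℂ F₀]
  {V₀ : X → Type*} [TopologicalSpace (TotalSpace F₀ V₀)]
  [∀ x, NormedAddCommGroup (V₀ x)] [∀ x, InnerProductSpace ℂ (V₀ x)] [FiberBundle F₀ V₀]
  {F₁ : Type*} [NormedAddCommGroup F₁] [NormedSpace ℂ F₁]
  {V₁ : X → Type*} [TopologicalSpace (TotalSpace F₁ V₁)]
  [∀ x, NormedAddCommGroup (V₁ x)] [∀ x, InnerProductSpace ℂ (V₁ x)] [FiberBundle F₁ V₁]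
  [VectorBundle ℂ F₀ V₀] [VectorBundle ℝ F₀ V₀] [VectorBundle ℂ F₁ V₁] [VectorBundle ℝ F₁ V₁]
  [IsSmoothHermitian n F₀ V₀] [IsSmoothHermitian n F₁ V₁]
  [MeasurableSpace X] [BorelSpace X] [T2Space X] [LocallyCompactSpace X] [IsManifold (𝓡 n) ∞ X]
  {ν : Measure X} [IsFiniteMeasureOnCompacts ν]
  {μ : Measure G} [μ.IsHaarMeasure] [μ.IsInvInvariant] {hG : IsIsometricAction n G X}
  {ρ₀ : BundleAction n G F₀ V₀} {ρ₁ : BundleAction n G F₁ V₁}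
  {hν : ∀ g : G, MeasurePreserving (fun x : X => g • x) ν ν}
  {P₀ : testSections n F₀ V₀ →ₗ[ℂ] testSections n F₁ V₁}

theorem IsGTraceClass.locTC {S : L2 n F₀ V₀ ν →L[ℂ] L2 n F₀ V₀ ν} (hS : IsGTraceClass ρ₀ S) :
    LocalRep.LocTC (bundleRep μ hG ρ₀ hν) S :=
  LocalRep.locTC_of_isTraceClass ((commutes_iff ρ₀ hG hν S).1 hS.1) hS.2

theorem isGTraceClass_starProjection {K : Submodule ℂ (L2 n F₀ V₀ ν)}
    [K.HasOrthogonalProjection] (h : LocalRep.LocHS (bundleRep μ hG ρ₀ hν) (bundleRep μ hG ρ₀ hν)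
      K.starProjection) : IsGTraceClass ρ₀ K.starProjection := by
  refine ⟨(commutes_iff ρ₀ hG hν _).2 h.equivariant, fun φ ψ => ?_⟩
  have := LocalRep.isTraceClass_of_locHS h h φ ψ
  rw [adjoint_starProjection, starProjection_comp_self] at this
  rwa [abs_starProjection]

theorem gTrace_eq_tr (c : CutoffPair n X μ) (S : L2 n F₀ V₀ ν →L[ℂ] L2 n F₀ V₀ ν) :
    gTrace c S = (bundleRep μ hG ρ₀ hν).tr (c.c₁, c.c₂) S := rfl

theorem ofReal_gDim {K : Submodule ℂ (L2 n F₀ V₀ ν)} [K.HasOrthogonalProjection]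
    (h : LocalRep.LocHS (bundleRep μ hG ρ₀ hν) (bundleRep μ hG ρ₀ hν) K.starProjection)
    (c : CutoffPair n X μ) :
    (gDim c K : ℂ) = (bundleRep μ hG ρ₀ hν).tr (c.c₁, c.c₂) K.starProjection := by
  have hc : (c.c₁, c.c₂) ∈ {d | ∃ c : CutoffPair n X μ, d = (c.c₁, c.c₂)} := ⟨c, rfl⟩
  have h' := LocalRep.conj_tr_of_projection h (adjoint_starProjection K)
    (starProjection_comp_self K) hc
  rw [gDim, gTrace_eq_tr (μ := μ) (hG := hG) (ρ₀ := ρ₀) (hν := hν)]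
  exact Complex.conj_eq_iff_re.1 h'

theorem unitaryOp_mem_closureGraph (hν : ∀ g : G, MeasurePreserving (fun x : X => g • x) ν ν)
    (hP : IsInvariantOp ρ₀ ρ₁ ((testSections n F₁ V₁).subtype ∘ₗ P₀)) (g : G)
    {p : L2 n F₀ V₀ ν × L2 n F₁ V₁ ν} (hp : p ∈ closureGraph ν P₀) :
    (unitaryOp ν ρ₀ hG g p.1, unitaryOp ν ρ₁ hG g p.2) ∈ closureGraph ν P₀ := by
  refine closureGraph_induction hp
    (C := {p | (unitaryOp ν ρ₀ hG g p.1, unitaryOp ν ρ₁ hG g p.2) ∈ closureGraph ν P₀})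
    (isClosed_closureGraph.preimage (by fun_prop)) fun u => ?_
  have h : P₀ (ρ₀.translateTest hG g u) = ρ₁.translateTest hG g (P₀ u) :=
    Subtype.ext ((hP g u (ρ₀.translateTest hG g u) (ρ₀.isTranslate_translate g u.1)).unique
      (ρ₁.isTranslate_translate g (P₀ u).1))
  change (unitaryOp ν ρ₀ hG g (toL2 ν u), unitaryOp ν ρ₁ hG g (toL2 ν (P₀ u))) ∈ closureGraph ν P₀
  rw [unitaryOp_toL2 ρ₀ hG (hν g), unitaryOp_toL2 ρ₁ hG (hν g), ← h]
  exact toL2_mem_closureGraph _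

theorem equivariant_starProjection_kerOp
    (hP : IsInvariantOp ρ₀ ρ₁ ((testSections n F₁ V₁).subtype ∘ₗ P₀)) :
    LocalRep.Equivariant (bundleRep μ hG ρ₀ hν) (bundleRep μ hG ρ₀ hν)
      (kerOp ν P₀).starProjection :=
  LocalRep.equivariant_starProjection fun g x hx => by
    have := unitaryOp_mem_closureGraph (hG := hG) hν hP g (mem_kerOp.1 hx)
    rw [map_zero] at this
    exact this

theorem equivariant_starProjection_kerAdj
    (hP : IsInvariantOp ρ₀ ρ₁ ((testSections n F₁ V₁).subtype ∘ₗ P₀)) :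
    LocalRep.Equivariant (bundleRep μ hG ρ₁ hν) (bundleRep μ hG ρ₁ hν)
      (kerAdj ν P₀).starProjection :=
  LocalRep.equivariant_starProjection fun g y hy => by
    refine mem_kerAdj.2 fun p hp => ?_
    rw [← ContinuousLinearMap.adjoint_inner_left, LocalRep.adjoint_U]
    exact mem_kerAdj.1 hy _ (unitaryOp_mem_closureGraph (hG := hG) hν hP g⁻¹ hp)

end BundleRep

end GIndex

end

theorem mainTheorem11
    -- the complete Riemannian manifold `X` with its volume measure `ν`
    {n : ℕ} {X : Type*} [EMetricSpace X] [ChartedSpace (EuclideanSpace ℝ (Fin n)) X]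
    [IsManifold (𝓡 n) ∞ X] [SecondCountableTopology X]
    [RiemannianBundle (fun x : X => TangentSpace (𝓡 n) x)]
    [IsContMDiffRiemannianBundle (𝓡 n) ∞ (EuclideanSpace ℝ (Fin n))
      (fun x : X => TangentSpace (𝓡 n) x)]
    [IsRiemannianManifold (𝓡 n) X] [CompleteSpace X]
    [MeasurableSpace X] [BorelSpace X] (ν : Measure X) [IsFiniteMeasureOnCompacts ν]
    (hν : GIndex.IsRiemannianVolume n ν)
    -- the unimodular locally compact group `G` with its Haar measure `μ`
    {G : Type*} [Group G] [TopologicalSpace G] [IsTopologicalGroup G] [LocallyCompactSpace G]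
    [T2Space G] [MeasurableSpace G] [BorelSpace G]
    (μ : Measure G) [μ.IsHaarMeasure] [μ.Regular] [μ.IsMulRightInvariant]
    -- the proper, cocompact, isometric action
    [MulAction G X] [ProperSMul G X] [CompactSpace (Quotient (MulAction.orbitRel G X))]
    (hG : GIndex.IsIsometricAction n G X)
    -- the Hermitian `G`-vector bundles `V₀` and `V₁`, even and odd part of the graded bundle
    {F₀ : Type*} [NormedAddCommGroup F₀] [NormedSpace ℂ F₀] [FiniteDimensional ℂ F₀]
    {V₀ : X → Type*} [TopologicalSpace (TotalSpace F₀ V₀)]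
    [∀ x, NormedAddCommGroup (V₀ x)] [∀ x, InnerProductSpace ℂ (V₀ x)] [FiberBundle F₀ V₀]
    [VectorBundle ℂ F₀ V₀] [VectorBundle ℝ F₀ V₀] [ContMDiffVectorBundle ∞ F₀ V₀ (𝓡 n)]
    [GIndex.IsSmoothHermitian n F₀ V₀] (ρ₀ : GIndex.BundleAction n G F₀ V₀)
    {F₁ : Type*} [NormedAddCommGroup F₁] [NormedSpace ℂ F₁] [FiniteDimensional ℂ F₁]
    {V₁ : X → Type*} [TopologicalSpace (TotalSpace F₁ V₁)]
    [∀ x, NormedAddCommGroup (V₁ x)] [∀ x, InnerProductSpace ℂ (V₁ x)] [FiberBundle F₁ V₁]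
    [VectorBundle ℂ F₁ V₁] [VectorBundle ℝ F₁ V₁] [ContMDiffVectorBundle ∞ F₁ V₁ (𝓡 n)]
    [GIndex.IsSmoothHermitian n F₁ V₁] (ρ₁ : GIndex.BundleAction n G F₁ V₁)
    -- the operator `P`, with lower left entry `P₀` and upper right entry `P₀'`, the formal adjoint
    (m : ℝ)
    (P₀ : GIndex.testSections n F₀ V₀ →ₗ[ℂ] GIndex.testSections n F₁ V₁)
    (P₀' : GIndex.testSections n F₁ V₁ →ₗ[ℂ] GIndex.testSections n F₀ V₀)
    (hadj : ∀ (u : GIndex.testSections n F₀ V₀) (v : GIndex.testSections n F₁ V₁),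
      ∫ x, ⟪(P₀ u).1 x, v.1 x⟫_ℂ ∂ν = ∫ x, ⟪u.1 x, (P₀' v).1 x⟫_ℂ ∂ν)
    (hP : GIndex.MemPsiGp ρ₀ ρ₁ m P₀)
    (hell : GIndex.IsElliptic F₁ m ((GIndex.testSections n F₁ V₁).subtype ∘ₗ P₀))
    -- the operator `Q` and the remainders `S₁`, `S₂`
    (Q : GIndex.L2 n F₁ V₁ ν →ₗ.[ℂ] GIndex.L2 n F₀ V₀ ν) (hQ : Q.IsClosable)
    (S₁ : GIndex.L2 n F₀ V₀ ν →L[ℂ] GIndex.L2 n F₀ V₀ ν)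
    (S₂ : GIndex.L2 n F₁ V₁ ν →L[ℂ] GIndex.L2 n F₁ V₁ ν)
    (hQ₁ : GIndex.LeftRemainder ν P₀ Q S₁) (hQ₂ : GIndex.RightRemainder ν P₀ Q S₂)
    (hS₁ : GIndex.IsGTraceClass ρ₀ S₁) (hS₂ : GIndex.IsGTraceClass ρ₁ S₂) :
    GIndex.IsGTraceClass ρ₀ (GIndex.kerOp ν P₀).starProjection ∧
    GIndex.IsGTraceClass ρ₁ (GIndex.kerAdj ν P₀).starProjection ∧
    -- whatever cutoff functions are used to compute the four traces
    ∀ c₀ c₁ d₀ d₁ : GIndex.CutoffPair n X μ,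
      (GIndex.l2Index ν P₀ c₀ c₁ : ℂ) = GIndex.gTrace d₀ S₁ - GIndex.gTrace d₁ S₂ := by

  have := GIndex.isInvInvariant_of_isMulRightInvariant μ
  have : LocallyCompactSpace X := ChartedSpace.locallyCompactSpace (EuclideanSpace ℝ (Fin n)) X
  have hm : ∀ g : G, MeasurePreserving (fun x : X => g • x) ν ν :=
    GIndex.measurePreserving_smul_of_isRiemannianVolume hν hG
  have hadj' : ∀ u v, ⟪GIndex.toL2 ν (P₀ u), GIndex.toL2 ν v⟫_ℂ =
      ⟪GIndex.toL2 ν u, GIndex.toL2 ν (P₀' v)⟫_ℂ := fun u v => by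
    rw [GIndex.inner_toL2, GIndex.inner_toL2, hadj]
  set L₀ := GIndex.bundleRep μ hG ρ₀ hm with hL₀
  set L₁ := GIndex.bundleRep μ hG ρ₁ hm with hL₁
  have hT₁ : GIndex.LocalRep.LocTC L₀ S₁ := hS₁.locTC
  have hT₂ : GIndex.LocalRep.LocTC L₁ S₂ := hS₂.locTC
  have he₀ : GIndex.LocalRep.Equivariant L₀ L₀ (GIndex.kerOp ν P₀).starProjection :=
    GIndex.equivariant_starProjection_kerOp hP.invariant
  have he₁ : GIndex.LocalRep.Equivariant L₁ L₁ (GIndex.kerAdj ν P₀).starProjection :=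
    GIndex.equivariant_starProjection_kerAdj hP.invariant
  have hp := GIndex.comp_starProjection_kerOp hQ hQ₁
  have hq := GIndex.starProjection_kerAdj_comp hQ₂
  -- The projections inherit the trace class property from `p = S₁ p` and `q = q S₂`.
  have hTp : GIndex.LocalRep.LocTC L₀ (GIndex.kerOp ν P₀).starProjection := hp ▸ hT₁.comp_right he₀
  have hTq : GIndex.LocalRep.LocTC L₁ (GIndex.kerAdj ν P₀).starProjection := hq ▸ hT₂.comp_left he₁
  have hHp := GIndex.LocalRep.locHS_of_projection he₀ (GIndex.adjoint_starProjection _)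
    (GIndex.starProjection_comp_self _) hTp
  have hHq := GIndex.LocalRep.locHS_of_projection he₁ (GIndex.adjoint_starProjection _)
    (GIndex.starProjection_comp_self _) hTq
  refine ⟨GIndex.isGTraceClass_starProjection hHp, GIndex.isGTraceClass_starProjection hHq,
    fun c₀ c₁ d₀ d₁ => ?_⟩
  have key := GIndex.LocalRep.tr_comp_starProjection_sub (L₀ := L₀) (L₁ := L₁)
    (GIndex.isClosed_closureGraph (ν := ν) (P₀ := P₀))
    (fun x => GIndex.eq_zero_of_inner_closureGraph)
    (fun y => GIndex.closureGraph_eq_zero hadj')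
    (fun g p => GIndex.unitaryOp_mem_closureGraph hm hP.invariant g)
    (fun p => GIndex.map_mem_closureGraph hQ₁ hQ₂) (fun x => GIndex.mem_kerOp)
    (fun y => GIndex.mem_kerAdj) he₀ he₁ hT₁ hT₂ (c := (d₀.c₁, d₀.c₂)) ⟨d₀, rfl⟩
  -- Here `tr (S₁ p) = tr p` and `tr (S₂ q) = tr (q S₂) = tr q`; independence of the cutoff pair
  -- then distributes the four given pairs.
  rw [hp, hT₂.tr_comp_comm he₁ ⟨d₀, rfl⟩ ⟨c₁, rfl⟩, hq, hTp.tr_eq ⟨d₀, rfl⟩ ⟨c₀, rfl⟩,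
    hT₂.tr_eq ⟨d₀, rfl⟩ ⟨d₁, rfl⟩] at key
  rw [GIndex.l2Index, Complex.ofReal_sub, GIndex.ofReal_gDim hHp, GIndex.ofReal_gDim hHq]
  exact key
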